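/- **Model.** Base stations form a homogeneous Poisson point process $\Phi\subset\mathbb R^2$ of density $\lambda>0$. Let $x_0,x_1,x_2,\dots$ be its points in order of increasing distance from the origin, where a typical user with $N_r=mN_t+\delta$ receive antennas is located ($N_t\ge1$, $m\ge1$, $\delta\ge0$ integers). The user is served by $x_0$. The fading vector $\mathbf h_{n,q}\in\mathbb C^{N_r}$ from the $q$-th antenna ($1\le q\le N_t$) of $x_n$ is $\mathcal{CN}(\mathbf 0,\mathbf I_{N_r})$; all these vectors are independent of each other and of $\Phi$. The path loss exponent is $\alpha>2$, and the noise variance is $\sigma^2$. To decode stream $\kappa$ of $x_0$, the partial zero-forcing (PZF) receiver uses $\mathbf v=\mathbf p/\|\mathbf p\|$, where $\mathbf p$ is the orthogonal projection of $\mathbf h_{0,\kappa}$ onto the orthogonal complement of the span of the vectors $\mathbf h_{0,q}$ ($q\ne\kappa$) and $\mathbf h_{n,q}$ ($1\le n\le m-1$, $1\le q\le N_t$). Its post-processing SINR and coverage probability are $$\mathtt{SINR}=\frac{|\mathbf v^\dagger\mathbf h_{0,\kappa}|^2\,\|x_0\|^{-\alpha}}{N_t\sigma^2+\sum_{n\ge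 m}\|x_n\|^{-\alpha}\sum_{q=1}^{N_t}|\mathbf v^\dagger\mathbf h_{n,q}|^2},\qquad \mathtt P_{\mathtt{PZF}}(z)=\mathbb P[\mathtt{SINR}>z].$$ **Notation.** $(x)_n=\Gamma(x+n)/\Gamma(x)=x(x+1)\cdots(x+n-1)$ is the Pochhammer symbol; $\mathcal S_k$ is the set of all set partitions of $\{1,\dots,k\}$; for $\upsilon\in\mathcal S_k$, $|\upsilon|$ is the number of blocks and $|\upsilon|_j$ the number of blocks with exactly $j$ elements; and $$\Lambda_{j,N_t}(w)={}_2F_1\!\left(N_t+j,\;j-\tfrac2\alpha;\;j-\tfrac2\alpha+1;\;-w\right),\qquad w\ge 0,$$ where ${}_2F_1$ is the Gauss hypergeometric function, analytically continued to $(-\infty,1)$. **Theorem.** Suppose that the network is interference limited, i.e. $\sigma^2=0$. Then for every $z\ge0$ $$\mathtt P_{\mathtt{PZF}}(z)=\sum_{k=0}^{\delta}\frac{z^k}{k!}\sum_{\upsilon\in\mathcal S_k}(-1)^{|\upsilon|}(m)_{|\upsilon|}\;\mathbb E_\beta\!\left[\frac{\beta^{-\alpha k}}{\Lambda_{0,N_t}(\beta^{-\alpha}z)^m}\prod_{j=1}^k\left(\frac{(N_t)_j\,(-\frac2\alpha)_j}{(\frac{\alpha-2}{\alpha})_j}\,\frac{\Lambda_{j,N_t}(\beta^{-\alpha}z)}{\Lambda_{0,N_t}(\beta^{-\alpha}z)}\right)^{|\upsilon|_j}\right],$$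 where all expectations exist and are finite, and $\beta=\|x_{m-1}\|/\|x_0\|$ is the ratio of the distance to the $(m-1)$-th nearest interfering base station to the distance to the serving one. If $m\ge2$, then $\beta$ has the density $g(\beta)=2(m-1)\beta^{1-2m}(\beta^2-1)^{m-2}$ on $\beta>1$; if $m=1$, then $\beta=1$ almost surely. -/

import Mathlib

open MeasureTheory ProbabilityTheory

namespace PZF

noncomputable section

/-! ### The Gauss hypergeometric function on the half-line `(-∞, 1)` -/

/-- `F` is the (real-)analytic continuation to `(-∞, 1)` of the Gauss hypergeometric series with
parameters `a, b; c`, which itself converges only on `(-1, 1)`. -/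
def IsGaussHypergeometric (a b c : ℝ) (F : ℝ → ℝ) : Prop :=
  AnalyticOnNhd ℝ F (Set.Iio 1) ∧
    ∀ x : ℝ, |x| < 1 → F x = ordinaryHypergeometric a b c x

open Classical in
/-- The standard hypergeometric function `₂F₁(a, b; c; x)` for real `x < 1`: the analytic
continuation of the Gauss series along `(-∞, 1)`. -/
def hyp2F1 (a b c x : ℝ) : ℝ :=
  if h : ∃ F : ℝ → ℝ, IsGaussHypergeometric a b c F then h.choose x else 0

/-- The continuation is unique, so `hyp2F1` does not depend on the choice made in its definition. -/
theorem IsGaussHypergeometric.hyp2F1_eq {a b c : ℝ} {F : ℝ → ℝ}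
    (hF : IsGaussHypergeometric a b c F) {x : ℝ} (hx : x < 1) : hyp2F1 a b c x = F x := by
  have h : ∃ F : ℝ → ℝ, IsGaussHypergeometric a b c F := ⟨F, hF⟩
  unfold hyp2F1
  rw [dif_pos h]
  refine h.choose_spec.1.eqOn_of_preconnected_of_eventuallyEq hF.1 isPreconnected_Iio
    (z₀ := 0) (by simp) ?_ hx
  filter_upwards [Metric.ball_mem_nhds (0 : ℝ) one_pos] with y hy
  have hy' : |y| < 1 := by simpa [Real.dist_eq] using hy
  rw [h.choose_spec.2 y hy', hF.2 y hy']

/-- `Λ_{j, N_t}(w) = ₂F₁(N_t + j, j - 2/α; j - 2/α + 1; -w)`. -/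
def Lam (α : ℝ) (Nt j : ℕ) (w : ℝ) : ℝ :=
  hyp2F1 ((Nt : ℝ) + j) ((j : ℝ) - 2 / α) ((j : ℝ) - 2 / α + 1) (-w)

/-- The Pochhammer symbol `(x)_n = x (x + 1) ⋯ (x + n - 1)`. -/
def poch (x : ℝ) (n : ℕ) : ℝ := (ascPochhammer ℝ n).eval x

/-! ### The network -/

/-- The plane. -/
abbrev Plane : Type := EuclideanSpace ℝ (Fin 2)

/-- The number (possibly `∞`) of points of `Φ ω` in the set `A`. -/
def count {Ω : Type*} (Φ : Ω → Set Plane) (A : Set Plane) (ω : Ω) : ℕ∞ := (Φ ω ∩ A).encard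

/-- `Φ` is a homogeneous Poisson point process of intensity `lam` in the plane: counts of Borel sets
are random variables, the count of a Borel set of finite area is Poisson with mean `lam` times
the area, and the counts of pairwise disjoint Borel sets are independent. -/
structure IsPoissonPointProcess {Ω : Type*} [MeasurableSpace Ω] (Φ : Ω → Set Plane)
    (lam : ℝ) (P : Measure Ω) : Prop where
  measurable_count : ∀ A : Set Plane, MeasurableSet A → Measurable (count Φ A)
  count_law : ∀ A : Set Plane, MeasurableSet A → volume A < ⊤ →
    HasLaw (count Φ A)
      ((poissonMeasure (lam * (volume A).toReal).toNNReal).map (Nat.cast : ℕ → ℕ∞)) P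
  indep : ∀ (n : ℕ) (A : Fin n → Set Plane), (∀ i, MeasurableSet (A i)) →
    Pairwise (fun i j => Disjoint (A i) (A j)) → iIndepFun (fun i => count Φ (A i)) P

/-- `X 0, X 1, X 2, …` is the labelling of the points of `Φ` by increasing distance from the typical
user at the origin. So `X 0` is the serving base station, and `X 1, X 2, …` are the interfering
base stations, nearest first. -/
structure IsNearestFirstLabelling {Ω : Type*} [MeasurableSpace Ω] (X : ℕ → Ω → Plane)
    (Φ : Ω → Set Plane) (P : Measure Ω) : Prop where
  measurable : ∀ n, Measurable (X n)
  ae_labelling : ∀ᵐ ω ∂P, Function.Injective (fun n => X n ω) ∧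
    Set.range (fun n => X n ω) = Φ ω ∧ Monotone (fun n => ‖X n ω‖)

/-- The circularly symmetric complex Gaussian law `𝒞𝒩(0, 1)`: independent real and imaginary
parts, each `𝒩(0, 1/2)`. -/
def stdComplexGaussian : Measure ℂ :=
  ((gaussianReal 0 (1 / 2)).prod (gaussianReal 0 (1 / 2))).map
    (fun p : ℝ × ℝ => (⟨p.1, p.2⟩ : ℂ))

/-- The circularly symmetric complex Gaussian law `𝒞𝒩(0, I_N)` on `ℂ^N`. -/
def stdComplexGaussianVec (N : ℕ) : Measure (EuclideanSpace ℂ (Fin N)) :=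
  (Measure.pi fun _ : Fin N => stdComplexGaussian).map (WithLp.toLp 2)

/-- Rayleigh fading: `h n q` is the fading vector from the `q`-th antenna of the base station
`X n` to the typical user. The vectors are i.i.d. `𝒞𝒩(0, I)` and independent of the locations. -/
structure IsRayleighFading {Ω : Type*} [MeasurableSpace Ω] {Nt Nr : ℕ}
    (h : ℕ → Fin Nt → Ω → EuclideanSpace ℂ (Fin Nr)) (X : ℕ → Ω → Plane)
    (P : Measure Ω) : Prop where
  measurable : ∀ n q, Measurable (h n q)
  law : ∀ n q, HasLaw (h n q) (stdComplexGaussianVec Nr) P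
  indep : iIndepFun (fun (i : ℕ × Fin Nt) => h i.1 i.2) P
  indep_locations :
    IndepFun (fun ω (n : ℕ) => X n ω) (fun ω (i : ℕ × Fin Nt) => h i.1 i.2 ω) P

/-! ### The partial zero-forcing receiver

In this part `x : ℕ → Plane` and `h : ℕ → Fin Nt → ℂ^Nr` are one realization of the locations
(labelled by increasing distance) and of the fading vectors, and `κ` is the stream of
interest. -/

/-- The span of the channel vectors that the receiver nulls: those of the other streams of the
serving base station, and those of all streams of the `m - 1` nearest interfering ones. -/
def nulledSpan {Nt Nr : ℕ} (m : ℕ) (κ : Fin Nt) (h : ℕ → Fin Nt → EuclideanSpace ℂ (Fin Nr)) :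
    Submodule ℂ (EuclideanSpace ℂ (Fin Nr)) :=
  Submodule.span ℂ
    ({w | ∃ q, q ≠ κ ∧ w = h 0 q} ∪ {w | ∃ n q, 1 ≤ n ∧ n ≤ m - 1 ∧ w = h n q})

/-- The orthogonal projection of the desired channel vector on the orthogonal complement of the
nulled vectors (`Q Q† h` for an orthonormal basis `Q` of that complement). -/
def projectedChannel {Nt Nr : ℕ} (m : ℕ) (κ : Fin Nt)
    (h : ℕ → Fin Nt → EuclideanSpace ℂ (Fin Nr)) : EuclideanSpace ℂ (Fin Nr) :=
  (nulledSpan m κ h)ᗮ.starProjection (h 0 κ)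

/-- The partial zero-forcing receive filter: the normalized projection. Among the unit vectors
orthogonal to the nulled channel vectors it maximizes the received signal power. -/
def filter {Nt Nr : ℕ} (m : ℕ) (κ : Fin Nt) (h : ℕ → Fin Nt → EuclideanSpace ℂ (Fin Nr)) :
    EuclideanSpace ℂ (Fin Nr) :=
  ((‖projectedChannel m κ h‖⁻¹ : ℝ) : ℂ) • projectedChannel m κ h

/-- The power `|v† w|²` of the channel vector `w` after the receive filter `v`. -/
def gain {Nr : ℕ} (v w : EuclideanSpace ℂ (Fin Nr)) : ℝ := ‖inner ℂ v w‖ ^ 2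

/-- The residual interference
`∑ ‖x_n‖^{-α} ∑_q |v† h_{n,q}|²` over the base stations that are neither the serving one nor
cancelled, that is over all `n ≥ m`. -/
def residualInterference {Nt Nr : ℕ} (α : ℝ) (m : ℕ) (κ : Fin Nt) (x : ℕ → Plane)
    (h : ℕ → Fin Nt → EuclideanSpace ℂ (Fin Nr)) : ENNReal :=
  ∑' n : {n : ℕ // m ≤ n},
    ENNReal.ofReal (‖x n‖ ^ (-α) * ∑ q : Fin Nt, gain (filter m κ h) (h n q))

/-- The post-processing signal-to-interference-plus-noise ratio of the stream `κ`, with noise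
variance `noiseVar` and path loss exponent `α`. -/
def sinr {Nt Nr : ℕ} (α noiseVar : ℝ) (m : ℕ) (κ : Fin Nt) (x : ℕ → Plane)
    (h : ℕ → Fin Nt → EuclideanSpace ℂ (Fin Nr)) : ENNReal :=
  ENNReal.ofReal (gain (filter m κ h) (h 0 κ) * ‖x 0‖ ^ (-α)) /
    (ENNReal.ofReal (Nt * noiseVar) + residualInterference α m κ x h)

/-- The coverage probability `ℙ[SINR > z]`. -/
def coverage {Ω : Type*} [MeasurableSpace Ω] {Nt Nr : ℕ} (α noiseVar : ℝ) (m : ℕ) (κ : Fin Nt)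
    (X : ℕ → Ω → Plane) (h : ℕ → Fin Nt → Ω → EuclideanSpace ℂ (Fin Nr)) (P : Measure Ω)
    (z : ℝ) : ℝ :=
  P.real {ω | ENNReal.ofReal z <
    sinr α noiseVar m κ (fun n => X n ω) (fun n q => h n q ω)}

/-! ### The closed form -/

/-- `β = R / r`, where `R` is the distance to the `(m-1)`-th nearest interfering base station and
`r` the distance to the serving one (`R = r` when `m = 1`). -/
def ratio {Ω : Type*} (X : ℕ → Ω → Plane) (m : ℕ) (ω : Ω) : ℝ := ‖X (m - 1) ω‖ / ‖X 0 ω‖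

/-- The density `2 (m-1) b^{1-2m} (b² - 1)^{m-2}` on `b > 1` (meant for `m ≥ 2`). -/
def ratioDensity (m : ℕ) (b : ℝ) : ℝ :=
  if 1 < b then 2 * ((m : ℝ) - 1) * b ^ (1 - 2 * (m : ℤ)) * (b ^ 2 - 1) ^ (m - 2) else 0

/-- The number of blocks of the set partition `υ` that have exactly `j` elements. -/
def blocksOfSize {k : ℕ} (υ : Finpartition (Finset.Icc 1 k)) (j : ℕ) : ℕ :=
  (υ.parts.filter (fun B => B.card = j)).card

/-- The expression under the expectation over `β` that belongs to the set partition `υ` of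
`{1, …, k}`, at `β = b`. -/
def partitionTerm (α : ℝ) (Nt m : ℕ) (z : ℝ) {k : ℕ} (υ : Finpartition (Finset.Icc 1 k))
    (b : ℝ) : ℝ :=
  b ^ (-(α * k)) / Lam α Nt 0 (b ^ (-α) * z) ^ m *
    ∏ j ∈ Finset.Icc 1 k,
      (poch Nt j * poch (-(2 / α)) j / poch ((α - 2) / α) j *
        (Lam α Nt j (b ^ (-α) * z) / Lam α Nt 0 (b ^ (-α) * z))) ^ blocksOfSize υ j

end

end PZF

/-!
The points `T n = πλ‖X n‖²` form a Poisson process of rate one on the half-line, whose waiting times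
are independent standard exponentials (`IsUnitPoisson.hasLaw_gap`). The receive filter is a unit
vector orthogonal to the `m N_t - 1` nulled channel vectors, which are almost surely linearly
independent. By unitary invariance of the complex Gaussian law, the signal power after the filter has
the Gamma law of shape `δ + 1`, the powers of the interfering streams are standard exponentials, and
all of these and the positions are independent (`IsRayleighFading.map_powers`).

Let `Y` be the interference divided by the path loss of the serving station. Without noise, coverage
means that the signal power exceeds `z Y`, and the tail of the Gamma law gives the coverage
probability `∑_{k ≤ δ} z^k / k! · E[Y^k e^{-zY}]` (`coverage_eq_integral`), that is, derivatives of
the Laplace transform of `Y` at `z`.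

That transform is `E[Λ₀(c β^{-α})^{-m}]` (`IsUnitPoisson.lintegral_expNeg_relInterference`). Averaging
over the fading replaces each interfering station by a factor `(1 + y)^{-N_t}`. The process restarts
at `T (m - 1)`, so the Laplace functional (`IsUnitPoisson.laplace`) turns the product over the further
points into `exp (-T (m - 1) (Λ₀(c β^{-α}) - 1))`, where `Λ₀` enters through its Euler integral
(`hyp2F1_eq_eulerInt`, `lintegral_one_sub_eq_Lam`). As `T (m - 1)` has the Gamma law of shape `m` and
is independent of `β = √(T (m - 1) / T 0)` (`IsUnitPoisson.map_ratio`), averaging over it gives the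
power `-m`. The substitution `a = u / b²` behind this independence also yields the density of `β`.

The two expressions for the transform may be differentiated under the expectation
(`integral_pow_mul_exp_eq`), because `β^{-α} ≤ 1`. The derivatives of `Λ₀` are multiples of the `Λ_j`,
and Faà di Bruno's formula for `Λ₀^{-m}`, by induction on the number of elements of the partitioned
set (`sum_finpartition_insert`, `hasDerivAt_negPowDeriv`), produces the sum over set partitions
(`integral_partitionTerm`).
-/

namespace PZF

/-! ### Euler's integral for the hypergeometric function -/

/-- The Euler-type integral `1 + b ∫₀¹ s^{b-1} ((1 - z s)^{-a} - 1) ds`, which represents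
`₂F₁(a, b; b + 1; z)` for a natural number `a`. Subtracting `1` under the integral makes it converge
for all `b > -1`, so that `j = 0` (where `b = -2/α < 0`) needs no separate treatment. -/
noncomputable def eulerInt (a : ℕ) (b : ℝ) (z : ℂ) : ℂ :=
  1 + b * ∫ s in Set.Ioc (0 : ℝ) 1, ((s ^ (b - 1) : ℝ) : ℂ) * (((1 - z * s) ^ a)⁻¹ - 1)

theorem one_sub_mul_mem_slitPlane {z : ℂ} (hz : 1 - z ∈ Complex.slitPlane) {s : ℝ} (h0 : 0 ≤ s)
    (h1 : s ≤ 1) : 1 - z * s ∈ Complex.slitPlane := by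
  have h := StarConvex.add_smul_mem Complex.starConvex_one_slitPlane
    (x := (1 : ℂ)) (y := -z) (by simpa [sub_eq_add_neg] using hz) h0 h1
  simpa [sub_eq_add_neg, mul_comm] using h

/-- The singularity of the integrand stays uniformly away from a neighbourhood of `z`, which allows
differentiation under the integral sign. -/
theorem exists_ball_le_norm_one_sub_mul {z : ℂ} (hz : 1 - z ∈ Complex.slitPlane) :
    ∃ ε > 0, ∃ c > 0, ∀ y ∈ Metric.ball z ε, ∀ s ∈ Set.Icc (0 : ℝ) 1, c ≤ ‖1 - y * (s : ℂ)‖ := by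
  obtain ⟨s0, hs0, hmin⟩ := (isCompact_Icc (a := (0 : ℝ)) (b := 1)).exists_isMinOn
    (Set.nonempty_Icc.2 zero_le_one) (f := fun s : ℝ => ‖1 - z * (s : ℂ)‖)
    (by fun_prop)
  have hpos : 0 < ‖1 - z * (s0 : ℂ)‖ :=
    norm_pos_iff.2 (Complex.slitPlane_ne_zero (one_sub_mul_mem_slitPlane hz hs0.1 hs0.2))
  refine ⟨‖1 - z * (s0 : ℂ)‖ / 2, by positivity, ‖1 - z * (s0 : ℂ)‖ / 2, by positivity,
    fun y hy s hs => ?_⟩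
  have h1 : ‖1 - z * (s0 : ℂ)‖ ≤ ‖1 - z * (s : ℂ)‖ := hmin hs
  have h2 : ‖(1 - z * (s : ℂ)) - (1 - y * (s : ℂ))‖ ≤ ‖y - z‖ := by
    have : (1 - z * (s : ℂ)) - (1 - y * (s : ℂ)) = (y - z) * (s : ℂ) := by ring
    rw [this, norm_mul, Complex.norm_real, Real.norm_of_nonneg hs.1]
    exact mul_le_of_le_one_right (norm_nonneg _) hs.2
  have h3 := norm_sub_norm_le (1 - z * (s : ℂ)) (1 - y * (s : ℂ))
  rw [Metric.mem_ball, dist_eq_norm] at hy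
  linarith

theorem integrableOn_rpow_Ioc {b : ℝ} (hb : -1 < b) :
    IntegrableOn (fun s : ℝ => s ^ b) (Set.Ioc 0 1) := by
  have := intervalIntegral.intervalIntegrable_rpow' (a := 0) (b := 1) hb
  rwa [intervalIntegrable_iff_integrableOn_Ioc_of_le zero_le_one] at this

theorem integral_rpow_Ioc {b : ℝ} (hb : -1 < b) :
    ∫ s in Set.Ioc (0 : ℝ) 1, s ^ b = 1 / (b + 1) := by
  rw [← intervalIntegral.integral_of_le zero_le_one, integral_rpow (Or.inl hb)]
  rw [Real.one_rpow, Real.zero_rpow (by linarith)]; simp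

/-- The factor `‖1 - y‖`, which is `‖z‖ s` for `y = 1 - z s`, compensates the singularity of
`s ^ (b - 1)` at `0`. -/
theorem norm_inv_pow_sub_one_le {y : ℂ} {c M : ℝ} (hc : 0 < c) (hcy : c ≤ ‖y‖) (hM : ‖y‖ ≤ M)
    (a : ℕ) : ‖(y ^ a)⁻¹ - 1‖ ≤ ‖1 - y‖ * ((∑ i ∈ Finset.range a, M ^ i) * (c ^ a)⁻¹) := by
  have hy : y ≠ 0 := norm_pos_iff.1 (hc.trans_le hcy)
  have h1 : (y ^ a)⁻¹ - 1 = (1 - y) * ((∑ i ∈ Finset.range a, y ^ i) * (y ^ a)⁻¹) := by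
    have h2 := mul_neg_geom_sum y a
    rw [← mul_assoc, h2, sub_mul, one_mul, mul_inv_cancel₀ (pow_ne_zero _ hy)]
  rw [h1, norm_mul, norm_mul, norm_inv, norm_pow]
  have hM0 : 0 ≤ M := (norm_nonneg _).trans hM
  have hM1 : 0 ≤ ∑ i ∈ Finset.range a, M ^ i := by positivity
  gcongr
  refine (norm_sum_le (Finset.range a) fun i => y ^ i).trans (Finset.sum_le_sum fun i _ => ?_)
  rw [norm_pow]
  gcongr

theorem integrableOn_eulerInt {z : ℂ} (hz : 1 - z ∈ Complex.slitPlane) (a : ℕ) {b : ℝ}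
    (hb : -1 < b) :
    IntegrableOn (fun s : ℝ => ((s ^ (b - 1) : ℝ) : ℂ) * (((1 - z * s) ^ a)⁻¹ - 1))
      (Set.Ioc 0 1) := by
  obtain ⟨ε, hε, c, hc, h⟩ := exists_ball_le_norm_one_sub_mul hz
  have hzball := h z (Metric.mem_ball_self hε)
  set C := ‖z‖ * ((∑ i ∈ Finset.range a, (1 + ‖z‖) ^ i) * (c ^ a)⁻¹)
  refine Integrable.mono' (g := fun s => C * s ^ b) ((integrableOn_rpow_Ioc hb).const_mul C)
    (by fun_prop) ?_
  filter_upwards [ae_restrict_mem measurableSet_Ioc] with s hs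
  have hs' : s ∈ Set.Icc (0 : ℝ) 1 := ⟨hs.1.le, hs.2⟩
  have h1 := norm_inv_pow_sub_one_le hc (hzball s hs') (M := 1 + ‖z‖) (by
    refine (norm_sub_le _ _).trans ?_
    rw [norm_one, norm_mul, Complex.norm_real, Real.norm_of_nonneg hs'.1]
    gcongr
    exact mul_le_of_le_one_right (norm_nonneg _) hs'.2) a
  have h2 : ‖1 - (1 - z * (s : ℂ))‖ = ‖z‖ * s := by
    rw [sub_sub_cancel, norm_mul, Complex.norm_real, Real.norm_of_nonneg hs'.1]
  rw [h2] at h1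
  rw [norm_mul, Complex.norm_real, Real.norm_of_nonneg (Real.rpow_nonneg hs'.1 _)]
  have h3 : s ^ b = s ^ (b - 1) * s := by
    rw [← Real.rpow_add_one hs.1.ne']; simp
  calc _ ≤ s ^ (b - 1) * (‖z‖ * s * ((∑ i ∈ Finset.range a, (1 + ‖z‖) ^ i) * (c ^ a)⁻¹)) := by
        have := Real.rpow_nonneg hs'.1 (b - 1)
        gcongr
    _ = C * s ^ b := by rw [h3]; ring

/-- Differentiation raises both parameters by one: this is `d/dz ₂F₁(a, b; b+1; z) =
(ab/(b+1)) ₂F₁(a+1, b+1; b+2; z)`. -/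
theorem hasDerivAt_eulerInt {z : ℂ} (hz : 1 - z ∈ Complex.slitPlane) (a : ℕ) {b : ℝ}
    (hb : -1 < b) :
    HasDerivAt (eulerInt a b) ((a * b / (b + 1) : ℝ) * eulerInt (a + 1) (b + 1) z) z := by
  obtain ⟨ε, hε, c, hc, h⟩ := exists_ball_le_norm_one_sub_mul hz
  have hmain := hasDerivAt_integral_of_dominated_loc_of_deriv_le
    (μ := volume.restrict (Set.Ioc (0 : ℝ) 1)) (x₀ := z) (s := Metric.ball z ε)
    (F := fun (y : ℂ) (s : ℝ) => ((s ^ (b - 1) : ℝ) : ℂ) * (((1 - y * s) ^ a)⁻¹ - 1))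
    (F' := fun (y : ℂ) (s : ℝ) => (a : ℂ) * (((s ^ b : ℝ) : ℂ) * ((1 - y * s) ^ (a + 1))⁻¹))
    (bound := fun s => a * (c ^ (a + 1))⁻¹ * s ^ b)
    (Metric.ball_mem_nhds z hε) (Filter.Eventually.of_forall fun y => by fun_prop)
    (integrableOn_eulerInt hz a hb) (by fun_prop) ?_
    ((integrableOn_rpow_Ioc hb).const_mul _) ?_
  · have h2 : ∫ s in Set.Ioc (0 : ℝ) 1, (a : ℂ) * (((s ^ b : ℝ) : ℂ) * ((1 - z * s) ^ (a + 1))⁻¹)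
        = a * (1 / (b + 1) * eulerInt (a + 1) (b + 1) z) := by
      have hb' : (b : ℂ) + 1 ≠ 0 := by
        have : (b + 1 : ℝ) ≠ 0 := by linarith
        exact_mod_cast this
      rw [integral_const_mul]
      congr 1
      have h3 := integrableOn_eulerInt hz (a + 1) (b := b + 1) (by linarith)
      have h4 := (integrableOn_rpow_Ioc hb).ofReal (𝕜 := ℂ)
      have h5 := integral_add h3 h4
      have h6 : ∫ s in Set.Ioc (0 : ℝ) 1, ((s ^ b : ℝ) : ℂ) = ((1 / (b + 1) : ℝ) : ℂ) := by
        rw [integral_complex_ofReal, integral_rpow_Ioc hb]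
      have h7 : ∀ s : ℝ, ((s ^ b : ℝ) : ℂ) * ((1 - z * s) ^ (a + 1))⁻¹ =
          ((s ^ (b + 1 - 1) : ℝ) : ℂ) * (((1 - z * s) ^ (a + 1))⁻¹ - 1) + ((s ^ b : ℝ) : ℂ) := by
        intro s; rw [add_sub_cancel_right]; ring
      simp_rw [h7]
      erw [h5]
      erw [h6]
      unfold eulerInt
      push_cast
      field_simp
      ring
    have h3 := (hmain.2.const_mul (b : ℂ)).const_add 1
    rw [h2] at h3
    unfold eulerInt at *
    convert! h3 using 1
    push_cast
    ring
  · filter_upwards [ae_restrict_mem measurableSet_Ioc] with s hs y hy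
    have hcy := h y hy s ⟨hs.1.le, hs.2⟩
    rw [norm_mul, norm_mul, norm_inv, norm_pow, Complex.norm_real, Complex.norm_natCast,
      Real.norm_of_nonneg (Real.rpow_nonneg hs.1.le _), mul_assoc, mul_comm (s ^ b)]
    have := Real.rpow_nonneg hs.1.le b
    gcongr
  · filter_upwards [ae_restrict_mem measurableSet_Ioc] with s hs y hy
    have hcy := h y hy s ⟨hs.1.le, hs.2⟩
    have hne : 1 - y * (s : ℂ) ≠ 0 := norm_pos_iff.1 (hc.trans_le hcy)
    have h1 : HasDerivAt (fun y : ℂ => 1 - y * (s : ℂ)) (-(s : ℂ)) y := by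
      simpa using ((hasDerivAt_id y).mul_const (s : ℂ)).const_sub 1
    have h2 := (((h1.pow a).inv (pow_ne_zero _ hne)).sub_const 1).const_mul
      ((s ^ (b - 1) : ℝ) : ℂ)
    convert! h2 using 1
    have h3 : s ^ b = s ^ (b - 1) * s := by
      rw [← Real.rpow_add_one hs.1.ne']; simp
    rw [h3]
    rcases a with _ | a
    · simp
    · simp only [Pi.pow_apply, Nat.add_sub_cancel]
      push_cast
      clear h1 h2
      generalize 1 - y * (s : ℂ) = u at *
      field_simp
      ring

theorem eulerInt_zero (a : ℕ) (b : ℝ) : eulerInt a b 0 = 1 := by simp [eulerInt]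

theorem iteratedDeriv_eulerInt (n : ℕ) (a : ℕ) {b : ℝ} (hb : -1 < b) {z : ℂ}
    (hz : 1 - z ∈ Complex.slitPlane) :
    iteratedDeriv n (eulerInt a b) z =
      ((poch a n * poch b n / poch (b + 1) n : ℝ) : ℂ) * eulerInt (a + n) (b + n) z := by
  induction n generalizing z with
  | zero => simp [poch]
  | succ n ih =>
    have hopen : IsOpen {z : ℂ | 1 - z ∈ Complex.slitPlane} :=
      Complex.isOpen_slitPlane.preimage (by fun_prop)
    rw [iteratedDeriv_succ]
    have hev : iteratedDeriv n (eulerInt a b) =ᶠ[nhds z] fun z =>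
        ((poch a n * poch b n / poch (b + 1) n : ℝ) : ℂ) * eulerInt (a + n) (b + n) z := by
      filter_upwards [hopen.mem_nhds hz] with y hy using ih hy
    have hbn : -1 < b + n := by have : (0 : ℝ) ≤ n := n.cast_nonneg; linarith
    rw [hev.deriv_eq, ((hasDerivAt_eulerInt hz (a + n) hbn).const_mul _).deriv, ← mul_assoc]
    have e1 : (b + n + 1 : ℝ) = b + (n + 1 : ℕ) := by push_cast; ring
    rw [e1, add_assoc a n 1]
    congr 1
    rw [← Complex.ofReal_mul]
    congr 1
    simp only [poch, ascPochhammer_succ_eval]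
    push_cast
    rw [show b + 1 + (n : ℝ) = b + (n + 1) by ring, div_mul_div_comm]
    congr 1
    ring

theorem one_sub_ofReal_mem_slitPlane {x : ℝ} (hx : x < 1) :
    1 - (x : ℂ) ∈ Complex.slitPlane := by
  rw [← Complex.ofReal_one, ← Complex.ofReal_sub, Complex.ofReal_mem_slitPlane]
  linarith

/-- The integral is analytic on `1 - z ∈ slitPlane`, which contains the half-line `(-∞, 1)`, and its
Taylor coefficients at `0` are those of the Gauss series, so it is the analytic continuation. -/
theorem hyp2F1_eq_eulerInt (a : ℕ) {b : ℝ} (hb : -1 < b) {x : ℝ} (hx : x < 1) :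
    hyp2F1 a b (b + 1) x = (eulerInt a b x).re := by
  refine IsGaussHypergeometric.hyp2F1_eq (F := fun x : ℝ => (eulerInt a b x).re) ⟨?_, ?_⟩ hx
  · intro x hx
    have hopen : IsOpen {z : ℂ | 1 - z ∈ Complex.slitPlane} :=
      Complex.isOpen_slitPlane.preimage (by fun_prop)
    have hd : DifferentiableOn ℂ (eulerInt a b) {z : ℂ | 1 - z ∈ Complex.slitPlane} :=
      fun z hz => (hasDerivAt_eulerInt hz a hb).differentiableAt.differentiableWithinAt
    have han : AnalyticAt ℝ (eulerInt a b) (x : ℂ) :=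
      (hd.analyticAt (hopen.mem_nhds (one_sub_ofReal_mem_slitPlane hx))).restrictScalars
    have h1 : AnalyticAt ℝ (fun x : ℝ => (x : ℂ)) x := Complex.ofRealCLM.analyticAt x
    have h2 : AnalyticAt ℝ (fun x : ℝ => eulerInt a b (x : ℂ)) x := han.comp h1
    exact (Complex.reCLM.analyticAt _).comp h2
  · intro x hx
    have hd : DifferentiableOn ℂ (eulerInt a b) (Metric.ball 0 1) := fun z hz => by
      refine (hasDerivAt_eulerInt ?_ a hb).differentiableAt.differentiableWithinAt
      left
      have h1 := Complex.re_le_norm z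
      have h2 : ‖z‖ < 1 := by simpa using hz
      simp only [Complex.sub_re, Complex.one_re]; linarith
    have hs := Complex.hasSum_taylorSeries_on_ball hd (z := (x : ℂ)) (by simpa using hx)
    have hs' := Complex.reCLM.hasSum hs
    rw [ordinaryHypergeometric_eq_tsum]
    refine (hs'.tsum_eq.symm.trans ?_)
    refine tsum_congr fun n => ?_
    rw [iteratedDeriv_eulerInt n a hb (by simp), eulerInt_zero, sub_zero,
      mul_one]
    simp only [smul_eq_mul, Complex.reCLM_apply]
    rw [← Complex.ofReal_pow, ← Complex.ofReal_natCast, ← Complex.ofReal_inv, ← Complex.ofReal_mul,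
      ← Complex.ofReal_mul, Complex.ofReal_re]
    simp only [poch]
    field_simp

theorem eulerInt_ofReal (a : ℕ) (b x : ℝ) :
    eulerInt a b x = ((1 + b * ∫ s in Set.Ioc (0 : ℝ) 1,
      s ^ (b - 1) * (((1 - x * s) ^ a)⁻¹ - 1) : ℝ) : ℂ) := by
  unfold eulerInt
  push_cast
  rw [← integral_complex_ofReal]
  push_cast
  rfl

/-! ### The functions `Λ_j` -/

/-- `Λ_j` as an Euler integral; the hypothesis `α > 2` ensures `j - 2/α > -1`. -/
theorem Lam_eq {α : ℝ} (hα : 2 < α) (Nt j : ℕ) {w : ℝ} (hw : -1 < w) :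
    Lam α Nt j w = (eulerInt (Nt + j) (j - 2 / α) (-w : ℝ)).re := by
  have h1 : 2 / α < 1 := by rw [div_lt_one (by linarith)]; exact hα
  have h2 : (0 : ℝ) ≤ j := j.cast_nonneg
  have := hyp2F1_eq_eulerInt (Nt + j) (b := j - 2 / α) (by linarith) (x := -w) (by linarith)
  rw [← this, Lam]
  push_cast
  rfl

theorem hasDerivAt_Lam {α : ℝ} (hα : 2 < α) (Nt j : ℕ) {w : ℝ} (hw : -1 < w) :
    HasDerivAt (Lam α Nt j)
      (-((Nt + j) * (j - 2 / α) / (j - 2 / α + 1)) * Lam α Nt (j + 1) w) w := by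
  have h1 : 2 / α < 1 := by rw [div_lt_one (by linarith)]; exact hα
  have h2 : (0 : ℝ) ≤ j := j.cast_nonneg
  have hev : Lam α Nt j =ᶠ[nhds w] fun w => (eulerInt (Nt + j) (j - 2 / α) (-w : ℝ)).re := by
    filter_upwards [Ioi_mem_nhds hw] with y hy using Lam_eq hα Nt j hy
  refine HasDerivAt.congr_of_eventuallyEq ?_ hev
  have h3 := (hasDerivAt_eulerInt (one_sub_ofReal_mem_slitPlane (x := -w) (by linarith)) (Nt + j)
    (b := j - 2 / α) (by linarith)).real_of_complex
  have h4 := HasDerivAt.comp (h₂ := fun x : ℝ => (eulerInt (Nt + j) (j - 2 / α) x).re) w h3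
    (hasDerivAt_neg w)
  refine h4.congr_deriv ?_
  rw [Lam_eq hα Nt (j + 1) hw, Complex.re_ofReal_mul,
    show ((j + 1 : ℕ) : ℝ) - 2 / α = j - 2 / α + 1 by push_cast; ring, add_assoc]
  push_cast
  ring

/-- `Λ₀ = 1 + (2/α) ∫₀¹ s^{-2/α-1} (1 - (1 + w s)^{-N_t}) ds`, the form in which it arises from the
Laplace functional. -/
theorem Lam_zero_eq_integral {α : ℝ} (hα : 2 < α) (Nt : ℕ) {w : ℝ} (hw : 0 ≤ w) :
    Lam α Nt 0 w = 1 + (2 / α) * ∫ s in Set.Ioc (0 : ℝ) 1,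
      s ^ (-(2 / α) - 1) * (1 - ((1 + w * s) ^ Nt)⁻¹) := by
  rw [Lam_eq hα Nt 0 (by linarith), eulerInt_ofReal, Complex.ofReal_re, ← integral_const_mul,
    ← integral_const_mul]
  congr 1
  refine integral_congr_ae (Filter.Eventually.of_forall fun s => ?_)
  simp only [add_zero, Nat.cast_zero, zero_sub]
  rw [show 1 - -w * s = 1 + w * s by ring]
  ring

theorem integrableOn_Lam_zero {α : ℝ} (hα : 2 < α) (Nt : ℕ) {w : ℝ} (hw : 0 ≤ w) :
    IntegrableOn (fun s : ℝ => s ^ (-(2 / α) - 1) * (1 - ((1 + w * s) ^ Nt)⁻¹))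
      (Set.Ioc (0 : ℝ) 1) := by
  have h1 : 2 / α < 1 := by rw [div_lt_one (by linarith)]; exact hα
  have := (integrableOn_eulerInt (one_sub_ofReal_mem_slitPlane (x := -w) (by linarith)) Nt
    (b := -(2 / α)) (by linarith)).re.neg
  refine this.congr (Filter.Eventually.of_forall fun s => ?_)
  have : (((s ^ (-(2 / α) - 1) : ℝ) : ℂ) * (((1 - ((-w : ℝ) : ℂ) * s) ^ Nt)⁻¹ - 1)) =
    ((s ^ (-(2 / α) - 1) * (((1 - (-w) * s) ^ Nt)⁻¹ - 1) : ℝ) : ℂ) := by push_cast; ring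
  simp only [Pi.neg_apply, RCLike.re_to_complex]
  rw [this, Complex.ofReal_re, show 1 - -w * s = 1 + w * s by ring]
  ring

theorem one_le_Lam_zero {α : ℝ} (hα : 2 < α) (Nt : ℕ) {w : ℝ} (hw : 0 ≤ w) :
    1 ≤ Lam α Nt 0 w := by
  rw [Lam_zero_eq_integral hα Nt hw, le_add_iff_nonneg_right]
  refine mul_nonneg (by positivity) (setIntegral_nonneg measurableSet_Ioc fun s hs => ?_)
  have hs0 : 0 ≤ s := hs.1.le
  have h1 : 1 ≤ (1 + w * s) ^ Nt := one_le_pow₀ (by have := mul_nonneg hw hs0; linarith)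
  have h2 : ((1 + w * s) ^ Nt)⁻¹ ≤ 1 := inv_le_one_of_one_le₀ h1
  exact mul_nonneg (Real.rpow_nonneg hs0 _) (by linarith)

theorem Lam_zero_zero {α : ℝ} (hα : 2 < α) (Nt : ℕ) : Lam α Nt 0 0 = 1 := by
  simp [Lam_zero_eq_integral hα Nt le_rfl]

/-! ### Derivatives of a negative power and set partitions -/

section Partitions

variable {α : Type*} [DecidableEq α] {a : α} {s : Finset α}

/-- The set partition of `insert a s` obtained from a partition `υ` of `s` by adding the new element
`a` to the block `B` of `υ`, or as a block of its own when `B = ∅`. -/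
def insertIntoBlock (ha : a ∉ s) (υ : Finpartition s) (B : Finset α)
    (hB : B ∈ insert ∅ υ.parts) : Finpartition (insert a s) :=
  Finpartition.ofExistsUnique (insert (insert a B) (υ.parts.erase B))
    (by
      have hBs : B ⊆ s := by
        rcases Finset.mem_insert.1 hB with rfl | h
        · simp
        · exact υ.le h
      intro p hp
      rcases Finset.mem_insert.1 hp with rfl | h
      · exact Finset.insert_subset_insert _ hBs
      · exact (υ.le (Finset.mem_of_mem_erase h)).trans (Finset.subset_insert _ _))
    (by
      intro x hx
      have hmem : ∀ p ∈ υ.parts, p ⊆ s := fun p hp => υ.le hp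
      have huniq : ∀ p ∈ υ.parts, ∀ q ∈ υ.parts, ∀ y, y ∈ p → y ∈ q → p = q :=
        fun p hp q hq y h1 h2 => υ.eq_of_mem_parts hp hq h1 h2
      by_cases hxB : x ∈ insert a B
      · refine ⟨insert a B, by simp only [Finset.mem_insert_self, true_and]; exact hxB, ?_⟩
        rintro p ⟨hp, hxp⟩
        grind
      · have hxs : x ∈ s := by grind
        obtain ⟨t, ht, hxt⟩ := υ.exists_mem hxs
        refine ⟨t, ⟨by grind, hxt⟩, ?_⟩
        rintro p ⟨hp, hxp⟩
        grind)
    (by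
      have h1 := υ.empty_notMem_parts
      have h2 := Finset.insert_ne_empty a B
      grind)

theorem insertIntoBlock_parts (ha : a ∉ s) (υ : Finpartition s) (B : Finset α)
    (hB : B ∈ insert ∅ υ.parts) :
    (insertIntoBlock ha υ B hB).parts = insert (insert a B) (υ.parts.erase B) := rfl

/-- A set partition of `insert a s` arises in exactly one way from a set partition of `s`, by
making `{a}` a new block or by adding `a` to one of the blocks. -/
theorem sum_finpartition_insert {M : Type*} [AddCommMonoid M] {t : Finset α} (ha : a ∉ s)
    (ht : t = insert a s) (F : Finset (Finset α) → M) :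
    ∑ π : Finpartition t, F π.parts = ∑ υ : Finpartition s,
      (F (insert {a} υ.parts) + ∑ B ∈ υ.parts, F (insert (insert a B) (υ.parts.erase B))) := by
  subst ht
  have h1 : ∀ υ : Finpartition s, F (insert {a} υ.parts) +
      ∑ B ∈ υ.parts, F (insert (insert a B) (υ.parts.erase B)) =
      ∑ B ∈ insert ∅ υ.parts, F (insert (insert a B) (υ.parts.erase B)) := by
    intro υ
    rw [Finset.sum_insert υ.empty_notMem_parts, Finset.erase_eq_of_notMem υ.empty_notMem_parts]
    rfl
  simp_rw [h1]
  rw [Finset.sum_sigma']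
  have hle : s ≤ insert a s := Finset.subset_insert _ _
  have hpart : ∀ π : Finpartition (insert a s), π.part a ∈ π.parts ∧ a ∈ π.part a := fun π =>
    ⟨π.part_mem.2 (Finset.mem_insert_self _ _), π.mem_part_self.2 (Finset.mem_insert_self _ _)⟩
  have hsub : ∀ π : Finpartition (insert a s), ∀ p ∈ π.parts, p ≠ π.part a → p ∩ s = p := by
    intro π p hp hne
    refine Finset.inter_eq_left.2 fun x hx => ?_
    have hxs := π.le hp hx
    rcases Finset.mem_insert.1 hxs with rfl | h
    · exact absurd (π.eq_of_mem_parts hp (hpart π).1 hx (hpart π).2) hne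
    · exact h
  have hself : ∀ π : Finpartition (insert a s), insert a (π.part a ∩ s) = π.part a := by
    intro π
    have h2 := π.le (hpart π).1
    have h3 := (hpart π).2
    ext x
    have := @h2 x
    grind
  have hrestr : ∀ π : Finpartition (insert a s), ∀ p, p ∈ (π.restrict hle).parts ↔
      p ≠ ∅ ∧ ∃ q ∈ π.parts, q ∩ s = p := by
    intro π p
    simp [Finpartition.restrict]
  have hmem : ∀ π : Finpartition (insert a s), π.part a ∩ s ∈ insert ∅ (π.restrict hle).parts := by
    intro π
    rw [Finset.mem_insert, hrestr]
    by_cases h : π.part a ∩ s = ∅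
    · exact Or.inl h
    · exact Or.inr ⟨h, _, (hpart π).1, rfl⟩
  have hinv : ∀ π : Finpartition (insert a s),
      insert (insert a (π.part a ∩ s)) ((π.restrict hle).parts.erase (π.part a ∩ s)) =
        π.parts := by
    intro π
    rw [hself]
    ext p
    rw [Finset.mem_insert, Finset.mem_erase, hrestr]
    constructor
    · rintro (rfl | ⟨h2, h3, q, hq, rfl⟩)
      · exact (hpart π).1
      · by_cases hqa : q = π.part a
        · exact absurd (by rw [hqa]) h2
        · rw [hsub π q hq hqa]; exact hq
    · intro hp
      by_cases hpa : p = π.part a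
      · exact Or.inl hpa
      · refine Or.inr ⟨?_, π.ne_empty hp, p, hp, hsub π p hp hpa⟩
        intro h
        obtain ⟨x, hx⟩ := π.nonempty_of_mem_parts hp
        have hx' : x ∈ π.part a := by
          have := hx; rw [h] at this; exact (Finset.mem_inter.1 this).1
        exact hpa (π.eq_of_mem_parts hp (hpart π).1 hx hx')
  -- The block `∅` stands for the choice of a new block `{a}`; the inverse map removes `a`.
  refine Finset.sum_bij' (fun π _ => ⟨π.restrict hle, π.part a ∩ s⟩)
    (fun x hx => insertIntoBlock ha x.1 x.2 (by simpa using hx)) ?_ ?_ ?_ ?_ ?_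
  · intro π _
    exact Finset.mem_sigma.2 ⟨Finset.mem_univ _, hmem π⟩
  · intro x hx; exact Finset.mem_univ _
  · intro π _
    exact Finpartition.ext (hinv π)
  · rintro ⟨υ, B⟩ hx
    have hB : B ∈ insert ∅ υ.parts := by simpa using hx
    have hBs : B ⊆ s := by
      rcases Finset.mem_insert.1 hB with rfl | h
      · simp
      · exact υ.le h
    have e1 : (insertIntoBlock ha υ B hB).part a = insert a B := by
      refine Finpartition.part_eq_of_mem _ ?_ (Finset.mem_insert_self _ _)
      rw [insertIntoBlock_parts]; exact Finset.mem_insert_self _ _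
    have e2 : insert a B ∩ s = B := by
      rw [Finset.insert_inter_of_notMem ha]; exact Finset.inter_eq_left.2 hBs
    have e3 : (insertIntoBlock ha υ B hB).restrict hle = υ := by
      refine Finpartition.ext ?_
      ext p
      rw [hrestr, insertIntoBlock_parts]
      constructor
      · rintro ⟨h1, q, hq, rfl⟩
        rcases Finset.mem_insert.1 hq with rfl | h
        · rw [e2] at h1 ⊢
          exact Finset.mem_of_mem_insert_of_ne hB h1
        · have h := Finset.mem_of_mem_erase h
          rwa [Finset.inter_eq_left.2 (υ.le h)]
      · intro hp
        refine ⟨υ.ne_empty hp, ?_⟩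
        by_cases hpB : p = B
        · exact ⟨insert a B, Finset.mem_insert_self _ _, by rw [e2, hpB]⟩
        · exact ⟨p, by grind, Finset.inter_eq_left.2 (υ.le hp)⟩
    simp only [e1, e2, e3]
  · intro π _
    simp only [hinv]

/-- The contribution of a set partition to a derivative of `D₀⁻ᵐ`, when `D j` is the `j`-th
derivative of `D₀`; this is the corresponding summand of Faà di Bruno's formula. -/
noncomputable def negPowTerm (m : ℕ) (D : ℕ → ℝ) (parts : Finset (Finset α)) : ℝ :=
  (-1) ^ parts.card * poch m parts.card * (D 0 ^ (m + parts.card))⁻¹ * ∏ B ∈ parts, D B.card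

theorem hasDerivAt_negPowTerm (ha : a ∉ s) (υ : Finpartition s) (m : ℕ) {D : ℕ → ℝ → ℝ} {w : ℝ}
    (hD : ∀ j, HasDerivAt (D j) (D (j + 1) w) w) (h0 : D 0 w ≠ 0) :
    HasDerivAt (fun w => negPowTerm m (fun j => D j w) υ.parts)
      (negPowTerm m (fun j => D j w) (insert {a} υ.parts) +
        ∑ B ∈ υ.parts, negPowTerm m (fun j => D j w) (insert (insert a B) (υ.parts.erase B))) w := by
  have hnot : ∀ B ∈ υ.parts, a ∉ B := fun B hB h => ha (υ.le hB h)
  have hins : ∀ B, insert a B ∉ υ.parts := fun B h => hnot _ h (Finset.mem_insert_self _ _)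
  unfold negPowTerm
  have h1 := ((hD 0).fun_pow (m + υ.parts.card)).fun_inv (pow_ne_zero _ h0)
  have h2 := HasDerivAt.fun_finsetProd (u := υ.parts) (f := fun B => D B.card)
    (f' := fun B => D (B.card + 1) w) (x := w) (fun B _ => hD B.card)
  have h3 := (h1.const_mul ((-1) ^ υ.parts.card * poch m υ.parts.card)).fun_mul h2
  refine h3.congr_deriv ?_
  congr 1
  · have : ({a} : Finset α) ∉ υ.parts := hins ∅
    rw [Finset.card_insert_of_notMem this, Finset.prod_insert this, Finset.card_singleton]
    simp only [poch, ascPochhammer_succ_eval]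
    rcases hk : m + υ.parts.card with _ | k
    · have hm : (m : ℝ) + (υ.parts.card : ℝ) = 0 := by exact_mod_cast hk
      rw [hm]; simp
    · have hm : (m : ℝ) + (υ.parts.card : ℝ) = k + 1 := by exact_mod_cast hk
      rw [hm, show m + (υ.parts.card + 1) = k + 2 by omega]
      push_cast
      field_simp
      ring
  · rw [Finset.mul_sum]
    refine Finset.sum_congr rfl fun B hB => ?_
    have hni : insert a B ∉ υ.parts.erase B := fun h => hins B (Finset.mem_of_mem_erase h)
    have hc : (insert (insert a B) (υ.parts.erase B)).card = υ.parts.card := by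
      rw [Finset.card_insert_of_notMem hni, Finset.card_erase_add_one hB]
    rw [hc, Finset.prod_insert hni, Finset.card_insert_of_notMem (hnot B hB), smul_eq_mul]
    ring

end Partitions

/-- The `k`-th derivative of `D₀⁻ᵐ`, by Faà di Bruno's formula. -/
noncomputable def negPowDeriv (m : ℕ) (D : ℕ → ℝ) (k : ℕ) : ℝ :=
  ∑ υ : Finpartition (Finset.Icc 1 k), negPowTerm m D υ.parts

theorem negPowDeriv_zero (m : ℕ) (D : ℕ → ℝ) : negPowDeriv m D 0 = (D 0 ^ m)⁻¹ := by
  have : Unique (Finpartition (Finset.Icc 1 0)) := inferInstanceAs (Unique (Finpartition ⊥))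
  have hp : (default : Finpartition (Finset.Icc 1 0)).parts = ∅ := by
    rw [Finpartition.parts_eq_empty_iff]; rfl
  rw [negPowDeriv, Fintype.sum_unique]
  simp [negPowTerm, hp, poch]

theorem hasDerivAt_negPowDeriv (m : ℕ) {D : ℕ → ℝ → ℝ} {w : ℝ}
    (hD : ∀ j, HasDerivAt (D j) (D (j + 1) w) w) (h0 : D 0 w ≠ 0) (k : ℕ) :
    HasDerivAt (fun w => negPowDeriv m (fun j => D j w) k)
      (negPowDeriv m (fun j => D j w) (k + 1)) w := by
  have ha : k + 1 ∉ Finset.Icc 1 k := by simp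
  have ht : Finset.Icc 1 (k + 1) = insert (k + 1) (Finset.Icc 1 k) := by
    ext x; simp only [Finset.mem_Icc, Finset.mem_insert]; omega
  unfold negPowDeriv
  rw [sum_finpartition_insert ha ht]
  exact HasDerivAt.fun_sum fun υ _ => hasDerivAt_negPowTerm ha υ m hD h0

/-! ### The exponential `e^{-x}` on `[0, ∞]` -/

/-- `e^{-x}` for `x ∈ [0, ∞]`, with `e^{-∞} = 0`. -/
noncomputable def expNeg (x : ENNReal) : ENNReal := EReal.exp (-(x : EReal))

theorem continuous_expNeg : Continuous expNeg :=
  ENNReal.continuous_exp.comp (continuous_neg.comp continuous_coe_ennreal_ereal)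

theorem measurable_expNeg : Measurable expNeg := continuous_expNeg.measurable

@[simp] theorem expNeg_zero : expNeg 0 = 1 := by simp [expNeg]

@[simp] theorem expNeg_top : expNeg ⊤ = 0 := by simp [expNeg]

theorem expNeg_add (x y : ENNReal) : expNeg (x + y) = expNeg x * expNeg y := by
  unfold expNeg
  rw [EReal.coe_ennreal_add, EReal.neg_add (by simp) (by simp), sub_eq_add_neg, EReal.exp_add]

theorem expNeg_antitone : Antitone expNeg := fun x y h => by
  unfold expNeg
  rw [EReal.exp_le_exp_iff, EReal.neg_le_neg_iff]
  exact_mod_cast h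

theorem expNeg_le_one (x : ENNReal) : expNeg x ≤ 1 := by
  simpa using expNeg_antitone (zero_le (a := x))

theorem expNeg_ofReal {r : ℝ} (hr : 0 ≤ r) :
    expNeg (ENNReal.ofReal r) = ENNReal.ofReal (Real.exp (-r)) := by
  unfold expNeg
  rw [EReal.coe_ennreal_ofReal, max_eq_left hr, ← EReal.coe_neg, EReal.exp_coe]

theorem expNeg_of_ne_top {x : ENNReal} (hx : x ≠ ⊤) :
    expNeg x = ENNReal.ofReal (Real.exp (-x.toReal)) := by
  rw [← expNeg_ofReal ENNReal.toReal_nonneg, ENNReal.ofReal_toReal hx]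

theorem expNeg_sum {ι : Type*} (s : Finset ι) (f : ι → ENNReal) :
    expNeg (∑ i ∈ s, f i) = ∏ i ∈ s, expNeg (f i) := by
  induction s using Finset.cons_induction with
  | empty => simp
  | cons a s ha ih => rw [Finset.sum_cons, Finset.prod_cons, expNeg_add, ih]

/-- Holds also when the sum is infinite, both sides then being `0`. -/
theorem tendsto_expNeg_tsum (f : ℕ → ENNReal) :
    Filter.Tendsto (fun N => ∏ i ∈ Finset.range N, expNeg (f i)) Filter.atTop
      (nhds (expNeg (∑' i, f i))) := by
  simp_rw [← expNeg_sum]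
  exact (continuous_expNeg.tendsto _).comp (ENNReal.tendsto_nat_tsum f)

/-! ### Differentiating a Laplace transform -/

section Laplace

variable {Ω : Type*} [MeasurableSpace Ω] {P : Measure Ω}

variable {G : ℕ → ℝ → ℝ} {x : Ω → ℝ}

theorem exists_abs_le_of_continuousOn_Ici {g : ℝ → ℝ} (hg : ∀ w, 0 ≤ w → ContinuousAt g w) (A : ℝ) :
    ∃ C, ∀ w ∈ Set.Icc 0 A, |g w| ≤ C := by
  obtain ⟨C, hC⟩ := (isCompact_Icc (a := (0 : ℝ)) (b := A)).exists_bound_of_continuousOn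
    (f := g) (fun w hw => (hg w hw.1).continuousWithinAt)
  exact ⟨C, fun w hw => by simpa using hC w hw⟩

theorem aestronglyMeasurable_mixture {g : ℝ → ℝ} (hg : ∀ w, 0 ≤ w → ContinuousAt g w)
    (hx : AEMeasurable x P) (hx01 : ∀ᵐ ω ∂P, x ω ∈ Set.Icc (0 : ℝ) 1) (k : ℕ) {t : ℝ}
    (ht : 0 ≤ t) : AEStronglyMeasurable (fun ω => x ω ^ k * g (t * x ω)) P := by
  have h1 : ContinuousOn g (Set.Ici 0) := fun w hw => (hg w hw).continuousWithinAt
  have h2 : Measurable ((Set.Ici (0 : ℝ)).indicator g) :=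
    h1.measurable_piecewise continuousOn_const measurableSet_Ici
  have h3 : AEMeasurable (fun ω => x ω ^ k * (Set.Ici (0 : ℝ)).indicator g (t * x ω)) P :=
    (hx.pow_const k).mul (h2.comp_aemeasurable (hx.const_mul t))
  refine (h3.congr ?_).aestronglyMeasurable
  filter_upwards [hx01] with ω hω
  rw [Set.indicator_of_mem (show t * x ω ∈ Set.Ici (0 : ℝ) from mul_nonneg ht hω.1)]

variable [IsProbabilityMeasure P]

/-- Only values of `g` on `[0, ∞)` matter; `g` need not be measurable elsewhere. -/
theorem integrable_mixture {g : ℝ → ℝ} (hg : ∀ w, 0 ≤ w → ContinuousAt g w)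
    (hx : AEMeasurable x P) (hx01 : ∀ᵐ ω ∂P, x ω ∈ Set.Icc (0 : ℝ) 1) (k : ℕ) {t : ℝ}
    (ht : 0 ≤ t) : Integrable (fun ω => x ω ^ k * g (t * x ω)) P := by
  obtain ⟨C, hC⟩ := exists_abs_le_of_continuousOn_Ici hg t
  refine (integrable_const C).mono' (aestronglyMeasurable_mixture hg hx hx01 k ht) ?_
  filter_upwards [hx01] with ω hω
  have h1 := hC (t * x ω) ⟨mul_nonneg ht hω.1, mul_le_of_le_one_right ht hω.2⟩
  rw [Real.norm_eq_abs, abs_mul, abs_of_nonneg (pow_nonneg hω.1 k)]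
  exact (mul_le_of_le_one_left (abs_nonneg _) (pow_le_one₀ hω.1 hω.2)).trans h1

theorem hasDerivAt_mixture (hG : ∀ k w, 0 ≤ w → HasDerivAt (G k) (G (k + 1) w) w)
    (hx : AEMeasurable x P) (hx01 : ∀ᵐ ω ∂P, x ω ∈ Set.Icc (0 : ℝ) 1) (k : ℕ) {t : ℝ} (ht : 0 < t) :
    HasDerivAt (fun t => ∫ ω, x ω ^ k * G k (t * x ω) ∂P)
      (∫ ω, x ω ^ (k + 1) * G (k + 1) (t * x ω) ∂P) t := by
  have hc : ∀ k w, 0 ≤ w → ContinuousAt (G k) w := fun k w hw => (hG k w hw).continuousAt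
  obtain ⟨C, hC⟩ := exists_abs_le_of_continuousOn_Ici (hc (k + 1)) (2 * t)
  have hball : ∀ y ∈ Metric.ball t t, 0 < y ∧ y < 2 * t := fun y hy => by
    rw [Metric.mem_ball, Real.dist_eq, abs_lt] at hy
    constructor <;> linarith [hy.1, hy.2]
  refine (hasDerivAt_integral_of_dominated_loc_of_deriv_le (s := Metric.ball t t)
    (F' := fun t ω => x ω ^ (k + 1) * G (k + 1) (t * x ω)) (bound := fun _ => C)
    (Metric.ball_mem_nhds t ht) ?_ (integrable_mixture (hc k) hx hx01 k ht.le)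
    (aestronglyMeasurable_mixture (hc (k + 1)) hx hx01 (k + 1) ht.le) ?_ (integrable_const C) ?_).2
  · filter_upwards [Metric.ball_mem_nhds t ht] with y hy
    exact aestronglyMeasurable_mixture (hc k) hx hx01 k (hball y hy).1.le
  · filter_upwards [hx01] with ω hω y hy
    obtain ⟨h0, h2⟩ := hball y hy
    have h1 := hC (y * x ω) ⟨mul_nonneg h0.le hω.1,
      (mul_le_of_le_one_right h0.le hω.2).trans h2.le⟩
    rw [Real.norm_eq_abs, abs_mul, abs_of_nonneg (pow_nonneg hω.1 _)]
    exact (mul_le_of_le_one_left (abs_nonneg _) (pow_le_one₀ hω.1 hω.2)).trans h1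
  · filter_upwards [hx01] with ω hω y hy
    obtain ⟨h0, h2⟩ := hball y hy
    have h3 := (hG k (y * x ω) (mul_nonneg h0.le hω.1)).comp y
      ((hasDerivAt_id y).mul_const (x ω))
    have h4 := h3.const_mul (x ω ^ k)
    refine h4.congr_deriv ?_
    ring

theorem iteratedDeriv_mixture (hG : ∀ k w, 0 ≤ w → HasDerivAt (G k) (G (k + 1) w) w)
    (hx : AEMeasurable x P) (hx01 : ∀ᵐ ω ∂P, x ω ∈ Set.Icc (0 : ℝ) 1) (k : ℕ) {t : ℝ} (ht : 0 < t) :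
    iteratedDeriv k (fun t => ∫ ω, G 0 (t * x ω) ∂P) t = ∫ ω, x ω ^ k * G k (t * x ω) ∂P := by
  induction k generalizing t with
  | zero => simp
  | succ k ih =>
    rw [iteratedDeriv_succ]
    have hev : iteratedDeriv k (fun t => ∫ ω, G 0 (t * x ω) ∂P) =ᶠ[nhds t]
        fun t => ∫ ω, x ω ^ k * G k (t * x ω) ∂P := by
      filter_upwards [Ioi_mem_nhds ht] with y hy using ih hy
    rw [hev.deriv_eq, (hasDerivAt_mixture hG hx hx01 k ht).deriv]

variable {Y : Ω → ENNReal}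

/-- If `E e^{-cY} = E g(c x)` for all `c > 0` with `x` bounded and `g 0 = 1`, then `Y` is almost
surely finite: let `c → 0`. -/
theorem ae_lt_top_of_laplace {g : ℝ → ℝ} (hg : ∀ w, 0 ≤ w → ContinuousAt g w) (hg0 : g 0 = 1)
    (hx : AEMeasurable x P) (hx01 : ∀ᵐ ω ∂P, x ω ∈ Set.Icc (0 : ℝ) 1) (hY : AEMeasurable Y P)
    (h : ∀ c > 0, ∫⁻ ω, expNeg (ENNReal.ofReal c * Y ω) ∂P =
      ENNReal.ofReal (∫ ω, g (c * x ω) ∂P)) : ∀ᵐ ω ∂P, Y ω < ⊤ := by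
  obtain ⟨C, hC⟩ := exists_abs_le_of_continuousOn_Ici hg 1
  have hseq : ∀ n : ℕ, (1 : ℝ) / (n + 1) ∈ Set.Ioc (0 : ℝ) 1 := fun n =>
    ⟨by positivity, by rw [div_le_one (by positivity)]; linarith [(n.cast_nonneg : (0 : ℝ) ≤ n)]⟩
  have h1 : Filter.Tendsto (fun n : ℕ => ∫ ω, g (1 / ((n : ℝ) + 1) * x ω) ∂P) Filter.atTop
      (nhds (∫ _, (1 : ℝ) ∂P)) := by
    refine tendsto_integral_of_dominated_convergence (fun _ => C) (fun n => ?_)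
      (integrable_const C) (fun n => ?_) ?_
    · simpa using aestronglyMeasurable_mixture hg hx hx01 0 (hseq n).1.le
    · filter_upwards [hx01] with ω hω
      exact hC _ ⟨mul_nonneg (hseq n).1.le hω.1, mul_le_one₀ (hseq n).2 hω.1 hω.2⟩
    · filter_upwards with ω
      have h2 : Filter.Tendsto (fun n : ℕ => 1 / ((n : ℝ) + 1) * x ω) Filter.atTop
          (nhds (0 * x ω)) := tendsto_one_div_add_atTop_nhds_zero_nat.mul_const _
      rw [zero_mul] at h2
      have h3 := (hg 0 le_rfl).tendsto.comp h2
      rwa [hg0] at h3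
  rw [integral_const, probReal_univ, one_smul] at h1
  have h2 : ∀ n : ℕ, ENNReal.ofReal (∫ ω, g (1 / ((n : ℝ) + 1) * x ω) ∂P) ≤
      P {ω | Y ω < ⊤} := by
    intro n
    have hpos := (hseq n).1
    rw [← h _ hpos]
    have hms : NullMeasurableSet {ω | Y ω < ⊤} P := nullMeasurableSet_lt hY aemeasurable_const
    rw [← lintegral_indicator_one₀ hms]
    refine lintegral_mono fun ω => ?_
    by_cases hω : Y ω < ⊤
    · rw [Set.indicator_of_mem (show ω ∈ {ω | Y ω < ⊤} from hω)]
      exact expNeg_le_one _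
    · rw [not_lt_top_iff.1 hω, ENNReal.mul_top (by simpa using hpos), expNeg_top]
      exact zero_le
  have h3 : 1 ≤ P {ω | Y ω < ⊤} := by
    have := ENNReal.tendsto_ofReal h1
    rw [ENNReal.ofReal_one] at this
    exact le_of_tendsto' this h2
  have hms : NullMeasurableSet {ω | Y ω < ⊤} P := nullMeasurableSet_lt hY aemeasurable_const
  exact (prob_compl_eq_zero_iff₀ hms).2 (le_antisymm prob_le_one h3)

/-- Equality of two Laplace transforms may be differentiated any number of times. -/
theorem integral_pow_mul_exp_eq (hG : ∀ k w, 0 ≤ w → HasDerivAt (G k) (G (k + 1) w) w)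
    (hG0 : G 0 0 = 1) (hx : AEMeasurable x P) (hx01 : ∀ᵐ ω ∂P, x ω ∈ Set.Icc (0 : ℝ) 1)
    (hY : AEMeasurable Y P)
    (h : ∀ c > 0, ∫⁻ ω, expNeg (ENNReal.ofReal c * Y ω) ∂P =
      ENNReal.ofReal (∫ ω, G 0 (c * x ω) ∂P)) {z : ℝ} (hz : 0 < z) (k : ℕ) :
    Integrable (fun ω => (Y ω).toReal ^ k * Real.exp (-(z * (Y ω).toReal))) P ∧
    ∫ ω, (Y ω).toReal ^ k * Real.exp (-(z * (Y ω).toReal)) ∂P =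
      (-1) ^ k * ∫ ω, x ω ^ k * G k (z * x ω) ∂P := by
  have hc : ∀ k w, 0 ≤ w → ContinuousAt (G k) w := fun k w hw => (hG k w hw).continuousAt
  have hfin := ae_lt_top_of_laplace (hc 0) hG0 hx hx01 hY h
  set Z : Ω → ℝ := fun ω => (Y ω).toReal
  have hZm : AEMeasurable Z P := hY.ennreal_toReal
  have hZ0 : ∀ ω, 0 ≤ Z ω := fun ω => ENNReal.toReal_nonneg
  have hint : ∀ t ≤ 0, Integrable (fun ω => Real.exp (t * Z ω)) P := by
    intro t ht
    refine (integrable_const (1 : ℝ)).mono' (by fun_prop) (Filter.Eventually.of_forall fun ω => ?_)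
    rw [Real.norm_of_nonneg (Real.exp_pos _).le, Real.exp_le_one_iff]
    exact mul_nonpos_of_nonpos_of_nonneg ht (hZ0 ω)
  -- The moment generating function is smooth in the interior of its domain, which contains `(-∞, 0)`.
  have hmem : ∀ t < 0, t ∈ interior (integrableExpSet Z P) := by
    intro t ht
    rw [mem_interior_iff_mem_nhds]
    exact Filter.mem_of_superset (Iic_mem_nhds ht) fun y hy => hint y hy
  have hmgf : ∀ c > 0, mgf Z P (-c) = ∫ ω, G 0 (c * x ω) ∂P := by
    intro c hc0
    have h1 : ∫⁻ ω, expNeg (ENNReal.ofReal c * Y ω) ∂P = ENNReal.ofReal (mgf Z P (-c)) := by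
      rw [mgf, ofReal_integral_eq_lintegral_ofReal (hint _ (by linarith))
        (Filter.Eventually.of_forall fun ω => (Real.exp_pos _).le)]
      refine lintegral_congr_ae ?_
      filter_upwards [hfin] with ω hω
      rw [expNeg_of_ne_top (ENNReal.mul_ne_top ENNReal.ofReal_ne_top hω.ne), ENNReal.toReal_mul,
        ENNReal.toReal_ofReal hc0.le, neg_mul]
    have h2 : 0 < mgf Z P (-c) := mgf_pos (hint _ (by linarith))
    have h3 := h c hc0
    rw [h1] at h3
    have h4 : 0 < ENNReal.ofReal (∫ ω, G 0 (c * x ω) ∂P) := by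
      rw [← h3]; exact ENNReal.ofReal_pos.2 h2
    rwa [ENNReal.ofReal_eq_ofReal_iff h2.le (ENNReal.ofReal_pos.1 h4).le] at h3
  have hd : iteratedDeriv k (fun c => mgf Z P (-c)) z =
      iteratedDeriv k (fun t => ∫ ω, G 0 (t * x ω) ∂P) z := by
    refine Filter.EventuallyEq.iteratedDeriv_eq k ?_
    filter_upwards [Ioi_mem_nhds hz] with c hc0 using hmgf c hc0
  rw [iteratedDeriv_mixture hG hx hx01 k hz, iteratedDeriv_comp_neg,
    iteratedDeriv_mgf (hmem (-z) (by linarith)), smul_eq_mul] at hd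
  refine ⟨?_, ?_⟩
  · simpa [Z] using integrable_pow_mul_exp_of_mem_interior_integrableExpSet
      (hmem (-z) (by linarith)) k
  · rw [← hd, ← mul_assoc, ← mul_pow]
    simp [Z]

end Laplace

/-! ### The summands of the coverage probability as derivatives -/

/-- The `j`-th derivative of `Λ₀`. -/
noncomputable def LamDeriv (α : ℝ) (Nt j : ℕ) (w : ℝ) : ℝ :=
  (-1) ^ j * (poch Nt j * poch (-(2 / α)) j / poch ((α - 2) / α) j) * Lam α Nt j w

theorem LamDeriv_zero (α : ℝ) (Nt : ℕ) (w : ℝ) : LamDeriv α Nt 0 w = Lam α Nt 0 w := by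
  simp [LamDeriv, poch]

theorem hasDerivAt_LamDeriv {α : ℝ} (hα : 2 < α) (Nt j : ℕ) {w : ℝ} (hw : -1 < w) :
    HasDerivAt (LamDeriv α Nt j) (LamDeriv α Nt (j + 1) w) w := by
  refine ((hasDerivAt_Lam hα Nt j hw).const_mul
    ((-1) ^ j * (poch Nt j * poch (-(2 / α)) j / poch ((α - 2) / α) j))).congr_deriv ?_
  have h1 : (j : ℝ) - 2 / α + 1 = (α - 2) / α + j := by field_simp; ring
  rw [h1]
  simp only [LamDeriv, poch, ascPochhammer_succ_eval, pow_succ]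
  rw [show (j : ℝ) - 2 / α = -(2 / α) + j by ring]
  generalize (α - 2) / α + (j : ℝ) = x
  generalize Polynomial.eval ((α - 2) / α) (ascPochhammer ℝ j) = y
  ring

theorem hasDerivAt_negPowDeriv_Lam {α : ℝ} (hα : 2 < α) (Nt m k : ℕ) {w : ℝ} (hw : 0 ≤ w) :
    HasDerivAt (fun w => negPowDeriv m (fun j => LamDeriv α Nt j w) k)
      (negPowDeriv m (fun j => LamDeriv α Nt j w) (k + 1)) w := by
  refine hasDerivAt_negPowDeriv m (D := LamDeriv α Nt)
    (fun j => hasDerivAt_LamDeriv hα Nt j (by linarith)) ?_ k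
  rw [LamDeriv_zero]
  exact (zero_lt_one.trans_le (one_le_Lam_zero hα Nt hw)).ne'

/-- Up to a factor, `partitionTerm` is a summand of Faà di Bruno's formula for `Λ₀⁻ᵐ`. -/
theorem partitionTerm_eq {α : ℝ} (hα : 2 < α) (Nt m : ℕ) {z : ℝ} (hz : 0 ≤ z) {k : ℕ}
    (υ : Finpartition (Finset.Icc 1 k)) {b : ℝ} (hb : 0 < b) :
    (-1) ^ υ.parts.card * poch m υ.parts.card * partitionTerm α Nt m z υ b =
      (-1) ^ k * ((b ^ (-α)) ^ k *
        negPowTerm m (fun j => LamDeriv α Nt j (z * b ^ (-α))) υ.parts) := by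
  have hw : 0 ≤ z * b ^ (-α) := mul_nonneg hz (Real.rpow_nonneg hb.le _)
  have hL : Lam α Nt 0 (z * b ^ (-α)) ≠ 0 :=
    (zero_lt_one.trans_le (one_le_Lam_zero hα Nt hw)).ne'
  have hcard : ∀ B ∈ υ.parts, B.card ∈ Finset.Icc 1 k := by
    intro B hB
    rw [Finset.mem_Icc]
    refine ⟨Finset.card_pos.2 (υ.nonempty_of_mem_parts hB), ?_⟩
    simpa using Finset.card_le_card (υ.le hB)
  have hprod : ∀ f : ℕ → ℝ, ∏ j ∈ Finset.Icc 1 k, f j ^ blocksOfSize υ j =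
      ∏ B ∈ υ.parts, f B.card := by
    intro f
    rw [← Finset.prod_fiberwise_of_maps_to hcard]
    refine Finset.prod_congr rfl fun j _ => ?_
    rw [Finset.prod_congr rfl (g := fun _ => f j) (fun B hB => by
      rw [(Finset.mem_filter.1 hB).2]), Finset.prod_const]
    rfl
  have hsum : ∑ B ∈ υ.parts, B.card = k := by rw [υ.sum_card_parts]; simp
  unfold partitionTerm negPowTerm
  rw [hprod, mul_comm (b ^ (-α)) z]
  have e1 : b ^ (-(α * k)) = (b ^ (-α)) ^ k := by
    rw [← Real.rpow_natCast, ← Real.rpow_mul hb.le]; ring_nf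
  rw [e1]
  beta_reduce
  rw [LamDeriv_zero]
  simp only [LamDeriv]
  have e3 : ∀ (c L : Finset ℕ → ℝ) (l : ℝ), ∏ B ∈ υ.parts, c B * (L B / l) =
      (∏ B ∈ υ.parts, c B) * (∏ B ∈ υ.parts, L B) / l ^ υ.parts.card := by
    intro c L l
    rw [Finset.prod_mul_distrib, Finset.prod_div_distrib, Finset.prod_const, mul_div_assoc]
  rw [e3, Finset.prod_mul_distrib, Finset.prod_mul_distrib, Finset.prod_pow_eq_pow_sum, hsum,
    pow_add]
  have e2 : ((-1 : ℝ) ^ k) * (-1) ^ k = 1 := by rw [← mul_pow]; simp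
  set A := ∏ B ∈ υ.parts, poch Nt B.card * poch (-(2 / α)) B.card / poch ((α - 2) / α) B.card
  set L := ∏ B ∈ υ.parts, Lam α Nt B.card (z * b ^ (-α))
  set l := Lam α Nt 0 (z * b ^ (-α))
  linear_combination (-((-1) ^ υ.parts.card * poch m υ.parts.card * (b ^ (-α)) ^ k *
    (l ^ m)⁻¹ * A * L * (l ^ υ.parts.card)⁻¹)) * e2

/-! ### Independence of disjoint blocks of a family -/

theorem comap_block_le {Ω ι κ : Type*} {β : ι → Type*} [∀ i, MeasurableSpace (β i)]
    (f : ∀ i, Ω → β i) (a : κ → ι) :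
    MeasurableSpace.comap (fun ω k => f (a k) ω) MeasurableSpace.pi ≤
      ⨆ i ∈ Set.range a, MeasurableSpace.comap (f i) inferInstance := by
  rw [← measurable_iff_comap_le]
  refine @measurable_pi_lambda _ _ _ (_) _ _ fun k => ?_
  rw [measurable_iff_comap_le]
  exact le_iSup₂_of_le (a k) ⟨k, rfl⟩ le_rfl

/-- Disjoint, possibly infinite, blocks of an independent family are independent. -/
theorem indepFun_of_disjoint_range {Ω ι κ κ' : Type*} [MeasurableSpace Ω] {P : Measure Ω}
    {β : ι → Type*} [∀ i, MeasurableSpace (β i)] {f : ∀ i, Ω → β i} (hf : iIndepFun f P)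
    (hm : ∀ i, Measurable (f i)) {a : κ → ι} {b : κ' → ι}
    (hab : Disjoint (Set.range a) (Set.range b)) :
    IndepFun (fun ω k => f (a k) ω) (fun ω k => f (b k) ω) P := by
  have h1 := indep_iSup_of_disjoint (m := fun i => MeasurableSpace.comap (f i) inferInstance)
    (fun i => (hm i).comap_le) hf hab
  rw [IndepFun_iff_Indep]
  exact indep_of_indep_of_le_left (indep_of_indep_of_le_right h1 (comap_block_le f b))
    (comap_block_le f a)

/-! ### Unit-rate Poisson processes on the half-line -/

/-- The number of indices `n` with `T n ω ∈ B`. -/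
noncomputable def tally {Ω : Type*} (T : ℕ → Ω → ℝ) (B : Set ℝ) (ω : Ω) : ENNReal :=
  ∑' n, B.indicator 1 (T n ω)

/-- `T 0 ≤ T 1 ≤ ⋯` are the points of a Poisson process of rate one on `[0, ∞)`: the numbers of
points in disjoint Borel sets are independent and Poisson distributed. -/
structure IsUnitPoisson {Ω : Type*} [MeasurableSpace Ω] (T : ℕ → Ω → ℝ) (P : Measure Ω) :
    Prop where
  measurable : ∀ n, Measurable (T n)
  nonneg : ∀ n ω, 0 ≤ T n ω
  mono : ∀ᵐ ω ∂P, Monotone (fun n => T n ω)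
  law : ∀ B : Set ℝ, MeasurableSet B → volume (B ∩ Set.Ici 0) < ⊤ →
    HasLaw (tally T B)
      ((poissonMeasure (volume (B ∩ Set.Ici 0)).toNNReal).map (Nat.cast : ℕ → ENNReal)) P
  indep : ∀ (n : ℕ) (B : Fin n → Set ℝ), (∀ i, MeasurableSet (B i)) →
    Pairwise (fun i j => Disjoint (B i) (B j)) → iIndepFun (fun i => tally T (B i)) P

section Radial

theorem volume_radial_le {lam : ℝ} (hlam : 0 < lam) (t : ℝ) :
    volume {x : Plane | Real.pi * lam * ‖x‖ ^ 2 ≤ t} = ENNReal.ofReal (t / lam) := by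
  have hpl : 0 < Real.pi * lam := mul_pos Real.pi_pos hlam
  rcases lt_or_ge t 0 with ht | ht
  · have : {x : Plane | Real.pi * lam * ‖x‖ ^ 2 ≤ t} = ∅ := by
      ext x
      simp only [Set.mem_ofPred_eq, Set.mem_empty_iff_false, iff_false, not_le]
      exact ht.trans_le (by positivity)
    rw [this, measure_empty, ENNReal.ofReal_of_nonpos]
    exact div_nonpos_of_nonpos_of_nonneg ht.le hlam.le
  · have : {x : Plane | Real.pi * lam * ‖x‖ ^ 2 ≤ t} =
        Metric.closedBall 0 (Real.sqrt (t / (Real.pi * lam))) := by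
      ext x
      rw [Set.mem_ofPred_eq, mem_closedBall_zero_iff, Real.le_sqrt (norm_nonneg _) (by positivity),
        le_div_iff₀ hpl, mul_comm]
    rw [this, EuclideanSpace.volume_closedBall_fin_two, ← ENNReal.ofReal_pow (Real.sqrt_nonneg _),
      Real.sq_sqrt (by positivity)]
    rw [← ENNReal.ofReal_mul (by positivity)]
    congr 1
    field_simp

/-- The map `x ↦ πλ‖x‖²` takes area, scaled by `λ`, to length on the half-line. -/
theorem volume_radial_preimage {lam : ℝ} (hlam : 0 < lam) {B : Set ℝ} (hB : MeasurableSet B) :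
    volume ((fun x : Plane => Real.pi * lam * ‖x‖ ^ 2) ⁻¹' B) =
      ENNReal.ofReal lam⁻¹ * volume (B ∩ Set.Ici 0) := by
  set f : Plane → ℝ := fun x => Real.pi * lam * ‖x‖ ^ 2
  have hf : Measurable f := by fun_prop
  have hIic : ∀ t, volume.map f (Set.Iic t) = ENNReal.ofReal (t / lam) := fun t => by
    rw [Measure.map_apply hf measurableSet_Iic]
    exact volume_radial_le hlam t
  have hIic' : ∀ t, (ENNReal.ofReal lam⁻¹ • volume.restrict (Set.Ici (0 : ℝ))) (Set.Iic t) =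
      ENNReal.ofReal (t / lam) := fun t => by
    rw [Measure.smul_apply, Measure.restrict_apply measurableSet_Iic, Set.Iic_inter_Ici,
      Real.volume_Icc, sub_zero, smul_eq_mul, ← ENNReal.ofReal_mul (by positivity), mul_comm,
      div_eq_mul_inv]
  have hIoc : ∀ (μ : Measure ℝ), (∀ t, μ (Set.Iic t) = ENNReal.ofReal (t / lam)) →
      ∀ a b : ℝ, a < b → μ (Set.Ioc a b) = ENNReal.ofReal (b / lam) - ENNReal.ofReal (a / lam) := by
    intro μ hμ a b hab
    rw [← Set.Iic_sdiff_Iic, measure_sdiff (Set.Iic_subset_Iic.2 hab.le)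
      measurableSet_Iic.nullMeasurableSet (by rw [hμ]; exact ENNReal.ofReal_ne_top), hμ, hμ]
  have hmain : volume.map f = ENNReal.ofReal lam⁻¹ • volume.restrict (Set.Ici (0 : ℝ)) := by
    refine Measure.ext_of_Ioc' _ _ (fun a b hab => ?_) (fun a b hab => ?_)
    · rw [hIoc _ hIic a b hab]
      exact ENNReal.sub_ne_top ENNReal.ofReal_ne_top
    · rw [hIoc _ hIic a b hab, hIoc _ hIic' a b hab]
  rw [← Measure.map_apply hf hB, hmain, Measure.smul_apply, Measure.restrict_apply hB, smul_eq_mul]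

variable {Ω : Type*} [MeasurableSpace Ω] {P : Measure Ω}

/-- The points of a planar Poisson process of intensity `λ`, labelled by increasing norm, become
a unit-rate Poisson process on the half-line under `x ↦ πλ‖x‖²`. -/
theorem IsPoissonPointProcess.isUnitPoisson {lam : ℝ} (hlam : 0 < lam) {Φ : Ω → Set Plane}
    (hΦ : IsPoissonPointProcess Φ lam P) {X : ℕ → Ω → Plane}
    (hX : IsNearestFirstLabelling X Φ P) :
    IsUnitPoisson (fun n ω => Real.pi * lam * ‖X n ω‖ ^ 2) P := by
  have hpl : 0 < Real.pi * lam := mul_pos Real.pi_pos hlam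
  set f : Plane → ℝ := fun x => Real.pi * lam * ‖x‖ ^ 2
  have hf : Measurable f := by fun_prop
  set T : ℕ → Ω → ℝ := fun n ω => f (X n ω)
  have htally : ∀ B : Set ℝ, (fun ω => ((count Φ (f ⁻¹' B) ω : ℕ∞) : ENNReal)) =ᵐ[P] tally T B := by
    intro B
    filter_upwards [hX.ae_labelling] with ω ⟨hinj, hrange, _⟩
    have h1 : Φ ω ∩ f ⁻¹' B = (fun n => X n ω) '' {n | T n ω ∈ B} := by
      rw [← hrange]
      ext x
      constructor
      · rintro ⟨⟨n, rfl⟩, hx⟩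
        exact ⟨n, hx, rfl⟩
      · rintro ⟨n, hn, rfl⟩
        exact ⟨⟨n, rfl⟩, hn⟩
    rw [count, h1, hinj.encard_image, ← ENNReal.tsum_set_one,
      tsum_subtype _ (fun _ => (1 : ENNReal))]
    rfl
  have hcast : Measurable (fun x : ℕ∞ => (x : ENNReal)) := measurable_of_countable _
  refine ⟨fun n => hf.comp (hX.measurable n), fun n ω => by positivity, ?_, ?_, ?_⟩
  · filter_upwards [hX.ae_labelling] with ω ⟨_, _, hmono⟩ i j hij
    have h1 : ‖X i ω‖ ≤ ‖X j ω‖ := hmono hij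
    change Real.pi * lam * ‖X i ω‖ ^ 2 ≤ Real.pi * lam * ‖X j ω‖ ^ 2
    gcongr
  · intro B hB hBfin
    have hvol := volume_radial_preimage hlam hB
    have hlaw := hΦ.count_law (f ⁻¹' B) (hf hB) (by
      rw [hvol]; exact ENNReal.mul_lt_top ENNReal.ofReal_lt_top hBfin)
    rw [hvol, ENNReal.toReal_mul, ENNReal.toReal_ofReal (by positivity), ← mul_assoc,
      mul_inv_cancel₀ hlam.ne', one_mul] at hlaw
    refine HasLaw.congr ⟨hcast.comp_aemeasurable hlaw.aemeasurable, ?_⟩ (htally B).symm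
    have h2 := Measure.map_map (μ := P) hcast (hΦ.measurable_count _ (hf hB))
    rw [hlaw.map_eq, Measure.map_map hcast (measurable_of_countable _)] at h2
    refine h2.symm.trans ?_
    rw [ENNReal.toNNReal_toReal_eq]
    rfl
  · intro n B hB hdisj
    have h1 := hΦ.indep n (fun i => f ⁻¹' B i) (fun i => hf (hB i))
      (fun i j hij => (hdisj hij).preimage f)
    exact (iIndepFun_congr fun i => htally (B i)).1 (h1.comp (fun _ x => (x : ENNReal))
      fun _ => hcast)

end Radial

section Counting

variable {Ω : Type*} {T : ℕ → Ω → ℝ}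

theorem measurable_tally [MeasurableSpace Ω] (hT : ∀ n, Measurable (T n)) {B : Set ℝ}
    (hB : MeasurableSet B) : Measurable (tally T B) :=
  Measurable.tsum fun n => (measurable_one.indicator hB).comp (hT n)

/-- Counting points up to time `t` and locating the `n`-th point are the same thing. -/
theorem tally_le_iff {ω : Ω} (hmono : Monotone fun n => T n ω) (t : ℝ) (n : ℕ) :
    tally T (Set.Iic t) ω ≤ n ↔ t < T n ω := by
  constructor
  · intro h
    by_contra! hle
    have h1 : ∑ i ∈ Finset.range (n + 1), (Set.Iic t).indicator (1 : ℝ → ENNReal) (T i ω) =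
        ((n + 1 : ℕ) : ENNReal) := by
      rw [Finset.sum_congr rfl (g := fun _ => 1)]
      · simp
      · intro i hi
        have : T i ω ≤ T n ω := hmono (by simpa [Nat.lt_succ_iff] using hi)
        exact Set.indicator_of_mem (s := Set.Iic t) (this.trans hle) 1
    have h2 : ((n + 1 : ℕ) : ENNReal) ≤ n := by
      rw [← h1]; exact (ENNReal.sum_le_tsum _).trans h
    have : n + 1 ≤ n := by exact_mod_cast h2
    omega
  · intro h
    rw [tally, tsum_eq_sum (s := Finset.range n)]
    · refine (Finset.sum_le_card_nsmul _ _ 1 fun i _ => ?_).trans (by simp)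
      exact Set.indicator_le_self' (fun _ _ => zero_le) _
    · intro i hi
      have : T n ω ≤ T i ω := hmono (by simpa using hi)
      exact Set.indicator_of_notMem (s := Set.Iic t) (not_le.2 (h.trans_le this)) 1

theorem tally_eq_zero_iff {B : Set ℝ} {ω : Ω} : tally T B ω = 0 ↔ ∀ n, T n ω ∉ B := by
  rw [tally, ENNReal.tsum_eq_zero]
  refine forall_congr' fun n => ?_
  rw [Set.indicator_apply_eq_zero]
  simp

theorem two_le_tally {B : Set ℝ} {ω : Ω} {i j : ℕ} (hij : i ≠ j) (hi : T i ω ∈ B)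
    (hj : T j ω ∈ B) : 2 ≤ tally T B ω := by
  have h1 : ∑ k ∈ {i, j}, B.indicator (1 : ℝ → ENNReal) (T k ω) = 2 := by
    rw [Finset.sum_pair hij, Set.indicator_of_mem hi, Set.indicator_of_mem hj]
    exact one_add_one_eq_two
  rw [← h1]
  exact ENNReal.sum_le_tsum _

theorem tally_eq_sum {κ : Type*} (s : Finset κ) {A : κ → Set ℝ} {B : Set ℝ}
    (h : ∀ x, B.indicator (1 : ℝ → ENNReal) x = ∑ k ∈ s, (A k).indicator 1 x) (ω : Ω) :
    tally T B ω = ∑ k ∈ s, tally T (A k) ω := by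
  unfold tally
  rw [← Summable.tsum_finsetSum fun _ _ => ENNReal.summable]
  exact tsum_congr fun n => h _

end Counting

namespace IsUnitPoisson

variable {Ω : Type*} [MeasurableSpace Ω] {P : Measure Ω} {T : ℕ → Ω → ℝ}

theorem indep_of_finite (hT : IsUnitPoisson T P) {κ : Type*} [Finite κ] {B : κ → Set ℝ}
    (hB : ∀ i, MeasurableSet (B i)) (hdisj : Pairwise fun i j => Disjoint (B i) (B j)) :
    iIndepFun (fun i => tally T (B i)) P := by
  obtain ⟨n, ⟨e⟩⟩ := Finite.exists_equiv_fin κ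
  have h := hT.indep n (fun i => B (e.symm i)) (fun i => hB _)
    (fun i j hij => hdisj (fun h => hij (e.symm.injective h)))
  refine (iIndepFun_precomp_of_bijective (g := e.symm) e.symm.bijective).1 h

/-- The numbers of points in finitely many Borel sets, which may overlap, are independent of the
number of points in a set disjoint from all of them: pass to the atoms of the sets. -/
theorem indepFun_tally (hT : IsUnitPoisson T P) {ι : Type*} [Finite ι] {B : ι → Set ℝ}
    (hB : ∀ i, MeasurableSet (B i)) {C : Set ℝ} (hC : MeasurableSet C)
    (hBC : ∀ i, Disjoint (B i) C) :
    IndepFun (fun ω i => tally T (B i) ω) (tally T C) P := by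
  classical
  have := Fintype.ofFinite ι
  -- `A none = C`; `A (some s)` is the set of points outside `C` lying in exactly the `B i` with `i ∈ s`.
  set A : Option (Finset ι) → Set ℝ := fun o => o.elim C
    fun s => {x | x ∉ C ∧ ∀ i, x ∈ B i ↔ i ∈ s}
  have hA : ∀ o, MeasurableSet (A o) := by
    rintro (_ | s)
    · exact hC
    · have : A (some s) = Cᶜ ∩ ⋂ i, {x | x ∈ B i ↔ i ∈ s} := by
        ext x; simp [A]
      rw [this]
      refine hC.compl.inter (MeasurableSet.iInter fun i => ?_)
      by_cases hi : i ∈ s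
      · simpa [hi] using hB i
      · simp only [hi, iff_false]; exact (hB i).compl
  have hdisj : Pairwise fun o o' => Disjoint (A o) (A o') := by
    rintro (_ | s) (_ | s') hne
    · exact absurd rfl hne
    · exact Set.disjoint_left.2 fun x hx hx' => hx'.1 hx
    · exact Set.disjoint_left.2 fun x hx hx' => hx.1 hx'
    · refine Set.disjoint_left.2 fun x hx hx' => hne ?_
      congr 1
      ext i
      exact (hx.2 i).symm.trans (hx'.2 i)
  have h1 := indepFun_of_disjoint_range (hT.indep_of_finite hA hdisj)
    (fun o => measurable_tally hT.measurable (hA o))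
    (a := (some : Finset ι → _)) (b := fun _ : Unit => (none : Option (Finset ι))) (by
      rw [Set.disjoint_left]; rintro _ ⟨s, rfl⟩ ⟨_, h⟩; exact absurd h (by simp))
  have h2 := h1.comp (φ := fun (v : Finset ι → ENNReal) (i : ι) =>
      ∑ s ∈ Finset.univ.filter (fun s => i ∈ s), v s) (ψ := fun w : Unit → ENNReal => w ()) (by fun_prop)
      (measurable_pi_apply (X := fun _ : Unit => ENNReal) ())
  convert h2 using 1
  swap
  · rfl
  funext ω i
  refine tally_eq_sum _ (fun x => ?_) ω
  by_cases hx : x ∈ B i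
  · have hxC : x ∉ C := Set.disjoint_left.1 (hBC i) hx
    rw [Set.indicator_of_mem hx,
      Finset.sum_eq_single (Finset.univ.filter fun j => x ∈ B j)]
    · rw [Set.indicator_of_mem]; exact ⟨hxC, by simp⟩
    · intro s _ hne
      refine Set.indicator_of_notMem (fun h => hne ?_) _
      ext j; simpa using (h.2 j).symm
    · intro h; simp [hx] at h
  · rw [Set.indicator_of_notMem hx, Finset.sum_eq_zero]
    intro s hs
    exact Set.indicator_of_notMem (fun h => hx ((h.2 i).2 (by simpa using hs))) _

theorem measure_tally_eq (hT : IsUnitPoisson T P) {B : Set ℝ} (hB : MeasurableSet B) {v : ℝ}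
    (hv : 0 ≤ v) (hvol : volume (B ∩ Set.Ici 0) = ENNReal.ofReal v) (k : ℕ) :
    P {ω | tally T B ω = k} = ENNReal.ofReal (Real.exp (-v) * v ^ k / k.factorial) := by
  have hv' : ((ENNReal.ofReal v).toNNReal : ℝ) = v := ENNReal.toReal_ofReal hv
  have h := (hT.law B hB (by rw [hvol]; exact ENNReal.ofReal_lt_top)).measure_eq
    (p := fun x => x = (k : ENNReal)) (measurableSet_singleton _)
  have : (Nat.cast : ℕ → ENNReal) ⁻¹' {x | x = (k : ENNReal)} = {k} := by
    ext n; simp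
  rw [h, Measure.map_apply (measurable_of_countable _)
    (show MeasurableSet {x | x = (k : ENNReal)} from measurableSet_singleton _), hvol]
  rw [this, poissonMeasure_singleton, hv']

end IsUnitPoisson

/-! ### The law of a point and the waiting time after it -/

/-- The tail `e^{-y} ∑_{k ≤ n} y^k / k!` of the Gamma law with shape `n + 1`. -/
noncomputable def gammaTail (n : ℕ) (y : ℝ) : ℝ :=
  ∑ k ∈ Finset.range (n + 1), Real.exp (-y) * y ^ k / k.factorial

theorem gammaTail_nonneg (n : ℕ) {y : ℝ} (hy : 0 ≤ y) : 0 ≤ gammaTail n y :=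
  Finset.sum_nonneg fun k _ => by positivity

theorem hasDerivAt_gammaTail (n : ℕ) (y : ℝ) :
    HasDerivAt (gammaTail n) (-(Real.exp (-y) * y ^ n / n.factorial)) y := by
  induction n with
  | zero =>
    have h : HasDerivAt (fun y : ℝ => Real.exp (-y)) (-Real.exp (-y)) y := by
      simpa using (hasDerivAt_neg y).exp
    unfold gammaTail
    simpa using h
  | succ n ih =>
    have h : HasDerivAt (fun y : ℝ => Real.exp (-y)) (-Real.exp (-y)) y := by
      simpa using (hasDerivAt_neg y).exp
    have h2 := (h.fun_mul (hasDerivAt_pow (n + 1) y)).div_const ((n + 1).factorial : ℝ)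
    have h3 : gammaTail (n + 1) =
        fun y => gammaTail n y + Real.exp (-y) * y ^ (n + 1) / (n + 1).factorial := by
      funext y
      rw [gammaTail, Finset.sum_range_succ, gammaTail]
    rw [h3]
    refine (ih.fun_add h2).congr_deriv ?_
    rw [Nat.factorial_succ]
    push_cast
    field_simp
    ring

theorem tendsto_gammaTail (n : ℕ) : Filter.Tendsto (gammaTail n) Filter.atTop (nhds 0) := by
  have h := tendsto_finsetSum (Finset.range (n + 1)) fun k _ =>
    (Real.tendsto_pow_mul_exp_neg_atTop_nhds_zero k).div_const (k.factorial : ℝ)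
  simp only [zero_div, Finset.sum_const_zero] at h
  refine h.congr fun y => ?_
  unfold gammaTail
  exact Finset.sum_congr rfl fun k _ => by ring

theorem gammaPDF_nat (n : ℕ) {x : ℝ} (hx : 0 ≤ x) :
    gammaPDF (n + 1) 1 x = ENNReal.ofReal (Real.exp (-x) * x ^ n / n.factorial) := by
  rw [gammaPDF_of_nonneg hx, Real.Gamma_nat_eq_factorial]
  congr 1
  rw [Real.one_rpow, show ((n : ℝ) + 1 - 1) = n by ring, Real.rpow_natCast, one_mul]
  ring

theorem gammaMeasure_Ioi (n : ℕ) {t : ℝ} (ht : 0 ≤ t) :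
    gammaMeasure (n + 1) 1 (Set.Ioi t) = ENNReal.ofReal (gammaTail n t) := by
  rw [gammaMeasure, withDensity_apply _ measurableSet_Ioi]
  rw [setLIntegral_congr_fun measurableSet_Ioi (g := fun x =>
    ENNReal.ofReal (Real.exp (-x) * x ^ n / n.factorial))
    fun x hx => gammaPDF_nat n (ht.trans (le_of_lt hx))]
  have hder : ∀ x ∈ Set.Ici t, HasDerivAt (fun y => -gammaTail n y)
      (Real.exp (-x) * x ^ n / n.factorial) x := fun x _ =>
    (hasDerivAt_gammaTail n x).fun_neg.congr_deriv (neg_neg _)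
  have hpos : ∀ x ∈ Set.Ioi t, 0 ≤ Real.exp (-x) * x ^ n / n.factorial := fun x hx => by
    have : 0 ≤ x := ht.trans (le_of_lt hx)
    positivity
  have htend : Filter.Tendsto (fun y => -gammaTail n y) Filter.atTop (nhds 0) := by
    simpa using (tendsto_gammaTail n).neg
  have hint := integrableOn_Ioi_deriv_of_nonneg' hder hpos htend
  rw [← ofReal_integral_eq_lintegral_ofReal hint
    ((ae_restrict_iff' measurableSet_Ioi).2 (Filter.Eventually.of_forall hpos)),
    integral_Ioi_of_hasDerivAt_of_nonneg' hder hpos htend]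
  simp

theorem gammaMeasure_Iio_zero {a r : ℝ} : gammaMeasure a r (Set.Iio 0) = 0 := by
  rw [gammaMeasure, withDensity_apply _ measurableSet_Iio,
    setLIntegral_congr_fun measurableSet_Iio (g := fun _ => 0) fun x hx => gammaPDF_of_neg hx]
  simp

/-- A nonnegative random variable with the right tail on `[0, ∞)` is Gamma distributed. -/
theorem eq_gammaMeasure_of_tail (n : ℕ) {μ : Measure ℝ} [IsProbabilityMeasure μ]
    (h0 : μ (Set.Iio 0) = 0)
    (h : ∀ t, 0 ≤ t → μ (Set.Ioi t) = ENNReal.ofReal (gammaTail n t)) :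
    μ = gammaMeasure (n + 1) 1 := by
  have := isProbabilityMeasure_gammaMeasure (a := n + 1) (r := 1) (by positivity) one_pos
  refine Measure.ext_of_Iic _ _ fun t => ?_
  rcases lt_or_ge t 0 with ht | ht
  · have hsub : Set.Iic t ⊆ Set.Iio 0 := Set.Iic_subset_Iio.2 ht
    rw [measure_mono_null hsub h0, measure_mono_null hsub gammaMeasure_Iio_zero]
  · rw [← compl_compl (Set.Iic t), Set.compl_Iic, prob_compl_eq_one_sub measurableSet_Ioi,
      prob_compl_eq_one_sub measurableSet_Ioi, h t ht, gammaMeasure_Ioi n ht]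

theorem expMeasure_Ioi (x : ℝ) :
    expMeasure 1 (Set.Ioi x) = ENNReal.ofReal (Real.exp (-max x 0)) := by
  have hp := isProbabilityMeasure_expMeasure (r := 1) one_pos
  have h0 := gammaMeasure_Ioi 0 (t := max x 0) (le_max_right _ _)
  have h1 : gammaTail 0 (max x 0) = Real.exp (-max x 0) := by simp [gammaTail]
  rw [h1] at h0
  rw [← h0, Nat.cast_zero, zero_add]
  rcases le_or_gt 0 x with hx | hx
  · rw [max_eq_left hx]; rfl
  · rw [max_eq_right hx.le]
    refine le_antisymm ?_ (measure_mono (Set.Ioi_subset_Ioi hx.le))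
    calc expMeasure 1 (Set.Ioi x) ≤ 1 := prob_le_one
      _ = gammaMeasure 1 1 (Set.Ioi 0) := by
        have := gammaMeasure_Ioi 0 (t := 0) le_rfl
        rw [Nat.cast_zero, zero_add] at this
        rw [this]; simp [gammaTail]

namespace IsUnitPoisson

variable {Ω : Type*} [MeasurableSpace Ω] {P : Measure Ω} {T : ℕ → Ω → ℝ}

/-- `T n` exceeds `t` exactly when at most `n` points lie in `[0, t]`. -/
theorem measure_lt (hT : IsUnitPoisson T P) (n : ℕ) {t : ℝ} (ht : 0 ≤ t) :
    P {ω | t < T n ω} = ENNReal.ofReal (gammaTail n t) := by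
  have hvol : volume (Set.Iic t ∩ Set.Ici 0) = ENNReal.ofReal t := by
    rw [Set.Iic_inter_Ici, Real.volume_Icc, sub_zero]
  have h1 : {ω | t < T n ω} =ᵐ[P]
      ⋃ k ∈ Finset.range (n + 1), {ω | tally T (Set.Iic t) ω = (k : ENNReal)} := by
    filter_upwards [hT.mono] with ω hω
    refine propext ?_
    change t < T n ω ↔ ω ∈ ⋃ k ∈ Finset.range (n + 1), {ω | tally T (Set.Iic t) ω = (k : ENNReal)}
    rw [← tally_le_iff hω]
    simp only [Set.mem_iUnion, Finset.mem_range, Set.mem_ofPred_eq, exists_prop]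
    constructor
    · intro h
      -- a tally bounded by `n` counts finitely many points, so it is a natural number
      have hfin : tally T (Set.Iic t) ω = ∑ i ∈ Finset.range n,
          (Set.Iic t).indicator (1 : ℝ → ENNReal) (T i ω) := by
        rw [tally, tsum_eq_sum]
        intro i hi
        have h2 : T n ω ≤ T i ω := hω (by simpa using hi)
        exact Set.indicator_of_notMem (s := Set.Iic t)
          (not_le.2 (((tally_le_iff hω t n).1 h).trans_le h2)) 1
      refine ⟨((Finset.range n).filter fun i => T i ω ≤ t).card, ?_, ?_⟩
      · exact Nat.lt_succ_of_le ((Finset.card_filter_le _ _).trans (by simp))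
      · rw [hfin, Finset.card_filter]
        push_cast
        refine Finset.sum_congr rfl fun i _ => ?_
        by_cases hi : T i ω ≤ t
        · rw [if_pos hi]; exact Set.indicator_of_mem (s := Set.Iic t) hi 1
        · rw [if_neg hi]; exact Set.indicator_of_notMem (s := Set.Iic t) hi 1
    · rintro ⟨k, hk, h⟩
      rw [h]
      exact_mod_cast Nat.lt_succ_iff.1 hk
  rw [measure_congr h1, measure_biUnion_finset]
  · rw [gammaTail, ENNReal.ofReal_sum_of_nonneg fun k _ => by positivity]
    exact Finset.sum_congr rfl fun k _ => hT.measure_tally_eq measurableSet_Iic ht hvol k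
  · intro i _ j _ hij
    refine Set.disjoint_left.2 fun ω hi hj => hij ?_
    have : (i : ENNReal) = j := hi.symm.trans hj
    exact_mod_cast this
  · intro k _
    exact measurable_tally hT.measurable measurableSet_Iic (measurableSet_singleton _)

theorem hasLaw_gammaMeasure [IsProbabilityMeasure P] (hT : IsUnitPoisson T P) (n : ℕ) :
    HasLaw (T n) (gammaMeasure (n + 1) 1) P := by
  have hp : IsProbabilityMeasure (P.map (T n)) :=
    Measure.isProbabilityMeasure_map (hT.measurable n).aemeasurable
  refine ⟨(hT.measurable n).aemeasurable, eq_gammaMeasure_of_tail n ?_ fun t ht => ?_⟩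
  · rw [Measure.map_apply (hT.measurable n) measurableSet_Iio]
    convert! measure_empty (μ := P)
    ext ω
    simpa using hT.nonneg n ω
  · rw [Measure.map_apply (hT.measurable n) measurableSet_Ioi]
    exact hT.measure_lt n ht

theorem measure_two_le_tally [IsProbabilityMeasure P] (hT : IsUnitPoisson T P) {B : Set ℝ}
    (hB : MeasurableSet B) {v : ℝ} (hv : 0 ≤ v)
    (hvol : volume (B ∩ Set.Ici 0) = ENNReal.ofReal v) :
    P {ω | 2 ≤ tally T B ω} ≤ ENNReal.ofReal (v ^ 2) := by
  have hm := measurable_tally hT.measurable hB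
  have h0 := hT.measure_tally_eq hB hv hvol 0
  have h1 := hT.measure_tally_eq hB hv hvol 1
  set A0 := {ω | tally T B ω = (0 : ℕ)}
  set A1 := {ω | tally T B ω = (1 : ℕ)}
  have hA0 : MeasurableSet A0 := hm (measurableSet_singleton _)
  have hA1 : MeasurableSet A1 := hm (measurableSet_singleton _)
  have hsub : {ω | 2 ≤ tally T B ω} ⊆ (A0 ∪ A1)ᶜ := by
    intro ω hω
    have hω' : 2 ≤ tally T B ω := hω
    rintro (h | h)
    · have h' : tally T B ω = (0 : ℕ) := h
      rw [h'] at hω'; simp at hω'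
    · have h' : tally T B ω = (1 : ℕ) := h
      rw [h'] at hω'; norm_num at hω'
  have hdisj : Disjoint A0 A1 := by
    refine Set.disjoint_left.2 fun ω hi hj => ?_
    have h : ((0 : ℕ) : ENNReal) = (1 : ℕ) := hi.symm.trans hj
    simp at h
  refine (measure_mono hsub).trans ?_
  rw [prob_compl_eq_one_sub (hA0.union hA1), measure_union hdisj hA1, h0, h1,
    ← ENNReal.ofReal_add (by positivity) (by positivity), ← ENNReal.ofReal_one,
    ← ENNReal.ofReal_sub _ (by positivity)]
  refine ENNReal.ofReal_le_ofReal ?_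
  have h2 := Real.add_one_le_exp (-v)
  simp only [pow_zero, pow_one, Nat.factorial_zero, Nat.factorial_one, Nat.cast_one, div_one,
    mul_one]
  nlinarith

/-- The points are almost surely distinct: cut `[0, A]` into `A K` cells of length `1 / K`; the
probability that some cell holds two points is at most `A K · K⁻²`. -/
theorem ae_lt_succ [IsProbabilityMeasure P] (hT : IsUnitPoisson T P) (n : ℕ) :
    ∀ᵐ ω ∂P, T n ω < T (n + 1) ω := by
  have key : ∀ A : ℕ, P {ω | T n ω = T (n + 1) ω ∧ T n ω < A} = 0 := by
    intro A
    have hbound : ∀ K : ℕ, P {ω | T n ω = T (n + 1) ω ∧ T n ω < A} ≤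
        ENNReal.ofReal ((A : ℝ) * (1 / ((K : ℝ) + 1))) := by
      intro K
      have hK : (0 : ℝ) < K + 1 := by positivity
      set cell : ℕ → Set ℝ := fun j => Set.Icc (j / (K + 1)) ((j + 1) / (K + 1))
      have hsub : {ω | T n ω = T (n + 1) ω ∧ T n ω < A} ⊆
          ⋃ j ∈ Finset.range (A * (K + 1)), {ω | 2 ≤ tally T (cell j) ω} := by
        rintro ω ⟨heq, hlt⟩
        have hnn := hT.nonneg n ω
        have hmem : T n ω ∈ cell ⌊T n ω * (K + 1)⌋₊ := by
          constructor
          · rw [div_le_iff₀ hK]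
            exact Nat.floor_le (by positivity)
          · rw [le_div_iff₀ hK]
            exact (Nat.lt_floor_add_one _).le
        refine Set.mem_biUnion (x := ⌊T n ω * (K + 1)⌋₊) ?_
          (two_le_tally (Nat.succ_ne_self n).symm hmem (heq ▸ hmem))
        rw [Finset.mem_coe, Finset.mem_range, Nat.floor_lt (by positivity)]
        push_cast
        gcongr
      refine (measure_mono hsub).trans ((measure_biUnion_finset_le _ _).trans ?_)
      have hcell : ∀ j ∈ Finset.range (A * (K + 1)), P {ω | 2 ≤ tally T (cell j) ω} ≤
          ENNReal.ofReal ((1 / ((K : ℝ) + 1)) ^ 2) := by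
        intro j _
        refine hT.measure_two_le_tally measurableSet_Icc (by positivity) ?_
        have : cell j ∩ Set.Ici 0 = cell j := by
          refine Set.inter_eq_left.2 fun x hx => ?_
          have h0 : (0 : ℝ) ≤ j / (K + 1) := by positivity
          exact h0.trans hx.1
        rw [this, Real.volume_Icc]
        congr 1
        field_simp
        ring
      refine (Finset.sum_le_sum hcell).trans ?_
      rw [Finset.sum_const, Finset.card_range, nsmul_eq_mul, ← ENNReal.ofReal_natCast,
        ← ENNReal.ofReal_mul (by positivity)]
      refine ENNReal.ofReal_le_ofReal (le_of_eq ?_)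
      push_cast
      field_simp
    have hlim : Filter.Tendsto (fun K : ℕ => ENNReal.ofReal ((A : ℝ) * (1 / ((K : ℝ) + 1))))
        Filter.atTop (nhds 0) := by
      have h1 := (tendsto_one_div_add_atTop_nhds_zero_nat (𝕜 := ℝ)).const_mul (A : ℝ)
      have h2 := ENNReal.tendsto_ofReal h1
      simpa using h2
    exact le_antisymm (ge_of_tendsto' hlim hbound) zero_le
  have hall : ∀ᵐ ω ∂P, ∀ A : ℕ, ¬ (T n ω = T (n + 1) ω ∧ T n ω < A) :=
    ae_all_iff.2 fun A => by
      rw [ae_iff]; simpa using key A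
  filter_upwards [hall, hT.mono] with ω h hmono
  refine lt_of_le_of_ne (hmono (Nat.le_succ n)) fun heq => ?_
  obtain ⟨A, hA⟩ := exists_nat_gt (T n ω)
  exact h A ⟨heq, hA⟩

/-- The waiting time after `T n`, tested against the events `{T 0 ≤ t 0, …, T n ≤ t n}`. Replacing
`T n` by the next multiple of a mesh `h` turns the left side into a sum over deterministic times,
where independence of increments applies; then `h → 0`. -/
theorem measure_box_inter_gap [IsProbabilityMeasure P] (hT : IsUnitPoisson T P) (n : ℕ)
    (t : Fin (n + 1) → ℝ) {x : ℝ} (hx : 0 ≤ x) :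
    P ({ω | ∀ i : Fin (n + 1), T i ω ≤ t i} ∩ {ω | x < T (n + 1) ω - T n ω}) =
      P {ω | ∀ i : Fin (n + 1), T i ω ≤ t i} * ENNReal.ofReal (Real.exp (-x)) := by
  set A := {ω | ∀ i : Fin (n + 1), T i ω ≤ t i}
  have hA : MeasurableSet A := by
    have : A = ⋂ i : Fin (n + 1), {ω | T i ω ≤ t i} := by ext; simp [A]
    rw [this]
    exact MeasurableSet.iInter fun i => measurableSet_le (hT.measurable _) measurable_const
  -- `J h ω * h` is the first multiple of `h` that is at least `T n ω`.
  set J : ℝ → Ω → ℕ := fun h ω => ⌈T n ω / h⌉₊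
  have hJm : ∀ h, Measurable (J h) := fun h => Nat.measurable_ceil.comp
    ((hT.measurable n).div_const h)
  -- The waiting time is replaced by the absence of points in an interval after this multiple.
  set E : ℝ → Set Ω := fun h => A ∩ {ω | ∀ i, T i ω ∉ Set.Ioc (J h ω * h) (J h ω * h + x)}
  have hfib : ∀ (j : ℕ) (h : ℝ), {ω | ∀ i, T i ω ∉ Set.Ioc (j * h) (j * h + x)} =
      {ω | tally T (Set.Ioc (j * h) (j * h + x)) ω = 0} := fun j h => by
    ext ω; exact tally_eq_zero_iff.symm
  have hEfib : ∀ (j : ℕ) (h : ℝ), E h ∩ J h ⁻¹' {j} =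
      (A ∩ J h ⁻¹' {j}) ∩ {ω | tally T (Set.Ioc (j * h) (j * h + x)) ω = 0} := by
    intro j h
    rw [← hfib]
    ext ω
    constructor
    · rintro ⟨⟨h1, h2⟩, h3⟩
      have h3' : J h ω = j := h3
      exact ⟨⟨h1, h3⟩, by simpa [h3'] using h2⟩
    · rintro ⟨⟨h1, h3⟩, h2⟩
      have h3' : J h ω = j := h3
      exact ⟨⟨h1, by simpa [h3'] using h2⟩, h3⟩
  have htz : ∀ (j : ℕ) (h : ℝ), MeasurableSet
      {ω | tally T (Set.Ioc (j * h) (j * h + x)) ω = 0} := fun j h =>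
    measurable_tally hT.measurable measurableSet_Ioc (measurableSet_singleton _)
  have hfm : ∀ (j : ℕ) (h : ℝ), MeasurableSet (A ∩ J h ⁻¹' {j}) := fun j h =>
    hA.inter (hJm h (measurableSet_singleton _))
  have hsplit : ∀ (h : ℝ) (S : Set Ω), S = ⋃ j, S ∩ J h ⁻¹' {j} := by
    intro h S; ext ω; simp
  have hEm : ∀ h, MeasurableSet (E h) := fun h => by
    rw [hsplit h (E h)]
    refine MeasurableSet.iUnion fun j => ?_
    rw [hEfib]
    exact (hfm j h).inter (htz j h)
  have hdisj : ∀ (h : ℝ) (S : Set Ω), Pairwise (Function.onFun Disjoint fun j => S ∩ J h ⁻¹' {j}) := by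
    intro h S i j hij
    refine Set.disjoint_left.2 fun ω h1 h2 => hij ?_
    have e1 : J h ω = i := h1.2
    have e2 : J h ω = j := h2.2
    exact e1.symm.trans e2
  have hcell : ∀ (h : ℝ), 0 < h → ∀ j : ℕ, P (E h ∩ J h ⁻¹' {j}) =
      P (A ∩ J h ⁻¹' {j}) * ENNReal.ofReal (Real.exp (-x)) := by
    intro h hh j
    rw [hEfib]
    have hjh : (0 : ℝ) ≤ j * h := by positivity
    set B : Option (Fin (n + 1)) → Set ℝ := fun o =>
      o.elim (Set.Iic (((j : ℝ) - 1) * h)) fun i => Set.Iic (min (t i) (j * h))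
    have hBm : ∀ o, MeasurableSet (B o) := by rintro (_ | i) <;> exact measurableSet_Iic
    have hBd : ∀ o, Disjoint (B o) (Set.Ioc ((j : ℝ) * h) (j * h + x)) := by
      rintro (_ | i) <;> refine Set.disjoint_left.2 fun y hy hy' => absurd hy'.1 (not_lt.2 ?_)
      · refine le_trans hy ?_
        nlinarith
      · exact le_trans hy (min_le_right _ _)
    have hind := hT.indepFun_tally hBm measurableSet_Ioc hBd
    -- On `{J h = j}`, the event `A` is determined by counts in sets lying to the left of `j h`:
    -- `(j - 1) h < T n` and `T i ≤ min (t i) (j h)` for all `i ≤ n`.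
    set V : Set (Option (Fin (n + 1)) → ENNReal) :=
      {v | v none ≤ n ∧ ∀ i : Fin (n + 1), ¬ v (some i) ≤ (i : ℕ)}
    have hV : MeasurableSet V := by
      have : V = {v | v none ≤ (n : ENNReal)} ∩
          ⋂ i : Fin (n + 1), {v | v (some i) ≤ ((i : ℕ) : ENNReal)}ᶜ := by
        ext v; simp [V]
      rw [this]
      exact (measurableSet_le (measurable_pi_apply _) measurable_const).inter
        (MeasurableSet.iInter fun i =>
          (measurableSet_le (measurable_pi_apply _) measurable_const).compl)
    have heq : (A ∩ J h ⁻¹' {j} : Set Ω) =ᵐ[P] (fun ω o => tally T (B o) ω) ⁻¹' V := by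
      filter_upwards [hT.mono] with ω hω
      refine propext ?_
      change (ω ∈ A ∧ J h ω = j) ↔ (tally T (B none) ω ≤ n ∧
        ∀ i : Fin (n + 1), ¬ tally T (B (some i)) ω ≤ (i : ℕ))
      have hnn := hT.nonneg n ω
      have hJ : J h ω = j ↔ ((j : ℝ) - 1) * h < T n ω ∧ T n ω ≤ j * h := by
        rcases Nat.eq_zero_or_pos j with rfl | hj
        · have : (J h ω = 0) ↔ T n ω ≤ 0 := by
            simp only [J, Nat.ceil_eq_zero, div_le_iff₀ hh, zero_mul]
          rw [this]
          constructor
          · intro h0; refine ⟨?_, by simpa using h0⟩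
            push_cast; linarith
          · rintro ⟨_, h0⟩; simpa using h0
        · rw [show J h ω = ⌈T n ω / h⌉₊ from rfl, Nat.ceil_eq_iff hj.ne', lt_div_iff₀ hh,
            div_le_iff₀ hh, Nat.cast_sub hj, Nat.cast_one]
      change _ ↔ (tally T (Set.Iic (((j : ℝ) - 1) * h)) ω ≤ n ∧ ∀ i : Fin (n + 1),
        ¬ tally T (Set.Iic (min (t i) (j * h))) ω ≤ (i : ℕ))
      simp only [tally_le_iff hω, not_lt, le_min_iff, hJ]
      constructor
      · rintro ⟨h1, h2, h3⟩
        refine ⟨h2, fun i => ⟨h1 i, le_trans (hω ?_) h3⟩⟩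
        exact Nat.lt_succ_iff.1 i.2
      · rintro ⟨h1, h2⟩
        exact ⟨fun i => (h2 i).1, h1, (h2 (Fin.last n)).2⟩
    have hvol : volume (Set.Ioc ((j : ℝ) * h) (j * h + x) ∩ Set.Ici 0) = ENNReal.ofReal x := by
      rw [Set.inter_eq_left.2 (show Set.Ioc ((j : ℝ) * h) (j * h + x) ⊆ Set.Ici 0 from
        fun y hy => hjh.trans hy.1.le), Real.volume_Ioc, add_sub_cancel_left]
    have hz := hT.measure_tally_eq (B := Set.Ioc ((j : ℝ) * h) (j * h + x)) measurableSet_Ioc hx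
      hvol 0
    have hz' : P {ω | tally T (Set.Ioc ((j : ℝ) * h) (j * h + x)) ω = 0} =
        ENNReal.ofReal (Real.exp (-x)) := by simpa using hz
    refine (measure_congr (heq.inter (Filter.EventuallyEq.refl _ _))).trans ?_
    rw [measure_congr heq, ← hz']
    exact hind.measure_inter_preimage_eq_mul V {0} hV (measurableSet_singleton _)
  have hmesh : ∀ h : ℝ, 0 < h → P (E h) = P A * ENNReal.ofReal (Real.exp (-x)) := by
    intro h hh
    rw [hsplit h (E h), measure_iUnion (hdisj h _) fun j => by
      rw [hEfib]; exact (hfm j h).inter (htz j h)]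
    simp_rw [hcell h hh]
    rw [ENNReal.tsum_mul_right, ← measure_iUnion (hdisj h _) fun j => hfm j h, ← hsplit h A]
  have hlim : Filter.Tendsto (fun k : ℕ => P (E (1 / ((k : ℝ) + 1)))) Filter.atTop
      (nhds (P (A ∩ {ω | x < T (n + 1) ω - T n ω}))) := by
    refine tendsto_measure_of_ae_tendsto_indicator_of_isFiniteMeasure _
      (hA.inter (measurableSet_lt measurable_const
        ((hT.measurable _).sub (hT.measurable _)))) (fun k => hEm _) ?_
    filter_upwards [hT.mono, hT.ae_lt_succ n] with ω hω hlt
    have hnn := hT.nonneg n ω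
    have hJ : ∀ k : ℕ, T n ω ≤ J (1 / ((k : ℝ) + 1)) ω * (1 / ((k : ℝ) + 1)) ∧
        J (1 / ((k : ℝ) + 1)) ω * (1 / ((k : ℝ) + 1)) < T n ω + 1 / ((k : ℝ) + 1) := by
      intro k
      have hk : (0 : ℝ) < 1 / ((k : ℝ) + 1) := by positivity
      constructor
      · rw [← div_le_iff₀ hk]; exact Nat.le_ceil _
      · have := Nat.ceil_lt_add_one (a := T n ω / (1 / ((k : ℝ) + 1))) (by positivity)
        calc _ < (T n ω / (1 / ((k : ℝ) + 1)) + 1) * (1 / ((k : ℝ) + 1)) := by gcongr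
          _ = _ := by field_simp
    have hsmall : ∀ ε > 0, ∀ᶠ k : ℕ in Filter.atTop, 1 / ((k : ℝ) + 1) < ε := fun ε hε =>
      (tendsto_one_div_add_atTop_nhds_zero_nat (𝕜 := ℝ)).eventually (gt_mem_nhds hε)
    -- For small `h` the interval contains `T (n + 1) ω` if the waiting time is at most `x`, and no point
    -- otherwise. In the first case it starts before `T (n + 1) ω` because `T n ω < T (n + 1) ω`.
    by_cases hxgap : x < T (n + 1) ω - T n ω
    · filter_upwards [hsmall (T (n + 1) ω - T n ω - x) (by linarith)] with k hk
      obtain ⟨h1, h2⟩ := hJ k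
      refine and_congr_right fun _ => iff_of_true (fun i hi => ?_) hxgap
      rcases Nat.lt_or_ge n i with hni | hni
      · have h3 : T (n + 1) ω ≤ T i ω := hω hni
        have := hi.2
        linarith
      · have h3 : T i ω ≤ T n ω := hω hni
        have := hi.1
        linarith
    · filter_upwards [hsmall (T (n + 1) ω - T n ω) (by linarith)] with k hk
      obtain ⟨h1, h2⟩ := hJ k
      refine and_congr_right fun _ => iff_of_false (fun hi => ?_) hxgap
      exact hi (n + 1) ⟨by linarith, by linarith⟩
  refine tendsto_nhds_unique hlim ?_
  simp_rw [fun k : ℕ => hmesh (1 / ((k : ℝ) + 1)) (by positivity)]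
  exact tendsto_const_nhds

end IsUnitPoisson

/-! ### Independent exponential waiting times -/

/-- The waiting times `T 0, T 1 - T 0, T 2 - T 1, …`. -/
def gap {Ω : Type*} (T : ℕ → Ω → ℝ) : ℕ → Ω → ℝ
  | 0 => T 0
  | n + 1 => fun ω => T (n + 1) ω - T n ω

theorem sum_gap {Ω : Type*} (T : ℕ → Ω → ℝ) (n : ℕ) (ω : Ω) :
    ∑ i ∈ Finset.range (n + 1), gap T i ω = T n ω := by
  induction n with
  | zero => simp [gap]
  | succ n ih => rw [Finset.sum_range_succ, ih]; simp [gap]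

theorem sum_gap_add {Ω : Type*} (T : ℕ → Ω → ℝ) (m n : ℕ) (ω : Ω) :
    ∑ i ∈ Finset.range (n + 1), gap T (m + 1 + i) ω = T (m + 1 + n) ω - T m ω := by
  induction n with
  | zero => simp [gap]
  | succ n ih =>
    rw [Finset.sum_range_succ, ih, show m + 1 + (n + 1) = (m + 1 + n) + 1 by ring]
    simp [gap]

theorem measurable_gap {Ω : Type*} [MeasurableSpace Ω] {T : ℕ → Ω → ℝ}
    (hT : ∀ n, Measurable (T n)) : ∀ n, Measurable (gap T n)
  | 0 => hT 0
  | n + 1 => (hT (n + 1)).sub (hT n)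

instance isProbabilityMeasure_expMeasure_one : IsProbabilityMeasure (expMeasure 1) :=
  isProbabilityMeasure_expMeasure one_pos

namespace IsUnitPoisson

variable {Ω : Type*} [MeasurableSpace Ω] {P : Measure Ω} [IsProbabilityMeasure P]
  {T : ℕ → Ω → ℝ}

/-- The boxes `{T 0 ≤ t 0, …, T n ≤ t n}` and the half-lines `(x, ∞)` generate the product
σ-algebra, so `measure_box_inter_gap` determines the joint law. -/
theorem map_prefix_gap (hT : IsUnitPoisson T P) (n : ℕ) :
    P.map (fun ω => ((fun i : Fin (n + 1) => T i ω), gap T (n + 1) ω)) =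
      (P.map fun ω (i : Fin (n + 1)) => T i ω).prod (expMeasure 1) := by
  have hpre : Measurable fun ω (i : Fin (n + 1)) => T i ω :=
    measurable_pi_lambda _ fun i => hT.measurable i
  have hgap := measurable_gap hT.measurable (n + 1)
  have := Measure.isProbabilityMeasure_map (μ := P) hpre.aemeasurable
  have hspan : IsCountablySpanning (Set.range (Set.Iic : ℝ → Set ℝ)) :=
    ⟨fun k : ℕ => Set.Iic (k : ℝ), fun k => ⟨k, rfl⟩, by
      ext x; simpa using exists_nat_ge x⟩
  have hC : MeasurableSpace.pi (X := fun _ : Fin (n + 1) => ℝ) = MeasurableSpace.generateFrom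
      (Set.pi Set.univ '' Set.pi Set.univ fun _ : Fin (n + 1) => Set.range Set.Iic) := by
    rw [← generateFrom_pi_eq fun _ => hspan, ← borel_eq_generateFrom_Iic,
      ← BorelSpace.measurable_eq (α := ℝ)]
  have hD : (inferInstance : MeasurableSpace ℝ) =
      MeasurableSpace.generateFrom (Set.range Set.Ioi) := by
    rw [← borel_eq_generateFrom_Ioi]; exact BorelSpace.measurable_eq
  symm
  refine Measure.prod_eq_generateFrom hC.symm hD.symm (IsPiSystem.pi fun _ => isPiSystem_Iic)
    isPiSystem_Ioi
    ⟨fun k => Set.pi Set.univ fun _ => Set.Iic (k : ℝ),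
      fun k => ⟨_, fun i _ => ⟨k, rfl⟩, rfl⟩, fun k => measure_lt_top _ _, ?_⟩
    ⟨fun k => Set.Ioi (-(k : ℝ)), fun k => ⟨_, rfl⟩, fun k => measure_lt_top _ _, ?_⟩ ?_
  · refine Set.eq_univ_of_forall fun v => Set.mem_iUnion.2 ?_
    obtain ⟨k, hk⟩ := exists_nat_ge (∑ i, |v i|)
    refine ⟨k, fun i _ => le_trans ?_ hk⟩
    exact (le_abs_self _).trans
      (Finset.single_le_sum (f := fun i => |v i|) (fun _ _ => abs_nonneg _) (Finset.mem_univ i))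
  · refine Set.eq_univ_of_forall fun x => Set.mem_iUnion.2 ?_
    obtain ⟨k, hk⟩ := exists_nat_gt (-x)
    exact ⟨k, by simp only [Set.mem_Ioi]; linarith⟩
  · rintro _ ⟨s, hs, rfl⟩ _ ⟨x, rfl⟩
    choose t ht using fun i => hs i (Set.mem_univ i)
    have hbox : MeasurableSet (Set.pi Set.univ s) :=
      MeasurableSet.univ_pi fun i => by rw [← ht i]; exact measurableSet_Iic
    rw [Measure.map_apply (hpre.prodMk hgap) (hbox.prod measurableSet_Ioi),
      Measure.map_apply hpre hbox, expMeasure_Ioi]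
    have h1 : (fun ω (i : Fin (n + 1)) => T i ω) ⁻¹' Set.pi Set.univ s =
        {ω | ∀ i : Fin (n + 1), T i ω ≤ t i} := by
      ext ω; simp [← ht]
    have h2 : (fun ω => ((fun i : Fin (n + 1) => T i ω), gap T (n + 1) ω)) ⁻¹'
        (Set.pi Set.univ s ×ˢ Set.Ioi x) =ᵐ[P]
        ({ω | ∀ i : Fin (n + 1), T i ω ≤ t i} ∩ {ω | max x 0 < T (n + 1) ω - T n ω} : Set Ω) := by
      filter_upwards [hT.ae_lt_succ n] with ω hω
      refine propext ?_
      change ((fun i : Fin (n + 1) => T i ω) ∈ Set.pi Set.univ s ∧ x < T (n + 1) ω - T n ω) ↔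
        ((∀ i : Fin (n + 1), T i ω ≤ t i) ∧ max x 0 < T (n + 1) ω - T n ω)
      have h3 : 0 < T (n + 1) ω - T n ω := by linarith
      rw [max_lt_iff, and_iff_left h3]
      refine and_congr_left fun _ => ?_
      simp [← ht]
    rw [measure_congr h2, h1, hT.measure_box_inter_gap n t (le_max_right x 0)]

/-- The waiting times of a unit-rate Poisson process are independent standard exponentials. -/
theorem hasLaw_gap (hT : IsUnitPoisson T P) :
    HasLaw (fun ω n => gap T n ω) (Measure.infinitePi fun _ : ℕ => expMeasure 1) P := by
  have hgm := measurable_gap hT.measurable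
  have hm : Measurable fun ω n => gap T n ω := measurable_pi_lambda _ hgm
  have hrange : ∀ (n : ℕ) (S : ℕ → Set ℝ), (∀ i, MeasurableSet (S i)) →
      P {ω | ∀ i ∈ Finset.range n, gap T i ω ∈ S i} = ∏ i ∈ Finset.range n, expMeasure 1 (S i) := by
    intro n S hS
    induction n with
    | zero => simp
    | succ n ih =>
      rw [Finset.prod_range_succ, ← ih]
      rcases n with _ | n
      · have h0 := (hT.hasLaw_gammaMeasure 0).map_eq
        rw [Nat.cast_zero, zero_add] at h0
        change _ = _ * gammaMeasure 1 1 (S 0)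
        rw [← h0, Measure.map_apply (hT.measurable 0) (hS 0)]
        simp [gap]
        rfl
      · have hgapT : ∀ i, i < n + 1 → ∃ φ : (Fin (n + 1) → ℝ) → ℝ, Measurable φ ∧
            ∀ ω, gap T i ω = φ (fun j : Fin (n + 1) => T j ω) := by
          intro i hi
          rcases i with _ | i
          · exact ⟨fun v => v ⟨0, hi⟩, measurable_pi_apply _, fun ω => rfl⟩
          · exact ⟨fun v => v ⟨i + 1, hi⟩ - v ⟨i, by omega⟩, by fun_prop, fun ω => rfl⟩
        choose! φ hφm hφ using hgapT
        set V : Set (Fin (n + 1) → ℝ) := ⋂ i ∈ Finset.range (n + 1), φ i ⁻¹' S i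
        have hV : MeasurableSet V := Finset.measurableSet_biInter _ fun i hi =>
          hφm i (Finset.mem_range.1 hi) (hS i)
        have hpre : Measurable fun ω (i : Fin (n + 1)) => T i ω :=
          measurable_pi_lambda _ fun i => hT.measurable i
        have hVeq : {ω | ∀ i ∈ Finset.range (n + 1), gap T i ω ∈ S i} =
            (fun ω (i : Fin (n + 1)) => T i ω) ⁻¹' V := by
          ext ω
          simp only [V, Set.mem_preimage, Set.mem_iInter, Set.mem_ofPred_eq]
          exact forall₂_congr fun i hi => by rw [hφ i (Finset.mem_range.1 hi)]
        have h1 : {ω | ∀ i ∈ Finset.range (n + 1 + 1), gap T i ω ∈ S i} =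
            (fun ω => ((fun i : Fin (n + 1) => T i ω), gap T (n + 1) ω)) ⁻¹' (V ×ˢ S (n + 1)) := by
          have : {ω | ∀ i ∈ Finset.range (n + 1 + 1), gap T i ω ∈ S i} =
              {ω | ∀ i ∈ Finset.range (n + 1), gap T i ω ∈ S i} ∩
                {ω | gap T (n + 1) ω ∈ S (n + 1)} := by
            ext ω
            simp only [Set.mem_inter_iff, Set.mem_ofPred_eq]
            rw [Finset.range_add_one, Finset.forall_mem_insert, and_comm]
          rw [this, hVeq]; rfl
        rw [h1, hVeq, ← Measure.map_apply (hpre.prodMk (hgm _)) (hV.prod (hS _)),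
          hT.map_prefix_gap n, Measure.prod_prod, Measure.map_apply hpre hV]
  refine ⟨hm.aemeasurable, Measure.eq_infinitePi _ fun s S hS => ?_⟩
  classical
  obtain ⟨n, hn⟩ : ∃ n, s ⊆ Finset.range n :=
    ⟨s.sup id + 1, fun i hi => Finset.mem_range.2 (Nat.lt_succ_of_le (Finset.le_sup (f := id) hi))⟩
  rw [Measure.map_apply hm (MeasurableSet.pi s.countable_toSet fun i _ => hS i)]
  have h := hrange n (fun i => if i ∈ s then S i else Set.univ) fun i => by
    split_ifs
    · exact hS i
    · exact MeasurableSet.univ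
  have h2 : {ω | ∀ i ∈ Finset.range n, gap T i ω ∈ if i ∈ s then S i else Set.univ} =
      (fun ω n => gap T n ω) ⁻¹' Set.pi s S := by
    ext ω
    simp only [Set.mem_preimage, Set.mem_pi, Set.mem_ofPred_eq, Finset.mem_coe]
    constructor
    · intro h i hi
      simpa [hi] using h i (hn hi)
    · intro h i _
      split_ifs with hi
      · exact h i hi
      · trivial
  rw [h2] at h
  rw [h, ← Finset.prod_subset hn fun i _ hi => by rw [if_neg hi]; exact measure_univ]
  exact Finset.prod_congr rfl fun i hi => by rw [if_pos hi]

theorem iIndepFun_gap (hT : IsUnitPoisson T P) : iIndepFun (gap T) P := by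
  have hgm := measurable_gap hT.measurable
  have h := hT.hasLaw_gap.map_eq
  rw [iIndepFun_iff_map_fun_eq_infinitePi_map hgm, h]
  congr 1
  funext n
  have h2 := Measure.map_map (μ := P) (measurable_pi_apply n)
    (measurable_pi_lambda (fun ω n => gap T n ω) hgm)
  rw [h, Measure.infinitePi_map_eval] at h2
  exact h2

/-- The partial sums `e 0, e 0 + e 1, …`. -/
def _root_.PZF.partialSums (e : ℕ → ℝ) (n : ℕ) : ℝ := ∑ i ∈ Finset.range (n + 1), e i

theorem _root_.PZF.measurable_partialSums : Measurable partialSums :=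
  measurable_pi_lambda _ fun _ => Finset.measurable_sum _ fun i _ => measurable_pi_apply i

theorem map_eq_partialSums (hT : IsUnitPoisson T P) :
    P.map (fun ω n => T n ω) =
      (Measure.infinitePi fun _ : ℕ => expMeasure 1).map partialSums := by
  have hm : Measurable fun ω n => gap T n ω :=
    measurable_pi_lambda _ (measurable_gap hT.measurable)
  rw [← hT.hasLaw_gap.map_eq, Measure.map_map measurable_partialSums hm]
  congr 1
  funext ω n
  exact (sum_gap T n ω).symm

/-- The Poisson process restarts afresh at each of its points. -/
theorem indepFun_restart (hT : IsUnitPoisson T P) (m : ℕ) :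
    IndepFun (fun ω (i : Fin (m + 1)) => T i ω) (fun ω n => T (m + 1 + n) ω - T m ω) P := by
  have h := indepFun_of_disjoint_range hT.iIndepFun_gap (measurable_gap hT.measurable)
    (a := fun i : Fin (m + 1) => (i : ℕ)) (b := fun n : ℕ => m + 1 + n) (by
      rw [Set.disjoint_left]
      rintro _ ⟨i, rfl⟩ ⟨n, hn⟩
      have := i.2
      simp only at hn
      omega)
  have h2 := h.comp (φ := fun (v : Fin (m + 1) → ℝ) (i : Fin (m + 1)) =>
      ∑ j ∈ Finset.univ.filter (fun j => j ≤ i), v j) (ψ := partialSums)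
    (by fun_prop) measurable_partialSums
  convert! h2 using 1
  · funext ω i
    rw [← sum_gap T i ω]
    simp only [Function.comp_apply]
    refine (Finset.sum_bij' (fun (j : Fin (m + 1)) _ => (j : ℕ))
      (fun j hj => ⟨j, by have := i.2; have := Finset.mem_range.1 hj; omega⟩) ?_ ?_ ?_ ?_ ?_).symm
    · intro j hj
      exact Finset.mem_range.2 (Nat.lt_succ_of_le (by simpa using hj))
    · intro j hj
      rw [Finset.mem_filter]
      exact ⟨Finset.mem_univ _, Nat.lt_succ_iff.1 (Finset.mem_range.1 hj)⟩
    · intro j _; rfl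
    · intro j _; rfl
    · intro j _; rfl
  · funext ω n
    exact (sum_gap_add T m n ω).symm

theorem map_restart (hT : IsUnitPoisson T P) (m : ℕ) :
    P.map (fun ω n => T (m + 1 + n) ω - T m ω) = P.map (fun ω n => T n ω) := by
  have hgm := measurable_gap hT.measurable
  have hm : Measurable fun ω n => gap T n ω := measurable_pi_lambda _ hgm
  rw [hT.map_eq_partialSums]
  have h1 := Measure.map_infinitePi_infinitePi_of_inj (P := fun _ : ℕ => expMeasure 1)
    (f := fun n : ℕ => m + 1 + n) (fun a b h => by simpa using h)
  have hsh : Measurable fun (e : ℕ → ℝ) (i : ℕ) => e (m + 1 + i) := by fun_prop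
  rw [← h1, ← hT.hasLaw_gap.map_eq, Measure.map_map hsh hm,
    Measure.map_map measurable_partialSums (hsh.comp hm)]
  congr 1
  funext ω n
  exact (sum_gap_add T m n ω).symm

end IsUnitPoisson

/-! ### The Laplace functional of the Poisson process -/

theorem expNeg_mul_natCast (v : ENNReal) (k : ℕ) : expNeg (v * k) = expNeg v ^ k := by
  have h := expNeg_sum (Finset.range k) fun _ => v
  rw [Finset.sum_const, Finset.prod_const, Finset.card_range, nsmul_eq_mul, mul_comm] at h
  exact h

theorem expNeg_ne_top (v : ENNReal) : expNeg v ≠ ⊤ :=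
  ((expNeg_le_one v).trans_lt ENNReal.one_lt_top).ne

/-- The Laplace transform of the Poisson law. -/
theorem lintegral_expNeg_poissonMeasure (r : NNReal) (v : ENNReal) :
    ∫⁻ k : ℕ, expNeg (v * k) ∂poissonMeasure r = expNeg (r * (1 - expNeg v)) := by
  set x := (expNeg v).toReal with hx
  have hx0 : 0 ≤ x := ENNReal.toReal_nonneg
  have hv : expNeg v = ENNReal.ofReal x := (ENNReal.ofReal_toReal (expNeg_ne_top v)).symm
  have hx1 : x ≤ 1 := by
    have := ENNReal.toReal_mono ENNReal.one_ne_top (expNeg_le_one v)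
    simpa using this
  have hr : (r : ENNReal) = ENNReal.ofReal r := by simp
  rw [lintegral_countable']
  have h1 : ∀ k : ℕ, expNeg (v * k) * poissonMeasure r {k} =
      ENNReal.ofReal (Real.exp (-r) * ((r * x) ^ k / k.factorial)) := fun k => by
    rw [expNeg_mul_natCast, hv, poissonMeasure_singleton, ← ENNReal.ofReal_pow hx0,
      ← ENNReal.ofReal_mul (by positivity)]
    congr 1
    rw [mul_pow]; ring
  have h2 : HasSum (fun k : ℕ => Real.exp (-r) * ((r * x) ^ k / k.factorial))
      (Real.exp (-r) * Real.exp (r * x)) := by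
    rw [Real.exp_eq_exp_ℝ]
    exact (NormedSpace.expSeries_div_hasSum_exp (r * x : ℝ)).mul_left _
  simp_rw [h1]
  rw [← ENNReal.ofReal_tsum_of_nonneg (fun k => by positivity) h2.summable, h2.tsum_eq, hv, hr,
    ← ENNReal.ofReal_one, ← ENNReal.ofReal_sub _ hx0, ← ENNReal.ofReal_mul r.coe_nonneg,
    expNeg_ofReal (mul_nonneg r.coe_nonneg (sub_nonneg.2 hx1)), ← Real.exp_add]
  congr 2
  ring

namespace IsUnitPoisson

variable {Ω : Type*} [MeasurableSpace Ω] {P : Measure Ω} [IsProbabilityMeasure P]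
  {T : ℕ → Ω → ℝ}

theorem lintegral_expNeg_tally (hT : IsUnitPoisson T P) {B : Set ℝ} (hB : MeasurableSet B)
    {v : ENNReal} (hvol : v ≠ 0 → volume (B ∩ Set.Ici 0) < ⊤) :
    ∫⁻ ω, expNeg (v * tally T B ω) ∂P =
      expNeg ((1 - expNeg v) * volume (B ∩ Set.Ici 0)) := by
  rcases eq_or_ne v 0 with rfl | hv
  · simp
  have h := hT.law B hB (hvol hv)
  have hm : Measurable fun x : ENNReal => expNeg (v * x) :=
    measurable_expNeg.comp (measurable_const_mul v)
  rw [h.lintegral_comp (f := fun x => expNeg (v * x)) hm.aemeasurable,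
    lintegral_map hm (measurable_of_countable _), lintegral_expNeg_poissonMeasure,
    ENNReal.coe_toNNReal (hvol hv).ne, mul_comm]

/-- The level sets of a simple function carry independent Poisson numbers of points. -/
theorem laplace_simpleFunc (hT : IsUnitPoisson T P) (s : SimpleFunc ℝ ENNReal)
    (hs : ∀ v, v ≠ 0 → volume (s ⁻¹' {v} ∩ Set.Ici 0) < ⊤) :
    ∫⁻ ω, expNeg (∑' n, s (T n ω)) ∂P = expNeg (∫⁻ t in Set.Ici 0, (1 - expNeg (s t))) := by
  have h1 : ∀ ω, ∑' n, s (T n ω) = ∑ v ∈ s.range, v * tally T (s ⁻¹' {v}) ω := fun ω => by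
    simp_rw [tally, ← ENNReal.tsum_mul_left]
    rw [← Summable.tsum_finsetSum fun _ _ => ENNReal.summable]
    refine tsum_congr fun n => ?_
    rw [Finset.sum_eq_single (s (T n ω))]
    · simp
    · intro v _ hv
      rw [Set.indicator_of_notMem (fun h => hv h.symm), mul_zero]
    · intro h; exact absurd (s.mem_range_self _) h
  have hind := (hT.indep_of_finite (B := fun v : s.range => s ⁻¹' {(v : ENNReal)})
    (fun v => s.measurableSet_preimage _) (fun v w hvw => by
      refine Set.disjoint_left.2 fun x hx hx' => hvw (Subtype.ext ?_)
      exact (show s x = v from hx).symm.trans hx')).comp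
      (fun (v : s.range) x => expNeg (v * x))
      (fun v => measurable_expNeg.comp (measurable_const_mul _))
  simp_rw [h1, expNeg_sum]
  have h2 : ∀ ω, ∏ v ∈ s.range, expNeg (v * tally T (s ⁻¹' {v}) ω) =
      ∏ v : s.range, expNeg (v * tally T (s ⁻¹' {(v : ENNReal)}) ω) := fun ω =>
    (Finset.prod_coe_sort s.range fun v => expNeg (v * tally T (s ⁻¹' {v}) ω)).symm
  simp_rw [h2]
  have h3 := lintegral_prod_eq_prod_lintegral_of_indepFun Finset.univ _ hind
    (fun v => (measurable_expNeg.comp (measurable_const_mul _)).comp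
      (measurable_tally hT.measurable (s.measurableSet_preimage _)))
  simp only [Function.comp_def] at h3
  rw [h3]
  have h4 : ∫⁻ t in Set.Ici 0, (1 - expNeg (s t)) =
      ∑ v : s.range, (1 - expNeg v) * volume (s ⁻¹' {(v : ENNReal)} ∩ Set.Ici 0) := by
    have h5 := SimpleFunc.map_lintegral (μ := volume.restrict (Set.Ici (0 : ℝ)))
      (fun v => 1 - expNeg v) s
    rw [← SimpleFunc.lintegral_eq_lintegral] at h5
    rw [Finset.sum_coe_sort s.range
      (fun v => (1 - expNeg v) * volume (s ⁻¹' {v} ∩ Set.Ici 0))]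
    refine Eq.trans h5 (Finset.sum_congr rfl fun v _ => ?_)
    rw [Measure.restrict_apply (s.measurableSet_preimage _)]
  rw [h4, expNeg_sum]
  exact Finset.prod_congr rfl fun v _ =>
    hT.lintegral_expNeg_tally (s.measurableSet_preimage _) (hs v)

/-- The Laplace functional of a Poisson process of rate one. -/
theorem laplace (hT : IsUnitPoisson T P) {φ : ℝ → ENNReal} (hφ : Measurable φ) :
    ∫⁻ ω, expNeg (∑' n, φ (T n ω)) ∂P = expNeg (∫⁻ t in Set.Ici 0, (1 - expNeg (φ t))) := by
  -- Simple functions supported on `[0, k]` increase to `φ`, and their level sets have finite length.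
  set s : ℕ → SimpleFunc ℝ ENNReal := fun k =>
    (SimpleFunc.eapprox φ k).restrict (Set.Icc 0 (k : ℝ)) with hsdef
  have hs_apply : ∀ k x, s k x = (Set.Icc 0 (k : ℝ)).indicator (SimpleFunc.eapprox φ k) x :=
    fun k x => SimpleFunc.restrict_apply _ measurableSet_Icc x
  have hs_mono : ∀ x, Monotone fun k => s k x := fun x i j hij => by
    simp only [hs_apply]
    refine (Set.indicator_le_indicator (SimpleFunc.monotone_eapprox φ hij x)).trans ?_
    refine Set.indicator_le_indicator_of_subset
      (Set.Icc_subset_Icc_right (by exact_mod_cast hij)) (fun _ => zero_le) x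
  have hs_tend : ∀ x, 0 ≤ x → Filter.Tendsto (fun k => s k x) Filter.atTop (nhds (φ x)) := by
    intro x hx
    refine (SimpleFunc.tendsto_eapprox hφ x).congr' ?_
    obtain ⟨N, hN⟩ := exists_nat_ge x
    filter_upwards [Filter.eventually_ge_atTop N] with k hk
    have hk' : (N : ℝ) ≤ k := by exact_mod_cast hk
    rw [hs_apply, Set.indicator_of_mem (s := Set.Icc 0 (k : ℝ)) ⟨hx, hN.trans hk'⟩]
  have hs_vol : ∀ k v, v ≠ 0 → volume (s k ⁻¹' {v} ∩ Set.Ici 0) < ⊤ := fun k v hv => by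
    rw [hsdef, SimpleFunc.restrict_preimage_singleton _ measurableSet_Icc hv]
    refine (measure_mono (Set.inter_subset_left.trans Set.inter_subset_left)).trans_lt ?_
    simp
  have hL : Filter.Tendsto (fun k => ∫⁻ ω, expNeg (∑' n, s k (T n ω)) ∂P) Filter.atTop
      (nhds (∫⁻ ω, expNeg (∑' n, φ (T n ω)) ∂P)) := by
    refine tendsto_lintegral_of_dominated_convergence (fun _ => 1) (fun k => ?_)
      (fun k => Filter.Eventually.of_forall fun ω => expNeg_le_one _) (by simp)
      (Filter.Eventually.of_forall fun ω => ?_)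
    · exact measurable_expNeg.comp
        (Measurable.tsum fun n => (s k).measurable.comp (hT.measurable n))
    · refine (continuous_expNeg.tendsto _).comp ?_
      have := lintegral_tendsto_of_tendsto_of_monotone (μ := Measure.count)
        (f := fun k n => s k (T n ω)) (F := fun n => φ (T n ω))
        (fun k => (measurable_of_countable _).aemeasurable)
        (Filter.Eventually.of_forall fun n => hs_mono _)
        (Filter.Eventually.of_forall fun n => hs_tend _ (hT.nonneg n ω))
      simpa only [lintegral_count] using this
  have hR : Filter.Tendsto (fun k => expNeg (∫⁻ t in Set.Ici 0, (1 - expNeg (s k t))))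
      Filter.atTop (nhds (expNeg (∫⁻ t in Set.Ici 0, (1 - expNeg (φ t))))) := by
    refine (continuous_expNeg.tendsto _).comp ?_
    refine lintegral_tendsto_of_tendsto_of_monotone
      (fun k => (measurable_const.sub (measurable_expNeg.comp (s k).measurable)).aemeasurable)
      (Filter.Eventually.of_forall fun x i j hij =>
        tsub_le_tsub_left (expNeg_antitone (hs_mono x hij)) 1) ?_
    refine (ae_restrict_iff' measurableSet_Ici).2 (Filter.Eventually.of_forall fun x hx => ?_)
    exact ENNReal.Tendsto.sub tendsto_const_nhds
      ((continuous_expNeg.tendsto _).comp (hs_tend x hx)) (Or.inl ENNReal.one_ne_top)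
  refine tendsto_nhds_unique hL ?_
  simp_rw [fun k => hT.laplace_simpleFunc (s k) (hs_vol k)]
  exact hR

end IsUnitPoisson

/-! ### The ratio of the distances and the further point -/

theorem measurable_ratioDensity (m : ℕ) : Measurable (ratioDensity m) := by
  unfold ratioDensity
  refine Measurable.ite measurableSet_Ioi ?_ measurable_const
  have : Measurable fun b : ℝ => b ^ (1 - 2 * (m : ℤ)) := by fun_prop
  fun_prop

theorem gammaMeasure_lintegral (n : ℕ) {f : ℝ → ENNReal} (hf : Measurable f) :
    ∫⁻ x, f x ∂gammaMeasure (n + 1) 1 =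
      ∫⁻ x in Set.Ioi 0, ENNReal.ofReal (Real.exp (-x) * x ^ n / n.factorial) * f x := by
  have hg : Measurable (gammaPDF ((n : ℝ) + 1) 1) :=
    (measurable_gammaPDFReal _ _).ennreal_ofReal
  rw [gammaMeasure, lintegral_withDensity_eq_lintegral_mul _ hg hf,
    ← lintegral_add_compl _ (measurableSet_Ici (a := (0 : ℝ))), Set.compl_Ici,
    setLIntegral_congr_fun (s := Set.Iio 0) measurableSet_Iio (g := fun _ => 0)
      (fun x hx => by simp [gammaPDF_of_neg hx]),
    setLIntegral_congr Ioi_ae_eq_Ici.symm]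
  simp only [lintegral_const, zero_mul, add_zero]
  exact setLIntegral_congr_fun measurableSet_Ioi fun x hx => by
    rw [Pi.mul_apply, gammaPDF_nat n (le_of_lt hx)]

/-- `E e^{-c U} = (1 + c)^{-n-1}` for a Gamma distributed variable `U` of shape `n + 1`. -/
theorem lintegral_expNeg_gammaMeasure (n : ℕ) {c : ℝ} (hc : 0 ≤ c) :
    ∫⁻ u, expNeg (ENNReal.ofReal (c * u)) ∂gammaMeasure (n + 1) 1 =
      ENNReal.ofReal (((1 + c) ^ (n + 1))⁻¹) := by
  have hc1 : 0 < 1 + c := by linarith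
  rw [gammaMeasure_lintegral n (f := fun u => expNeg (ENNReal.ofReal (c * u)))
    (measurable_expNeg.comp (by fun_prop))]
  have h1 := lintegral_gammaPDF_eq_one (a := (n : ℝ) + 1) (r := 1 + c) (by positivity) hc1
  rw [← lintegral_add_compl _ (measurableSet_Ici (a := (0 : ℝ))), Set.compl_Ici,
    setLIntegral_congr_fun (s := Set.Iio 0) measurableSet_Iio (g := fun _ => 0)
      (fun x hx => gammaPDF_of_neg hx),
    setLIntegral_congr Ioi_ae_eq_Ici.symm] at h1
  simp only [lintegral_const, zero_mul, add_zero] at h1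
  rw [← mul_one (ENNReal.ofReal _), ← h1, ← lintegral_const_mul' _ _ ENNReal.ofReal_ne_top]
  refine setLIntegral_congr_fun measurableSet_Ioi fun x hx => ?_
  have hx0 : 0 < x := hx
  rw [expNeg_ofReal (by positivity), gammaPDF_of_nonneg hx0.le, ← ENNReal.ofReal_mul (by positivity),
    ← ENNReal.ofReal_mul (by positivity), Real.Gamma_nat_eq_factorial]
  congr 1
  rw [show ((n : ℝ) + 1 - 1) = n by ring, Real.rpow_natCast,
    show ((n : ℝ) + 1) = ((n + 1 : ℕ) : ℝ) by push_cast; ring, Real.rpow_natCast]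
  have : Real.exp (-((1 + c) * x)) = Real.exp (-x) * Real.exp (-(c * x)) := by
    rw [← Real.exp_add]; congr 1; ring
  rw [this]
  field_simp

/-- If `a` and `s` are independent Gamma variables of shapes `1` and `n + 1`, then the pair
`√((a + s) / a)`, `a + s` consists of independent variables with density `ratioDensity (n + 2)` and
of Gamma law with shape `n + 2`. -/
theorem lintegral_ratio (n : ℕ) {F : ℝ × ℝ → ENNReal} (hF : Measurable F) :
    ∫⁻ a, ∫⁻ s, F (√((a + s) / a), a + s) ∂gammaMeasure (n + 1) 1 ∂gammaMeasure ((0 : ℕ) + 1) 1 =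
      ∫⁻ b, ENNReal.ofReal (ratioDensity (n + 2) b) *
        ∫⁻ u, F (b, u) ∂gammaMeasure ((n + 1 : ℕ) + 1) 1 := by
  have hg : IsProbabilityMeasure (gammaMeasure ((n : ℝ) + 1) 1) :=
    isProbabilityMeasure_gammaMeasure (by positivity) one_pos
  -- In the variables `a` and `u = a + s` the integrand is `K a u`; then `a = u / b ^ 2` for fixed `u`.
  set K : ℝ → ℝ → ENNReal := fun a u => (Set.Ioo 0 u).indicator
    (fun a => ENNReal.ofReal (Real.exp (-u) * (u - a) ^ n / n.factorial) * F (√(u / a), u)) a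
    with hK
  have hKm : Measurable (Function.uncurry K) := by
    have : Function.uncurry K = {p : ℝ × ℝ | 0 < p.1 ∧ p.1 < p.2}.indicator
        (fun p => ENNReal.ofReal (Real.exp (-p.2) * (p.2 - p.1) ^ n / n.factorial) *
          F (√(p.2 / p.1), p.2)) := by
      funext p
      simp only [Function.uncurry, hK]
      by_cases h : 0 < p.1 ∧ p.1 < p.2
      · rw [Set.indicator_of_mem (s := Set.Ioo 0 p.2) h,
          Set.indicator_of_mem (s := {p : ℝ × ℝ | 0 < p.1 ∧ p.1 < p.2}) h]
      · rw [Set.indicator_of_notMem (s := Set.Ioo 0 p.2) h,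
          Set.indicator_of_notMem (s := {p : ℝ × ℝ | 0 < p.1 ∧ p.1 < p.2}) h]
    rw [this]
    refine Measurable.indicator (by fun_prop) ?_
    exact (measurableSet_lt measurable_const measurable_fst).inter
      (measurableSet_lt measurable_fst measurable_snd)
  have hL : ∫⁻ a, ∫⁻ s, F (√((a + s) / a), a + s) ∂gammaMeasure (n + 1) 1
      ∂gammaMeasure ((0 : ℕ) + 1) 1 = ∫⁻ a, ∫⁻ u, K a u := by
    rw [gammaMeasure_lintegral 0 (Measurable.lintegral_prod_right (by fun_prop)),
      ← lintegral_indicator measurableSet_Ioi]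
    refine lintegral_congr fun a => ?_
    by_cases ha : 0 < a
    · rw [Set.indicator_of_mem (s := Set.Ioi 0) ha, gammaMeasure_lintegral n (by fun_prop),
        ← lintegral_const_mul' _ _ ENNReal.ofReal_ne_top, ← lintegral_indicator measurableSet_Ioi,
        ← lintegral_sub_right_eq_self _ a]
      refine lintegral_congr fun u => ?_
      by_cases hu : a < u
      · rw [Set.indicator_of_mem (s := Set.Ioi 0) (show 0 < u - a from sub_pos.2 hu), hK]
        simp only
        rw [Set.indicator_of_mem (s := Set.Ioo 0 u) ⟨ha, hu⟩, add_sub_cancel, ← mul_assoc,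
          ← ENNReal.ofReal_mul (by positivity)]
        congr 2
        have : Real.exp (-u) = Real.exp (-a) * Real.exp (-(u - a)) := by
          rw [← Real.exp_add]; congr 1; ring
        rw [this]
        simp only [pow_zero, Nat.factorial_zero, Nat.cast_one, mul_one, div_one]
        ring
      · rw [Set.indicator_of_notMem (s := Set.Ioi 0) (show ¬ 0 < u - a by linarith), hK]
        simp only
        rw [Set.indicator_of_notMem (s := Set.Ioo 0 u) (fun h => hu h.2)]
    · rw [Set.indicator_of_notMem (s := Set.Ioi 0) ha]
      have : ∀ u, K a u = 0 := fun u => Set.indicator_of_notMem (s := Set.Ioo 0 u)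
        (fun h => ha h.1) _
      simp [this]
  have hin : ∀ u, 0 < u → ∫⁻ a, K a u =
      ∫⁻ b, ENNReal.ofReal (ratioDensity (n + 2) b) *
        (ENNReal.ofReal (Real.exp (-u) * u ^ (n + 1) / (n + 1).factorial) * F (b, u)) := by
    intro u hu
    have himg : (fun b : ℝ => u / b ^ 2) '' Set.Ioi 1 = Set.Ioo 0 u := by
      ext a
      constructor
      · rintro ⟨b, hb, rfl⟩
        have hb1 : (1 : ℝ) < b := hb
        exact ⟨by positivity, div_lt_self hu (by nlinarith)⟩
      · rintro ⟨ha, hau⟩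
        have h1 : 1 < u / a := (one_lt_div ha).2 hau
        refine ⟨√(u / a), ?_, ?_⟩
        · rw [Set.mem_Ioi, Real.lt_sqrt zero_le_one]; simpa using h1
        · simp only
          rw [Real.sq_sqrt (by positivity)]
          field_simp
    have hder : ∀ b ∈ Set.Ioi (1 : ℝ),
        HasDerivWithinAt (fun b : ℝ => u / b ^ 2) (-(2 * u / b ^ 3)) (Set.Ioi 1) b := by
      intro b hb
      have hb0 : b ≠ 0 := (zero_lt_one.trans hb).ne'
      have h := (hasDerivAt_const b u).fun_div (hasDerivAt_pow 2 b) (pow_ne_zero 2 hb0)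
      refine (h.congr_deriv ?_).hasDerivWithinAt
      field_simp
      ring
    have hinj : Set.InjOn (fun b : ℝ => u / b ^ 2) (Set.Ioi 1) := by
      intro b hb c hc hbc
      have hb0 : 0 < b := zero_lt_one.trans hb
      have hc0 : 0 < c := zero_lt_one.trans hc
      simp only at hbc
      rw [div_eq_div_iff (by positivity) (by positivity)] at hbc
      have h2 : c ^ 2 = b ^ 2 := mul_left_cancel₀ hu.ne' hbc
      exact ((pow_left_inj₀ hc0.le hb0.le two_ne_zero).1 h2).symm
    have h1 : ∫⁻ a, K a u = ∫⁻ a in Set.Ioo 0 u,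
        ENNReal.ofReal (Real.exp (-u) * (u - a) ^ n / n.factorial) * F (√(u / a), u) := by
      rw [← lintegral_indicator measurableSet_Ioo]
    rw [h1, ← himg, lintegral_image_eq_lintegral_abs_deriv_mul measurableSet_Ioi hder hinj,
      ← lintegral_indicator measurableSet_Ioi]
    refine lintegral_congr fun b => ?_
    by_cases hb : 1 < b
    · have hb0 : 0 < b := by linarith
      have hb2 : 0 ≤ b ^ 2 - 1 := by nlinarith
      rw [Set.indicator_of_mem (s := Set.Ioi 1) hb, ratioDensity, if_pos hb,
        show u / (u / b ^ 2) = b ^ 2 by field_simp, Real.sqrt_sq hb0.le, ← mul_assoc, ← mul_assoc,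
        ← ENNReal.ofReal_mul (abs_nonneg _), ← ENNReal.ofReal_mul (by
          push_cast
          have : (0 : ℝ) ≤ (n : ℝ) + 2 - 1 := by linarith [(Nat.cast_nonneg n : (0 : ℝ) ≤ n)]
          positivity)]
      congr 2
      rw [abs_neg, abs_of_nonneg (by positivity), Nat.add_sub_cancel,
        show u - u / b ^ 2 = u * (b ^ 2 - 1) / b ^ 2 by field_simp, Nat.factorial_succ]
      have hz : b ^ (1 - 2 * ((n + 2 : ℕ) : ℤ)) = (b ^ (2 * n + 3))⁻¹ := by
        rw [← zpow_natCast, ← zpow_neg]; congr 1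
      rw [hz]
      push_cast
      have hfac : (n.factorial : ℝ) ≠ 0 := by positivity
      have hn1 : (n : ℝ) + 1 ≠ 0 := by positivity
      rw [show (n : ℝ) + 2 - 1 = n + 1 by ring, div_pow, mul_pow]
      field_simp
      ring
    · rw [Set.indicator_of_notMem (s := Set.Ioi 1) hb, ratioDensity, if_neg hb]
      simp
  have hKnonpos : ∀ u, ¬ 0 < u → ∫⁻ a, K a u = 0 := fun u hu => by
    have : ∀ a, K a u = 0 := fun a => Set.indicator_of_notMem (s := Set.Ioo 0 u)
        (fun h => hu (h.1.trans h.2)) _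
    simp [this]
  have hrm := measurable_ratioDensity (n + 2)
  rw [hL, lintegral_lintegral_swap hKm.aemeasurable]
  have hR : ∀ b, ENNReal.ofReal (ratioDensity (n + 2) b) *
        ∫⁻ u, F (b, u) ∂gammaMeasure ((n + 1 : ℕ) + 1) 1 =
      ∫⁻ u in Set.Ioi 0, ENNReal.ofReal (ratioDensity (n + 2) b) *
        (ENNReal.ofReal (Real.exp (-u) * u ^ (n + 1) / (n + 1).factorial) * F (b, u)) := fun b => by
    rw [gammaMeasure_lintegral (n + 1) (by fun_prop),
      lintegral_const_mul' _ _ ENNReal.ofReal_ne_top]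
  simp_rw [hR]
  refine Eq.trans ?_ (lintegral_lintegral_swap (by fun_prop)).symm
  rw [← lintegral_indicator measurableSet_Ioi]
  refine lintegral_congr fun u => ?_
  by_cases hu : 0 < u
  · rw [Set.indicator_of_mem (s := Set.Ioi 0) hu, hin u hu]
  · rw [Set.indicator_of_notMem (s := Set.Ioi 0) hu, hKnonpos u hu]

namespace IsUnitPoisson

variable {Ω : Type*} [MeasurableSpace Ω] {P : Measure Ω} [IsProbabilityMeasure P]
  {T : ℕ → Ω → ℝ}

theorem ae_pos (hT : IsUnitPoisson T P) : ∀ᵐ ω ∂P, ∀ n, 0 < T n ω := by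
  have h0 : ∀ᵐ ω ∂P, 0 < T 0 ω := by
    have hp := (hT.hasLaw_gammaMeasure 0).measure_eq (p := fun x => 0 < x) measurableSet_Ioi
    have h1 : P {ω | 0 < T 0 ω} = 1 := by
      rw [hp]
      have := gammaMeasure_Ioi 0 (le_refl (0 : ℝ))
      simp only [gammaTail] at this
      simpa [Set.Ioi] using this
    exact (prob_compl_eq_zero_iff (measurableSet_lt measurable_const (hT.measurable 0))).2 h1
  filter_upwards [h0, hT.mono] with ω h1 h2 n
  exact h1.trans_le (h2 (Nat.zero_le n))

/-- The pair consists of functions of `T 0` and the later increment `T (n + 1) - T 0`, which are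
independent Gamma variables. -/
theorem map_ratio_succ (hT : IsUnitPoisson T P) (n : ℕ) :
    P.map (fun ω => (√(T (n + 1) ω / T 0 ω), T (n + 1) ω)) =
      (volume.withDensity fun b => ENNReal.ofReal (ratioDensity (n + 2) b)).prod
        (gammaMeasure ((n + 1 : ℕ) + 1) 1) := by
  have hm := hT.measurable
  have hg : ∀ k : ℕ, IsProbabilityMeasure (gammaMeasure ((k : ℝ) + 1) 1) := fun k =>
    isProbabilityMeasure_gammaMeasure (by positivity) one_pos
  have hSm : Measurable fun ω => T (0 + 1 + n) ω - T 0 ω := (hm _).sub (hm _)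
  have hind : IndepFun (T 0) (fun ω => T (0 + 1 + n) ω - T 0 ω) P :=
    (hT.indepFun_restart 0).comp (φ := fun v : Fin 1 → ℝ => v 0) (ψ := fun v : ℕ → ℝ => v n)
      (by fun_prop) (by fun_prop)
  have hS : P.map (fun ω => T (0 + 1 + n) ω - T 0 ω) = gammaMeasure (n + 1) 1 := by
    have h1 := congrArg (Measure.map fun v : ℕ → ℝ => v n) (hT.map_restart 0)
    rw [Measure.map_map (by fun_prop) (by fun_prop), Measure.map_map (by fun_prop) (by fun_prop)]
      at h1
    exact h1.trans (hT.hasLaw_gammaMeasure n).map_eq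
  have hjoint := (indepFun_iff_map_prod_eq_prod_map_map (hm 0).aemeasurable hSm.aemeasurable).1 hind
  rw [hS, (hT.hasLaw_gammaMeasure 0).map_eq] at hjoint
  refine Measure.ext_of_lintegral _ fun F hF => ?_
  rw [lintegral_map hF (by fun_prop)]
  have h2 : ∫⁻ ω, F (√(T (n + 1) ω / T 0 ω), T (n + 1) ω) ∂P =
      ∫⁻ p, F (√((p.1 + p.2) / p.1), p.1 + p.2)
        ∂(P.map fun ω => (T 0 ω, T (0 + 1 + n) ω - T 0 ω)) := by
    rw [lintegral_map (by fun_prop) (by fun_prop)]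
    refine lintegral_congr fun ω => ?_
    simp only [add_sub_cancel]
    rw [show 0 + 1 + n = n + 1 by ring]
  rw [h2, hjoint, lintegral_prod _ (by fun_prop), lintegral_ratio n hF,
    lintegral_prod _ hF.aemeasurable, lintegral_withDensity_eq_lintegral_mul _
      (measurable_ratioDensity _).ennreal_ofReal hF.lintegral_prod_right']
  rfl

theorem map_sqrt_ratio_succ (hT : IsUnitPoisson T P) (n : ℕ) :
    P.map (fun ω => √(T (n + 1) ω / T 0 ω)) =
      volume.withDensity fun b => ENNReal.ofReal (ratioDensity (n + 2) b) := by
  have hm := hT.measurable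
  have hg : IsProbabilityMeasure (gammaMeasure (((n + 1 : ℕ) : ℝ) + 1) 1) :=
    isProbabilityMeasure_gammaMeasure (by positivity) one_pos
  have h := congrArg (Measure.map Prod.fst) (hT.map_ratio_succ n)
  rw [Measure.map_map (by fun_prop) (by fun_prop), Measure.map_fst_prod, measure_univ,
    one_smul] at h
  exact h

/-- The point `T n` is independent of its ratio to the first point. -/
theorem map_ratio (hT : IsUnitPoisson T P) (n : ℕ) :
    P.map (fun ω => (√(T n ω / T 0 ω), T n ω)) =
      (P.map fun ω => √(T n ω / T 0 ω)).prod (gammaMeasure (n + 1) 1) := by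
  have hm := hT.measurable
  have hg : IsProbabilityMeasure (gammaMeasure ((n : ℝ) + 1) 1) :=
    isProbabilityMeasure_gammaMeasure (by positivity) one_pos
  cases n with
  | zero =>
    have h1 : ∀ᵐ ω ∂P, √(T 0 ω / T 0 ω) = 1 := by
      filter_upwards [hT.ae_pos] with ω hω
      rw [div_self (hω 0).ne', Real.sqrt_one]
    have h2 : (fun ω => (√(T 0 ω / T 0 ω), T 0 ω)) =ᵐ[P] fun ω => (1, T 0 ω) := by
      filter_upwards [h1] with ω hω
      rw [hω]
    rw [Measure.map_congr h2, Measure.map_congr (show (fun ω => √(T 0 ω / T 0 ω)) =ᵐ[P]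
      fun _ => 1 from h1), Measure.map_const, measure_univ, one_smul, Measure.dirac_prod,
      ← (hT.hasLaw_gammaMeasure 0).map_eq, Measure.map_map (by fun_prop) (hm 0)]
    rfl
  | succ n =>
    rw [hT.map_ratio_succ n, hT.map_sqrt_ratio_succ n]

end IsUnitPoisson

/-! ### The exponent of the Laplace functional -/

/-- The substitution `s = (u / (u + t)) ^ (α / 2)` turns the exponent of the Laplace functional of
the interference of the points beyond `u` into the hypergeometric function. -/
theorem lintegral_one_sub_eq_Lam {α : ℝ} (hα : 2 < α) (Nt : ℕ) {w u : ℝ} (hw : 0 ≤ w)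
    (hu : 0 < u) :
    ∫⁻ t in Set.Ici 0, (1 - ENNReal.ofReal (((1 + w * (u / (u + t)) ^ (α / 2)) ^ Nt)⁻¹)) =
      ENNReal.ofReal (u * (Lam α Nt 0 w - 1)) := by
  have hα0 : 0 < α := by linarith
  have hαe : -(2 / α) * (α / 2) = -1 := by field_simp
  have hmono : ∀ s ∈ Set.Ioo (0 : ℝ) 1, 1 < s ^ (-(2 / α)) := fun s hs =>
    Real.one_lt_rpow_of_pos_of_lt_one_of_neg hs.1 hs.2 (by simp [hα0])
  have hinv : ∀ s ∈ Set.Ioo (0 : ℝ) 1,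
      (u / (u + (u * s ^ (-(2 / α)) - u))) ^ (α / 2) = s := fun s hs => by
    have hp : 0 < s ^ (-(2 / α)) := Real.rpow_pos_of_pos hs.1 _
    rw [show u / (u + (u * s ^ (-(2 / α)) - u)) = (s ^ (-(2 / α)))⁻¹ by
      rw [add_sub_cancel]; field_simp,
      Real.inv_rpow hp.le, ← Real.rpow_mul hs.1.le, hαe, Real.rpow_neg_one, inv_inv]
  have himg : (fun s : ℝ => u * s ^ (-(2 / α)) - u) '' Set.Ioo 0 1 = Set.Ioi 0 := by
    ext t
    constructor
    · rintro ⟨s, hs, rfl⟩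
      have := hmono s hs
      simp only [Set.mem_Ioi]
      nlinarith
    · intro ht
      have ht0 : 0 < t := ht
      have hq : 0 < u / (u + t) := by positivity
      have hq1 : u / (u + t) < 1 := (div_lt_one (by positivity)).2 (by linarith)
      refine ⟨(u / (u + t)) ^ (α / 2), ⟨Real.rpow_pos_of_pos hq _,
        Real.rpow_lt_one hq.le hq1 (by positivity)⟩, ?_⟩
      simp only
      rw [← Real.rpow_mul hq.le, mul_comm, mul_comm (α / 2), hαe, Real.rpow_neg_one, inv_div]
      field_simp
      ring
  have hder : ∀ s ∈ Set.Ioo (0 : ℝ) 1, HasDerivWithinAt (fun s : ℝ => u * s ^ (-(2 / α)) - u)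
      (u * (-(2 / α) * s ^ (-(2 / α) - 1))) (Set.Ioo 0 1) s := fun s hs =>
    (((Real.hasDerivAt_rpow_const (Or.inl hs.1.ne')).const_mul u).sub_const u).hasDerivWithinAt
  have hinj : Set.InjOn (fun s : ℝ => u * s ^ (-(2 / α)) - u) (Set.Ioo 0 1) := by
    intro s hs s' hs' h
    rw [← hinv s hs, ← hinv s' hs']
    simp only at h
    rw [h]
  rw [← setLIntegral_congr Ioi_ae_eq_Ici, ← himg,
    lintegral_image_eq_lintegral_abs_deriv_mul measurableSet_Ioo hder hinj]
  have hint := (integrableOn_Lam_zero hα Nt hw).const_mul (u * (2 / α))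
  have h1 : u * (Lam α Nt 0 w - 1) = ∫ s in Set.Ioc (0 : ℝ) 1,
      u * (2 / α) * (s ^ (-(2 / α) - 1) * (1 - ((1 + w * s) ^ Nt)⁻¹)) := by
    rw [Lam_zero_eq_integral hα Nt hw, integral_const_mul]; ring
  have hle : ∀ s ∈ Set.Ioc (0 : ℝ) 1, ((1 + w * s) ^ Nt)⁻¹ ≤ 1 := fun s hs =>
    inv_le_one_of_one_le₀ (one_le_pow₀ (by nlinarith [hs.1]))
  rw [h1, ofReal_integral_eq_lintegral_ofReal hint
    ((ae_restrict_iff' measurableSet_Ioc).2 (Filter.Eventually.of_forall fun s hs => ?_)),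
    setLIntegral_congr Ioo_ae_eq_Ioc.symm]
  · refine setLIntegral_congr_fun measurableSet_Ioo fun s hs => ?_
    have hp : 0 < s ^ (-(2 / α) - 1) := Real.rpow_pos_of_pos hs.1 _
    have hpos : 0 ≤ ((1 + w * s) ^ Nt)⁻¹ := by
      have := hs.1; positivity
    rw [hinv s hs, ← ENNReal.ofReal_one, ← ENNReal.ofReal_sub _ hpos,
      ← ENNReal.ofReal_mul (abs_nonneg _), show u * (-(2 / α) * s ^ (-(2 / α) - 1)) =
        -(u * (2 / α * s ^ (-(2 / α) - 1))) by ring, abs_neg, abs_of_nonneg (by positivity)]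
    congr 1
    ring
  · have := hle s hs
    have hp : 0 < s ^ (-(2 / α) - 1) := Real.rpow_pos_of_pos hs.1 _
    exact mul_nonneg (by positivity) (mul_nonneg hp.le (by linarith))

/-! ### Sums of independent exponential variables -/

theorem lintegral_ratioDensity (n : ℕ) :
    ∫⁻ b, ENNReal.ofReal (ratioDensity (n + 2) b) = 1 := by
  have hg : ∀ k : ℕ, IsProbabilityMeasure (gammaMeasure ((k : ℝ) + 1) 1) := fun k =>
    isProbabilityMeasure_gammaMeasure (by positivity) one_pos
  have h0 := hg 0
  have h1 := hg n
  have h2 := hg (n + 1)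
  have h := lintegral_ratio n (F := fun _ => 1) measurable_const
  simp only [lintegral_const, measure_univ, mul_one] at h
  exact h.symm

/-- The sum of `n` independent exponential variables has the Gamma law of shape `n`. -/
theorem hasLaw_sum_gammaMeasure {Ω ι : Type*} [MeasurableSpace Ω] {P : Measure Ω}
    [IsProbabilityMeasure P] {e : ι → Ω → ℝ} (hm : ∀ i, Measurable (e i)) (hind : iIndepFun e P)
    (hlaw : ∀ i, P.map (e i) = expMeasure 1) (s : Finset ι) (hs : s.Nonempty) :
    P.map (∑ i ∈ s, e i) = gammaMeasure s.card 1 := by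
  induction hs using Finset.Nonempty.cons_induction with
  | singleton a => simpa [expMeasure] using hlaw a
  | cons a s ha hs ih =>
    obtain ⟨n, hn⟩ : ∃ n, s.card = n + 1 := ⟨s.card - 1, by have := hs.card_pos; omega⟩
    have hg : IsProbabilityMeasure (gammaMeasure ((n : ℝ) + 1) 1) :=
      isProbabilityMeasure_gammaMeasure (by positivity) one_pos
    have hsum : ∀ s : Finset ι, Measurable (∑ i ∈ s, e i) := fun s => by
      rw [show (∑ i ∈ s, e i) = fun ω => ∑ i ∈ s, e i ω from funext fun ω => Finset.sum_apply _ _ _]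
      exact Finset.measurable_sum s fun i _ => hm i
    have hsm := hsum s
    have hi : IndepFun (e a) (∑ i ∈ s, e i) P := (hind.indepFun_finsetSum_of_notMem hm ha).symm
    have hj := (indepFun_iff_map_prod_eq_prod_map_map (hm a).aemeasurable hsm.aemeasurable).1 hi
    rw [ih, hlaw a, hn] at hj
    have hg' : SFinite (gammaMeasure ((n + 1 : ℕ) : ℝ) 1) := by
      push_cast; infer_instance
    rw [Finset.card_cons, hn]
    refine Measure.ext_of_lintegral _ fun f hf => ?_
    have h1 : ∫⁻ x, f x ∂P.map (∑ i ∈ Finset.cons a s ha, e i) =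
        ∫⁻ p, f (p.1 + p.2) ∂P.map (fun ω => (e a ω, (∑ i ∈ s, e i) ω)) := by
      rw [lintegral_map hf (hsum _),
        lintegral_map (by fun_prop) ((hm a).prodMk hsm), Finset.sum_cons]
      rfl
    rw [h1, hj, lintegral_prod _ (by fun_prop)]
    have h2 := lintegral_ratio n (F := fun p => f p.2) (by fun_prop)
    simp only at h2
    rw [lintegral_mul_const _ (measurable_ratioDensity _).ennreal_ofReal, lintegral_ratioDensity,
      one_mul] at h2
    simp only [Nat.cast_zero, zero_add] at h2
    push_cast at h2 ⊢
    exact h2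

/-! ### Complex Gaussian vectors -/

section Gaussian

theorem measurable_complexMk : Measurable fun p : ℝ × ℝ => (⟨p.1, p.2⟩ : ℂ) :=
  Complex.measurableEquivRealProd.symm.measurable

instance isProbabilityMeasure_stdComplexGaussian : IsProbabilityMeasure stdComplexGaussian :=
  Measure.isProbabilityMeasure_map measurable_complexMk.aemeasurable

instance isProbabilityMeasure_stdComplexGaussianVec (N : ℕ) :
    IsProbabilityMeasure (stdComplexGaussianVec N) :=
  Measure.isProbabilityMeasure_map (WithLp.measurable_toLp 2 _).aemeasurable

/-- The squared modulus of a standard complex Gaussian variable is exponentially distributed. -/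
theorem map_normSq_stdComplexGaussian :
    stdComplexGaussian.map (fun z => ‖z‖ ^ 2) = expMeasure 1 := by
  refine Measure.ext_of_lintegral _ fun f hf => ?_
  have hv : (1 / 2 : NNReal) ≠ 0 := by norm_num
  have hpdf : ∀ x : ℝ, gaussianPDF 0 (1 / 2) x =
      ENNReal.ofReal ((√Real.pi)⁻¹ * Real.exp (-x ^ 2)) := fun x => by
    rw [gaussianPDF, gaussianPDFReal]
    congr 3
    · push_cast; congr 1; ring
    · push_cast; ring
  have hL : ∫⁻ x, f x ∂stdComplexGaussian.map (fun z => ‖z‖ ^ 2) = ∫⁻ p : ℝ × ℝ,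
      ENNReal.ofReal (Real.pi⁻¹ * Real.exp (-(p.1 ^ 2 + p.2 ^ 2))) * f (p.1 ^ 2 + p.2 ^ 2) := by
    rw [lintegral_map hf (by fun_prop), stdComplexGaussian,
      lintegral_map (by fun_prop) measurable_complexMk, gaussianReal_of_var_ne_zero _ hv,
      prod_withDensity (measurable_gaussianPDF _ _) (measurable_gaussianPDF _ _),
      lintegral_withDensity_eq_lintegral_mul _
        (by
          have := measurable_gaussianPDF 0 (1 / 2)
          fun_prop)
        (by
          have h1 : Measurable fun z : ℂ => f (‖z‖ ^ 2) := by fun_prop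
          exact h1.comp measurable_complexMk)]
    refine lintegral_congr fun p => ?_
    simp only [Pi.mul_apply, hpdf]
    rw [← ENNReal.ofReal_mul (by positivity)]
    congr 2
    · rw [show (√Real.pi)⁻¹ * Real.exp (-p.1 ^ 2) * ((√Real.pi)⁻¹ * Real.exp (-p.2 ^ 2)) =
        (√Real.pi * √Real.pi)⁻¹ * (Real.exp (-p.1 ^ 2) * Real.exp (-p.2 ^ 2)) by
          rw [mul_inv]; ring, Real.mul_self_sqrt Real.pi_pos.le, ← Real.exp_add]
      congr 2; ring
    · rw [← Complex.normSq_eq_norm_sq, Complex.normSq_apply]; ring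
  have hpolar : ∀ p : ℝ × ℝ, (polarCoord.symm p).1 ^ 2 + (polarCoord.symm p).2 ^ 2 = p.1 ^ 2 :=
    fun p => by
      rw [polarCoord_symm_apply]
      simp only
      rw [mul_pow, mul_pow, ← mul_add, Real.cos_sq_add_sin_sq, mul_one]
  -- Polar coordinates, then the substitution of the square of the radius.
  rw [hL, ← lintegral_comp_polarCoord_symm, polarCoord_target]
  simp only [hpolar, smul_eq_mul]
  rw [Measure.volume_eq_prod, ← Measure.prod_restrict, lintegral_prod _ (by fun_prop)]
  simp only [lintegral_const, Measure.restrict_apply_univ, Real.volume_Ioo]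
  have hR := gammaMeasure_lintegral 0 hf
  simp only [Nat.cast_zero, zero_add, pow_zero, mul_one, Nat.factorial_zero, Nat.cast_one,
    div_one] at hR
  have himg : (fun r : ℝ => r ^ 2) '' Set.Ioi 0 = Set.Ioi 0 := by
    ext x
    refine ⟨?_, fun hx => ⟨√x, Real.sqrt_pos.2 hx, Real.sq_sqrt (le_of_lt hx)⟩⟩
    rintro ⟨r, hr, rfl⟩
    exact pow_pos (show (0 : ℝ) < r from hr) 2
  have hder : ∀ r ∈ Set.Ioi (0 : ℝ),
      HasDerivWithinAt (fun r : ℝ => r ^ 2) (2 * r) (Set.Ioi 0) r := fun r _ => by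
    simpa using (hasDerivAt_pow 2 r).hasDerivWithinAt
  have hinj : Set.InjOn (fun r : ℝ => r ^ 2) (Set.Ioi 0) := fun a ha b hb hab =>
    (pow_left_inj₀ (le_of_lt ha) (le_of_lt hb) two_ne_zero).1 hab
  rw [expMeasure, hR]
  conv_rhs => rw [← himg]
  rw [lintegral_image_eq_lintegral_abs_deriv_mul measurableSet_Ioi hder hinj]
  refine setLIntegral_congr_fun measurableSet_Ioi fun r hr => ?_
  have hr0 : (0 : ℝ) < r := hr
  rw [mul_comm _ (ENNReal.ofReal (Real.pi - -Real.pi)), ← mul_assoc, ← mul_assoc, ← mul_assoc,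
    ← ENNReal.ofReal_mul (by linarith [Real.pi_pos]),
    ← ENNReal.ofReal_mul (mul_nonneg (by linarith [Real.pi_pos]) hr0.le),
    ← ENNReal.ofReal_mul (abs_nonneg _), abs_of_pos (show (0 : ℝ) < 2 * r by positivity)]
  congr 2
  have := Real.pi_ne_zero
  field_simp
  ring

/-- The variance of each of the real and imaginary parts is `1/2`, whence the factor `4`. -/
theorem charFun_stdComplexGaussian (t : ℂ) :
    charFun stdComplexGaussian t = Complex.exp (-(‖t‖ ^ 2 / 4 : ℝ)) := by
  rw [charFun_apply, stdComplexGaussian,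
    integral_map measurable_complexMk.aemeasurable
      (Continuous.aestronglyMeasurable (by fun_prop))]
  have h : ∀ p : ℝ × ℝ, Complex.exp ((inner ℝ (⟨p.1, p.2⟩ : ℂ) t : ℝ) * Complex.I) =
      Complex.exp (t.re * p.1 * Complex.I) * Complex.exp (t.im * p.2 * Complex.I) := fun p => by
    rw [← Complex.exp_add, Complex.inner]
    congr 1
    simp only [Complex.mul_re, Complex.conj_re, Complex.conj_im]
    push_cast
    ring
  simp_rw [h]
  rw [integral_prod_mul (fun x : ℝ => Complex.exp (t.re * x * Complex.I))
    (fun x : ℝ => Complex.exp (t.im * x * Complex.I)), ← charFun_apply_real, ← charFun_apply_real,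
    charFun_gaussianReal, charFun_gaussianReal, ← Complex.exp_add,
    ← Complex.normSq_eq_norm_sq, Complex.normSq_apply]
  congr 1
  push_cast
  ring

theorem charFun_stdComplexGaussianVec {N : ℕ} (t : EuclideanSpace ℂ (Fin N)) :
    charFun (stdComplexGaussianVec N) t = Complex.exp (-(‖t‖ ^ 2 / 4 : ℝ)) := by
  rw [stdComplexGaussianVec, charFun_pi]
  simp_rw [charFun_stdComplexGaussian]
  rw [← Complex.exp_sum, EuclideanSpace.norm_sq_eq]
  congr 1
  push_cast
  rw [Finset.sum_div, Finset.sum_neg_distrib]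

theorem real_inner_eq_re {N : ℕ} (x y : EuclideanSpace ℂ (Fin N)) :
    inner ℝ x y = (inner ℂ x y).re := by
  rw [PiLp.inner_apply, PiLp.inner_apply, Complex.re_sum]
  refine Finset.sum_congr rfl fun i _ => ?_
  rw [Complex.inner, RCLike.inner_apply, mul_comm]

/-- The coefficients of a standard complex Gaussian vector along an orthonormal family form a
standard complex Gaussian vector. -/
theorem map_inner_stdComplexGaussianVec {d N : ℕ} {w : Fin d → EuclideanSpace ℂ (Fin N)}
    (hw : Orthonormal ℂ w) :
    (stdComplexGaussianVec N).map (fun g => WithLp.toLp 2 fun j => inner ℂ (w j) g) =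
      stdComplexGaussianVec d := by
  have hm : Continuous fun g : EuclideanSpace ℂ (Fin N) =>
      (WithLp.toLp 2 fun j => inner ℂ (w j) g : EuclideanSpace ℂ (Fin d)) := by fun_prop
  have := Measure.isProbabilityMeasure_map (μ := stdComplexGaussianVec N)
    hm.measurable.aemeasurable
  refine Measure.ext_of_charFun (funext fun t => ?_)
  have hnorm : ‖∑ j, t j • w j‖ ^ 2 = ‖t‖ ^ 2 := by
    have h1 := hw.inner_sum (fun j => t j) (fun j => t j) Finset.univ
    rw [inner_self_eq_norm_sq_to_K] at h1
    rw [EuclideanSpace.norm_sq_eq t]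
    have h2 : ((‖∑ j, t j • w j‖ ^ 2 : ℝ) : ℂ) = ((∑ j, ‖t j‖ ^ 2 : ℝ) : ℂ) := by
      push_cast
      refine Eq.trans h1 (Finset.sum_congr rfl fun j _ => ?_)
      rw [mul_comm, Complex.mul_conj, Complex.normSq_eq_norm_sq]
      push_cast; rfl
    exact_mod_cast h2
  rw [charFun_stdComplexGaussianVec, ← hnorm, ← charFun_stdComplexGaussianVec, charFun_apply,
    integral_map hm.measurable.aemeasurable (Continuous.aestronglyMeasurable (by fun_prop)),
    charFun_apply]
  refine integral_congr_ae (Filter.Eventually.of_forall fun g => ?_)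
  simp only
  congr 3
  rw [real_inner_eq_re, real_inner_eq_re, inner_sum, PiLp.inner_apply]
  congr 1
  refine Finset.sum_congr rfl fun j _ => ?_
  rw [inner_smul_right, RCLike.inner_apply, inner_conj_symm]

/-- The squared norm of the projection of a standard complex Gaussian vector on a subspace of
dimension `d ≥ 1` has the Gamma law of shape `d`. -/
theorem map_norm_sq_starProjection {N : ℕ} (W : Submodule ℂ (EuclideanSpace ℂ (Fin N)))
    (hW : 1 ≤ Module.finrank ℂ W) :
    (stdComplexGaussianVec N).map (fun g => ‖W.starProjection g‖ ^ 2) =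
      gammaMeasure (Module.finrank ℂ W) 1 := by
  set b := stdOrthonormalBasis ℂ W
  have hb : Orthonormal ℂ fun j => (b j : EuclideanSpace ℂ (Fin N)) :=
    b.orthonormal.comp_linearIsometry W.subtypeₗᵢ
  have h1 : ∀ g, ‖W.starProjection g‖ ^ 2 =
      ∑ j, ‖(WithLp.toLp 2 fun j => inner ℂ (b j : EuclideanSpace ℂ (Fin N)) g :
        EuclideanSpace ℂ (Fin (Module.finrank ℂ W))) j‖ ^ 2 := fun g => by
    rw [Submodule.starProjection_apply, Submodule.norm_coe, ← b.sum_sq_norm_inner_right]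
    refine Finset.sum_congr rfl fun j _ => ?_
    rw [Submodule.coe_inner, ← Submodule.starProjection_apply,
      ← Submodule.inner_starProjection_left_eq_right,
      Submodule.starProjection_eq_self_iff.2 (b j).2]
  have hm : Measurable fun g : EuclideanSpace ℂ (Fin N) =>
      (WithLp.toLp 2 fun j => inner ℂ (b j : EuclideanSpace ℂ (Fin N)) g :
        EuclideanSpace ℂ (Fin (Module.finrank ℂ W))) := Continuous.measurable (by fun_prop)
  have h2 := congrArg (Measure.map fun t : EuclideanSpace ℂ (Fin (Module.finrank ℂ W)) =>
    ∑ j, ‖t j‖ ^ 2) (map_inner_stdComplexGaussianVec hb)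
  rw [Measure.map_map (by fun_prop) hm, stdComplexGaussianVec.eq_def (Module.finrank ℂ W),
    Measure.map_map (by fun_prop) (WithLp.measurable_toLp 2 _)] at h2
  simp_rw [h1]
  refine h2.trans ?_
  have hind := iIndepFun_pi (μ := fun _ : Fin (Module.finrank ℂ W) => stdComplexGaussian)
    (X := fun _ z => ‖z‖ ^ 2) (fun _ => by fun_prop)
  have h3 := hasLaw_sum_gammaMeasure (fun i => by fun_prop) hind (fun i => by
    have h4 : (fun x : Fin (Module.finrank ℂ W) → ℂ => ‖x i‖ ^ 2) =
      (fun z : ℂ => ‖z‖ ^ 2) ∘ Function.eval i := rfl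
    rw [h4, ← Measure.map_map (by fun_prop) (measurePreserving_eval (fun _ => stdComplexGaussian) i).measurable,
      (measurePreserving_eval _ i).map_eq, map_normSq_stdComplexGaussian])
    Finset.univ (Finset.univ_nonempty_iff.2 ⟨⟨0, hW⟩⟩)
  rw [Finset.card_univ, Fintype.card_fin] at h3
  convert! h3 using 2
  funext x
  simp [Finset.sum_apply]

theorem map_gain_stdComplexGaussianVec {N : ℕ} {v : EuclideanSpace ℂ (Fin N)} (hv : ‖v‖ = 1) :
    (stdComplexGaussianVec N).map (gain v) = expMeasure 1 := by
  have hv0 : v ≠ 0 := fun h => by simp [h] at hv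
  have h1 := finrank_span_singleton (K := ℂ) hv0
  have h := map_norm_sq_starProjection (Submodule.span ℂ {v}) h1.ge
  rw [h1, Nat.cast_one] at h
  rw [expMeasure, ← h]
  congr 1
  funext g
  rw [Submodule.starProjection_unit_singleton ℂ hv, norm_smul, hv, mul_one, gain]

/-- A vector `v` orthogonal to the subspace has an exponential, hence continuous, law of
`‖⟪v, g⟫‖²`. -/
theorem stdComplexGaussianVec_submodule {N : ℕ} {V : Submodule ℂ (EuclideanSpace ℂ (Fin N))}
    (hV : V ≠ ⊤) : stdComplexGaussianVec N V = 0 := by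
  have h1 : Vᗮ ≠ ⊥ := fun h => hV ((Submodule.orthogonal_eq_bot_iff).1 h)
  obtain ⟨u, hu, hu0⟩ := Submodule.exists_mem_ne_zero_of_ne_bot h1
  set v := ((‖u‖⁻¹ : ℝ) : ℂ) • u
  have hv : ‖v‖ = 1 := by
    rw [norm_smul, Complex.norm_real, norm_inv, norm_norm, inv_mul_cancel₀ (norm_ne_zero_iff.2 hu0)]
  have hvV : v ∈ Vᗮ := Submodule.smul_mem _ _ hu
  have hm : Measurable (gain v) := Continuous.measurable (by unfold gain; fun_prop)
  have h2 : stdComplexGaussianVec N (gain v ⁻¹' {0}) = 0 := by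
    rw [← Measure.map_apply hm (measurableSet_singleton 0), map_gain_stdComplexGaussianVec hv,
      expMeasure, gammaMeasure]
    exact withDensity_absolutelyContinuous _ _ (by simp)
  refine measure_mono_null (fun x hx => ?_) h2
  rw [Set.mem_preimage, Set.mem_singleton_iff, gain,
    Submodule.inner_left_of_mem_orthogonal (K := V) hx hvV, norm_zero]
  norm_num

/-- At most `N` independent Gaussian vectors in `ℂ^N` are almost surely linearly independent. -/
theorem ae_linearIndependent {N : ℕ} (k : ℕ) (hk : k ≤ N) :
    ∀ᵐ f ∂Measure.pi fun _ : Fin k => stdComplexGaussianVec N, LinearIndependent ℂ f := by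
  induction k with
  | zero => exact Filter.Eventually.of_forall fun f => linearIndependent_empty_type
  | succ k ih =>
    have hmp := measurePreserving_piFinSuccAbove
      (fun _ : Fin (k + 1) => stdComplexGaussianVec N) 0
    have hmeas : ∀ j, MeasurableSet
        {f : Fin j → EuclideanSpace ℂ (Fin N) | LinearIndependent ℂ f} := fun j =>
      isOpen_setOfPred_linearIndependent.measurableSet
    have h2 : ∀ᵐ q ∂(Measure.pi fun _ : Fin k => stdComplexGaussianVec N).prod
        (stdComplexGaussianVec N),
        LinearIndependent ℂ (Fin.cons q.2 q.1 : Fin (k + 1) → EuclideanSpace ℂ (Fin N)) := by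
      refine (Measure.ae_prod_iff_ae_ae ?_).2 ?_
      · have : Measurable fun q : (Fin k → EuclideanSpace ℂ (Fin N)) × EuclideanSpace ℂ (Fin N) =>
          (Fin.cons q.2 q.1 : Fin (k + 1) → EuclideanSpace ℂ (Fin N)) := by
          refine measurable_pi_lambda _ fun i => ?_
          refine Fin.cases ?_ (fun j => ?_) i
          · simpa using measurable_snd
          · simp only [Fin.cons_succ]; fun_prop
        exact this (hmeas (k + 1))
      · filter_upwards [ih (by omega)] with f hf
        have hV : Submodule.span ℂ (Set.range f) ≠ ⊤ := fun h => by
          have h3 := finrank_span_eq_card hf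
          rw [h, finrank_top, finrank_euclideanSpace_fin, Fintype.card_fin] at h3
          omega
        have h4 := stdComplexGaussianVec_submodule hV
        filter_upwards [compl_mem_ae_iff.2 h4] with x hx
        exact linearIndependent_finSucc.2 ⟨by simpa using hf, by simpa using hx⟩
    have h5 := hmp.quasiMeasurePreserving.ae
      (Measure.measurePreserving_swap.quasiMeasurePreserving.ae h2)
    filter_upwards [h5] with f hf
    convert! hf using 1
    funext i
    refine Fin.cases ?_ (fun j => ?_) i
    · rfl
    · rfl

end Gaussian

/-! ### The signal and interference powers after the receive filter -/

/-- If the conditional law of `Φ a` does not depend on `a`, then it is independent of any function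
of `a`. -/
theorem map_prod_skew {A B C D : Type*} [MeasurableSpace A] [MeasurableSpace B] [MeasurableSpace C]
    [MeasurableSpace D] {μ : Measure A} {ν : Measure B} {η : Measure C} [IsProbabilityMeasure μ]
    [IsProbabilityMeasure ν] [IsProbabilityMeasure η] {φ : A → D} {Φ : A → B → C}
    (hφ : Measurable φ) (hΦ : Measurable fun p : A × B => Φ p.1 p.2)
    (h : ∀ᵐ a ∂μ, ν.map (Φ a) = η) :
    (μ.prod ν).map (fun p => (φ p.1, Φ p.1 p.2)) = (μ.map φ).prod η := by
  have := Measure.isProbabilityMeasure_map (μ := μ) hφ.aemeasurable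
  refine Measure.ext_of_lintegral _ fun F hF => ?_
  rw [lintegral_map hF (by fun_prop), lintegral_prod _ (by fun_prop),
    lintegral_prod _ hF.aemeasurable, lintegral_map hF.lintegral_prod_right' hφ]
  refine lintegral_congr_ae ?_
  filter_upwards [h] with a ha
  have hΦa : Measurable (Φ a) := hΦ.comp measurable_prodMk_left
  rw [← ha, lintegral_map (by fun_prop) hΦa]

/-- The component of `g` orthogonal to the vectors `f i`. -/
noncomputable def residual {k N : ℕ} (f : Fin k → EuclideanSpace ℂ (Fin N))
    (g : EuclideanSpace ℂ (Fin N)) : EuclideanSpace ℂ (Fin N) :=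
  (Submodule.span ℂ (Set.range f))ᗮ.starProjection g

/-- The projection depends on the span of `f`, whose dimension varies with `f`; writing it as the last
Gram–Schmidt vector shows that it is jointly measurable. -/
theorem residual_eq_gramSchmidt {k N : ℕ} (f : Fin k → EuclideanSpace ℂ (Fin N))
    (g : EuclideanSpace ℂ (Fin N)) :
    residual f g = InnerProductSpace.gramSchmidt ℂ
      (Fin.snoc f g : Fin (k + 1) → EuclideanSpace ℂ (Fin N)) (Fin.last k) := by
  set u : Fin (k + 1) → EuclideanSpace ℂ (Fin N) := Fin.snoc f g with hu
  have hspan : Submodule.span ℂ (InnerProductSpace.gramSchmidt ℂ u '' Set.Iio (Fin.last k)) =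
      Submodule.span ℂ (Set.range f) := by
    rw [InnerProductSpace.span_gramSchmidt_Iio]
    congr 1
    ext x
    constructor
    · rintro ⟨i, hi, rfl⟩
      refine ⟨i.castPred (Fin.ne_last_of_lt hi), ?_⟩
      conv_rhs => rw [hu, ← Fin.castSucc_castPred i (Fin.ne_last_of_lt hi), Fin.snoc_castSucc]
    · rintro ⟨j, rfl⟩
      exact ⟨j.castSucc, Fin.castSucc_lt_last j, by rw [hu, Fin.snoc_castSucc]⟩
  have hlast : u (Fin.last k) = g := by rw [hu, Fin.snoc_last]
  refine Submodule.eq_starProjection_of_mem_orthogonal ?_ ?_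
  · rw [← hspan, Submodule.mem_orthogonal]
    intro x hx
    induction hx using Submodule.span_induction with
    | mem x hx =>
      obtain ⟨i, hi, rfl⟩ := hx
      exact InnerProductSpace.gramSchmidt_orthogonal ℂ u (ne_of_lt hi)
    | zero => simp
    | add x y _ _ hx hy => rw [inner_add_left, hx, hy, add_zero]
    | smul c x _ hx => rw [inner_smul_left, hx, mul_zero]
  · rw [Submodule.orthogonal_orthogonal, ← hspan, InnerProductSpace.gramSchmidt_def, hlast,
      sub_sub_cancel]
    refine Submodule.sum_mem _ fun i hi => ?_
    rw [Submodule.starProjection_singleton]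
    exact Submodule.smul_mem _ _ (Submodule.subset_span ⟨i, Finset.mem_Iio.1 hi, rfl⟩)

theorem measurable_gramSchmidt {K N : ℕ} (n : Fin K) :
    Measurable fun u : Fin K → EuclideanSpace ℂ (Fin N) =>
      InnerProductSpace.gramSchmidt ℂ u n := by
  induction n using WellFoundedLT.induction with
  | ind n ih =>
    simp_rw [InnerProductSpace.gramSchmidt_def ℂ _ n, Submodule.starProjection_singleton]
    refine (measurable_pi_apply n).sub (Finset.measurable_sum _ fun i hi => ?_)
    have h := ih i (Finset.mem_Iio.1 hi)
    have h2 : Measurable fun u : Fin K → EuclideanSpace ℂ (Fin N) =>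
        inner ℂ (InnerProductSpace.gramSchmidt ℂ u i) (u n) := h.inner (measurable_pi_apply n)
    have h3 : Measurable fun u : Fin K → EuclideanSpace ℂ (Fin N) =>
        ((‖InnerProductSpace.gramSchmidt ℂ u i‖ ^ 2 : ℝ) : ℂ) :=
      Complex.measurable_ofReal.comp (h.norm.pow_const 2)
    exact (h2.div h3).smul h

theorem measurable_residual {k N : ℕ} :
    Measurable fun p : (Fin k → EuclideanSpace ℂ (Fin N)) × EuclideanSpace ℂ (Fin N) =>
      residual p.1 p.2 := by
  simp_rw [residual_eq_gramSchmidt]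
  refine (measurable_gramSchmidt (Fin.last k)).comp (measurable_pi_lambda _ fun i => ?_)
  refine Fin.lastCases ?_ (fun j => ?_) i
  · simpa using measurable_snd
  · simp only [Fin.snoc_castSucc]; fun_prop

/-- Almost surely the `k` nulled vectors span a space of dimension `k`, leaving dimension `δ + 1` for
the residual. -/
theorem map_norm_sq_residual {N k δ : ℕ} (hN : N = k + 1 + δ) :
    ((Measure.pi fun _ : Fin k => stdComplexGaussianVec N).prod
        (stdComplexGaussianVec N)).map (fun p => ‖residual p.1 p.2‖ ^ 2) =
      gammaMeasure ((δ : ℝ) + 1) 1 := by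
  have hg : IsProbabilityMeasure (gammaMeasure ((δ : ℝ) + 1) 1) :=
    isProbabilityMeasure_gammaMeasure (by positivity) one_pos
  have hm : Measurable fun p : (Fin k → EuclideanSpace ℂ (Fin N)) ×
      EuclideanSpace ℂ (Fin N) => ‖residual p.1 p.2‖ ^ 2 :=
    measurable_residual.norm.pow_const 2
  have h := map_prod_skew (φ := fun _ => ())
      (Φ := fun (f : Fin k → EuclideanSpace ℂ (Fin N)) g => ‖residual f g‖ ^ 2) (ν := stdComplexGaussianVec N)
      (η := gammaMeasure ((δ : ℝ) + 1) 1) measurable_const hm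
      (μ := Measure.pi fun _ : Fin k => stdComplexGaussianVec N) (by
    filter_upwards [ae_linearIndependent (N := N) k (by omega)] with f hf
    have h1 := finrank_span_eq_card hf
    have h2 := Submodule.finrank_add_finrank_orthogonal (Submodule.span ℂ (Set.range f))
    rw [h1, finrank_euclideanSpace_fin, Fintype.card_fin] at h2
    have h3 : Module.finrank ℂ (Submodule.span ℂ (Set.range f))ᗮ = δ + 1 := by omega
    have h4 := map_norm_sq_starProjection (Submodule.span ℂ (Set.range f))ᗮ (by omega)
    rw [h3] at h4
    push_cast at h4
    exact h4)
  have h5 := congrArg (Measure.map Prod.snd) h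
  rw [Measure.map_map measurable_snd (measurable_const.prodMk hm), Measure.map_snd_prod,
    Measure.map_apply measurable_const .univ, Set.preimage_univ, measure_univ, one_smul] at h5
  exact h5

/-- The unit vector in the direction of the component of `g` orthogonal to the vectors `f i`. -/
noncomputable def unitResidual {k N : ℕ} (f : Fin k → EuclideanSpace ℂ (Fin N))
    (g : EuclideanSpace ℂ (Fin N)) : EuclideanSpace ℂ (Fin N) :=
  ((‖residual f g‖⁻¹ : ℝ) : ℂ) • residual f g

theorem measurable_unitResidual {k N : ℕ} :
    Measurable fun p : (Fin k → EuclideanSpace ℂ (Fin N)) × EuclideanSpace ℂ (Fin N) =>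
      unitResidual p.1 p.2 :=
  (Complex.measurable_ofReal.comp measurable_residual.norm.inv).smul measurable_residual

theorem gain_unitResidual_self {k N : ℕ} (f : Fin k → EuclideanSpace ℂ (Fin N))
    (g : EuclideanSpace ℂ (Fin N)) : gain (unitResidual f g) g = ‖residual f g‖ ^ 2 := by
  have h1 : inner ℂ (residual f g) g = (‖residual f g‖ : ℂ) ^ 2 := by
    have h := inner_self_eq_norm_sq_to_K (𝕜 := ℂ) (residual f g)
    refine Eq.trans ?_ h
    unfold residual
    rw [Submodule.inner_starProjection_left_eq_right, Submodule.inner_starProjection_left_eq_right]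
    rw [Submodule.starProjection_eq_self_iff.2 (Submodule.starProjection_apply_mem _ _)]
  rw [gain, unitResidual, inner_smul_left, h1, Complex.conj_ofReal, norm_mul, Complex.norm_real,
    norm_inv, norm_norm, norm_pow, Complex.norm_real, norm_norm]
  rcases eq_or_ne ‖residual f g‖ 0 with h0 | h0
  · rw [h0]; simp
  · field_simp

theorem measurable_gain {A : Type*} [MeasurableSpace A] {N : ℕ}
    {v w : A → EuclideanSpace ℂ (Fin N)} (hv : Measurable v) (hw : Measurable w) :
    Measurable fun a => gain (v a) (w a) := by
  unfold gain
  exact (hv.inner hw).norm.pow_const 2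

/-- If the filter `v` is a unit vector independent of the interfering channel vectors, then the
interference powers are independent exponential variables, independent of what determines `v`. -/
theorem map_gain_of_ae_unit {A J : Type*} [MeasurableSpace A] {μ : Measure A}
    [IsProbabilityMeasure μ] {N : ℕ} {v : A → EuclideanSpace ℂ (Fin N)} {H : A → ℝ}
    (hH : Measurable H) (hv : Measurable v) (hv1 : ∀ᵐ a ∂μ, ‖v a‖ = 1) :
    (μ.prod (Measure.infinitePi fun _ : J => stdComplexGaussianVec N)).map
      (fun p => (H p.1, fun j => gain (v p.1) (p.2 j))) =
      (μ.map H).prod (Measure.infinitePi fun _ : J => expMeasure 1) := by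
  refine map_prod_skew hH (Φ := fun a (w : J → EuclideanSpace ℂ (Fin N)) j => gain (v a) (w j))
    (measurable_pi_lambda _ fun j => measurable_gain (hv.comp measurable_fst)
      ((measurable_pi_apply j).comp measurable_snd)) ?_
  filter_upwards [hv1] with a ha
  rw [Measure.infinitePi_map_pi _ (f := fun _ => gain (v a))
    (fun _ => measurable_gain measurable_const measurable_id)]
  congr 1
  funext j
  exact map_gain_stdComplexGaussianVec ha

/-- The squared norm of the residual and the gains of further Gaussian vectors along its direction are
independent. -/
theorem map_gain_unitResidual {J : Type*} {N k δ : ℕ} (hN : N = k + 1 + δ) :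
    (((Measure.pi fun _ : Fin k => stdComplexGaussianVec N).prod
        (stdComplexGaussianVec N)).prod
        (Measure.infinitePi fun _ : J => stdComplexGaussianVec N)).map
      (fun p => (‖residual p.1.1 p.1.2‖ ^ 2,
        fun j => gain (unitResidual p.1.1 p.1.2) (p.2 j))) =
      (gammaMeasure ((δ : ℝ) + 1) 1).prod (Measure.infinitePi fun _ : J => expMeasure 1) := by
  have hm : Measurable fun p : (Fin k → EuclideanSpace ℂ (Fin N)) × EuclideanSpace ℂ (Fin N) =>
      ‖residual p.1 p.2‖ ^ 2 := measurable_residual.norm.pow_const 2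
  have h0 : ∀ᵐ p ∂(Measure.pi fun _ : Fin k => stdComplexGaussianVec N).prod
      (stdComplexGaussianVec N), ‖residual p.1 p.2‖ ^ 2 ≠ 0 := by
    refine ae_of_ae_map (p := fun x : ℝ => x ≠ 0) hm.aemeasurable ?_
    rw [map_norm_sq_residual hN, gammaMeasure]
    exact (withDensity_absolutelyContinuous _ _).ae_le
      (compl_mem_ae_iff.2 (by simp : volume ({0} : Set ℝ) = 0))
  have h1 : ∀ᵐ p ∂(Measure.pi fun _ : Fin k => stdComplexGaussianVec N).prod
      (stdComplexGaussianVec N), ‖unitResidual p.1 p.2‖ = 1 := by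
    filter_upwards [h0] with p hp
    have hp0 : ‖residual p.1 p.2‖ ≠ 0 := fun h => hp (by rw [h]; norm_num)
    rw [unitResidual, norm_smul, Complex.norm_real, norm_inv, norm_norm, inv_mul_cancel₀ hp0]
  have h2 := map_gain_of_ae_unit (J := J) hm measurable_unitResidual h1
  rw [map_norm_sq_residual hN] at h2
  exact h2

/-- The indices of the channel vectors that the receiver nulls. -/
def nulledIndices {Nt : ℕ} (m : ℕ) (κ : Fin Nt) : Finset (ℕ × Fin Nt) :=
  (Finset.range m ×ˢ Finset.univ).erase (0, κ)

theorem card_nulledIndices {Nt m : ℕ} (hm : 1 ≤ m) (κ : Fin Nt) :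
    (nulledIndices m κ).card + 1 = m * Nt := by
  rw [nulledIndices, Finset.card_erase_add_one (by simp; omega)]
  simp

theorem nulledSpan_eq {Nt Nr m k : ℕ} (hm : 1 ≤ m) (κ : Fin Nt)
    (e : Fin k ≃ nulledIndices m κ) (h : ℕ → Fin Nt → EuclideanSpace ℂ (Fin Nr)) :
    nulledSpan m κ h =
      Submodule.span ℂ (Set.range fun i => h (e i : ℕ × Fin Nt).1 (e i : ℕ × Fin Nt).2) := by
  unfold nulledSpan
  congr 1
  ext w
  constructor
  · rintro (⟨q, hq, rfl⟩ | ⟨n, q, h1, h2, rfl⟩)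
    · exact ⟨e.symm ⟨(0, q), by simp [nulledIndices, hq]; omega⟩, by simp⟩
    · exact ⟨e.symm ⟨(n, q), by simp [nulledIndices]; omega⟩, by simp⟩
  · rintro ⟨i, rfl⟩
    have hi := (e i).2
    rcases hei : (e i : ℕ × Fin Nt) with ⟨n, q⟩
    rw [hei] at hi
    simp only [nulledIndices, Finset.mem_erase, Finset.mem_product, Finset.mem_range,
      Finset.mem_univ, and_true, ne_eq, Prod.mk.injEq, not_and] at hi
    rcases Nat.eq_zero_or_pos n with rfl | hn
    · exact Or.inl ⟨q, hi.1 rfl, by simp only [hei]⟩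
    · exact Or.inr ⟨n, q, hn, by omega, by simp only [hei]⟩

/-- The receive filter is a unit residual of the desired channel vector with respect to the nulled ones. -/
theorem filter_eq_unitResidual {Nt Nr m k : ℕ} (hm : 1 ≤ m) (κ : Fin Nt)
    (e : Fin k ≃ nulledIndices m κ) (h : ℕ → Fin Nt → EuclideanSpace ℂ (Fin Nr)) :
    filter m κ h =
      unitResidual (fun i => h (e i : ℕ × Fin Nt).1 (e i : ℕ × Fin Nt).2) (h 0 κ) := by
  unfold filter projectedChannel unitResidual residual
  simp only [nulledSpan_eq hm κ e]

/-- The received power of the signal (left) and of the uncancelled interfering streams (right),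
before path loss. -/
noncomputable def powers {Nt Nr : ℕ} (m : ℕ) (κ : Fin Nt)
    (h : ℕ → Fin Nt → EuclideanSpace ℂ (Fin Nr)) : ℝ × (ℕ × Fin Nt → ℝ) :=
  (gain (filter m κ h) (h 0 κ), fun i => gain (filter m κ h) (h (m + i.1) i.2))

section Fading

variable {Ω : Type*} [MeasurableSpace Ω] {P : Measure Ω} [IsProbabilityMeasure P]
  {Nt Nr m δ : ℕ} {h : ℕ → Fin Nt → Ω → EuclideanSpace ℂ (Fin Nr)}
  {X : ℕ → Ω → Plane}

/-- The positions are independent of the received powers before path loss. These are independent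
of each other, with Gamma law of shape `δ + 1` for the signal and exponential laws for the
interference. -/
theorem IsRayleighFading.map_powers (hh : IsRayleighFading h X P) (hNr : Nr = m * Nt + δ)
    (hm : 1 ≤ m) (κ : Fin Nt) (hX : ∀ n, Measurable (X n)) :
    Measurable (fun ω => powers m κ (fun n q => h n q ω)) ∧
    P.map (fun ω => ((fun n => X n ω), powers m κ (fun n q => h n q ω))) =
      (P.map fun ω n => X n ω).prod
        ((gammaMeasure ((δ : ℝ) + 1) 1).prod (Measure.infinitePi fun _ => expMeasure 1)) := by
  set k := (nulledIndices m κ).card with hk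
  have hcard := card_nulledIndices hm κ
  have hN : Nr = k + 1 + δ := by omega
  clear_value k
  obtain ⟨e⟩ : Nonempty (Fin k ≃ nulledIndices m κ) :=
    ⟨((nulledIndices m κ).equivFinOfCardEq hk.symm).symm⟩
  set γ := stdComplexGaussianVec Nr
  -- `S` sorts the channel vectors into nulled, desired and interfering ones; `R` computes the powers.
  set S : (ℕ × Fin Nt → EuclideanSpace ℂ (Fin Nr)) →
      ((Fin k → EuclideanSpace ℂ (Fin Nr)) × EuclideanSpace ℂ (Fin Nr)) ×
        (ℕ × Fin Nt → EuclideanSpace ℂ (Fin Nr)) :=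
    fun u => ((fun i => u (e i), u (0, κ)), fun j => u (m + j.1, j.2))
  have hS : Measurable S := by fun_prop
  set R : ((Fin k → EuclideanSpace ℂ (Fin Nr)) × EuclideanSpace ℂ (Fin Nr)) ×
        (ℕ × Fin Nt → EuclideanSpace ℂ (Fin Nr)) → ℝ × (ℕ × Fin Nt → ℝ) :=
    fun p => (‖residual p.1.1 p.1.2‖ ^ 2, fun j => gain (unitResidual p.1.1 p.1.2) (p.2 j))
  have hR : Measurable R := ((measurable_residual.comp measurable_fst).norm.pow_const 2).prodMk
    (measurable_pi_lambda _ fun j => measurable_gain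
      (measurable_unitResidual.comp measurable_fst)
      ((measurable_pi_apply j).comp measurable_snd))
  have hpow : ∀ ω, powers m κ (fun n q => h n q ω) =
      R (S fun i => h i.1 i.2 ω) := fun ω => by
    simp only [powers, filter_eq_unitResidual hm κ e, R, S, gain_unitResidual_self]
  have hhm : ∀ i : ℕ × Fin Nt, Measurable fun ω => h i.1 i.2 ω := fun i => hh.measurable _ _
  have hall : Measurable fun ω (i : ℕ × Fin Nt) => h i.1 i.2 ω := measurable_pi_lambda _ hhm
  have hmeas : Measurable fun ω => powers m κ (fun n q => h n q ω) := by
    simp_rw [hpow]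
    exact hR.comp (hS.comp hall)
  refine ⟨hmeas, ?_⟩
  have hXm : Measurable fun ω n => X n ω := measurable_pi_lambda _ hX
  have hindX : IndepFun (fun ω n => X n ω) (fun ω => powers m κ (fun n q => h n q ω)) P := by
    simp_rw [hpow]
    exact hh.indep_locations.comp (φ := id) (ψ := R ∘ S) measurable_id (hR.comp hS)
  rw [(indepFun_iff_map_prod_eq_prod_map_map hXm.aemeasurable hmeas.aemeasurable).1 hindX]
  congr 1
  have hein : Function.Injective fun i => (e i : ℕ × Fin Nt) :=
    Subtype.val_injective.comp e.injective
  have heκ : ∀ i, (e i : ℕ × Fin Nt) ≠ (0, κ) := fun i => Finset.ne_of_mem_erase (e i).2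
  have hem : ∀ i, (e i : ℕ × Fin Nt).1 < m := fun i => by
    have := Finset.mem_of_mem_erase (e i).2
    simpa using this
  have hlaw : ∀ i : ℕ × Fin Nt, P.map (fun ω => h i.1 i.2 ω) = γ := fun i => (hh.law _ _).map_eq
  -- the nulled vectors and the desired one, indexed together
  set a : Option (Fin k) → ℕ × Fin Nt := fun o => o.elim (0, κ) fun i => e i
  have ham : ∀ o, (a o).1 < m := by
    rintro (_ | i)
    · exact hm
    · exact hem i
  have hi1 := indepFun_of_disjoint_range hh.indep hhm (a := a)
    (b := fun j : ℕ × Fin Nt => (m + j.1, j.2)) (by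
      rw [Set.disjoint_left]
      rintro _ ⟨o, rfl⟩ ⟨j, hj⟩
      have := ham o
      rw [← hj] at this
      simp at this)
  have hi2 : IndepFun (fun ω => ((fun i => h (e i : ℕ × Fin Nt).1 (e i : ℕ × Fin Nt).2 ω), h 0 κ ω))
      (fun ω (j : ℕ × Fin Nt) => h (m + j.1) j.2 ω) P :=
    hi1.comp (φ := fun v : Option (Fin k) → EuclideanSpace ℂ (Fin Nr) =>
      ((fun i => v (some i)), v none)) (ψ := id) (by fun_prop) measurable_id
  have hi3 : IndepFun (fun ω i => h (e i : ℕ × Fin Nt).1 (e i : ℕ × Fin Nt).2 ω) (h 0 κ) P :=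
    (indepFun_of_disjoint_range hh.indep hhm (a := fun i => (e i : ℕ × Fin Nt))
      (b := fun _ : Unit => ((0 : ℕ), κ)) (by
        rw [Set.disjoint_left]
        rintro _ ⟨i, rfl⟩ ⟨_, hj⟩
        exact heκ i hj.symm)).comp (φ := id)
        (ψ := fun v : Unit → EuclideanSpace ℂ (Fin Nr) => v ())
        measurable_id (by fun_prop)
  have hw1 : P.map (fun ω i => h (e i : ℕ × Fin Nt).1 (e i : ℕ × Fin Nt).2 ω) =
      Measure.pi fun _ => γ := by
    rw [(iIndepFun_iff_map_fun_eq_pi_map fun i => (hhm _).aemeasurable).1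
      (hh.indep.precomp hein)]
    simp_rw [hlaw]
  have hinj : Function.Injective fun j : ℕ × Fin Nt => (m + j.1, j.2) := fun i j hij => by
    simp only [Prod.mk.injEq, Nat.add_left_cancel_iff] at hij
    exact Prod.ext hij.1 hij.2
  have hw2 : P.map (fun ω (j : ℕ × Fin Nt) => h (m + j.1) j.2 ω) =
      Measure.infinitePi fun _ => γ := by
    rw [(hh.indep.precomp hinj).map_fun_eq_infinitePi_map (fun i => hhm _)]
    have : ∀ i : ℕ × Fin Nt, P.map (fun ω => h (m + i.1) i.2 ω) = γ := fun i =>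
      hlaw (m + i.1, i.2)
    simp_rw [this]
  have hj1 := (indepFun_iff_map_prod_eq_prod_map_map
    (measurable_pi_lambda _ fun i => hhm _).aemeasurable (hhm (0, κ)).aemeasurable).1 hi3
  have hj2 := (indepFun_iff_map_prod_eq_prod_map_map
    ((measurable_pi_lambda _ fun i => hhm _).prodMk (hhm (0, κ))).aemeasurable
    (measurable_pi_lambda _ fun j : ℕ × Fin Nt => hhm (m + j.1, j.2)).aemeasurable).1 hi2
  have hSlaw : P.map (fun ω => S fun i => h i.1 i.2 ω) =
      ((Measure.pi fun _ => γ).prod γ).prod (Measure.infinitePi fun _ => γ) := by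
    refine hj2.trans ?_
    rw [hw2]
    congr 1
    refine hj1.trans ?_
    rw [hw1, hlaw (0, κ)]
  simp_rw [hpow]
  have h6 := Measure.map_map (μ := P) hR (hS.comp hall)
  refine Eq.trans (h6.symm.trans ?_) (map_gain_unitResidual hN)
  congr 1

end Fading

/-! ### The Laplace transform of the interference -/

/-- The interference, relative to the power of the serving station, of the points `t (m + i)`
with fading powers `e (i, q)`, where points are measured by the mean number of stations
that are nearer to the user. -/
noncomputable def relInterference {Nt : ℕ} (α : ℝ) (m : ℕ) (t : ℕ → ℝ) (e : ℕ × Fin Nt → ℝ) :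
    ENNReal :=
  ∑' i, ENNReal.ofReal ((t 0 / t (m + i)) ^ (α / 2) * ∑ q, e (i, q))

theorem measurable_relInterference {Nt : ℕ} (α : ℝ) (m : ℕ) :
    Measurable fun p : (ℕ → ℝ) × (ℕ × Fin Nt → ℝ) => relInterference α m p.1 p.2 := by
  unfold relInterference
  exact Measurable.tsum fun i => by fun_prop

/-- The exponent `Nt log (1 + y)`, so that `e^{-logExponent}` is the Laplace transform
`(1 + y) ^ (-Nt)` of a sum of `Nt` independent exponential variables. -/
noncomputable def logExponent (Nt : ℕ) (y : ℝ) : ENNReal := ENNReal.ofReal (Nt * Real.log (1 + y))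

theorem measurable_logExponent (Nt : ℕ) : Measurable (logExponent Nt) := by
  unfold logExponent; fun_prop

theorem expNeg_logExponent (Nt : ℕ) {y : ℝ} (hy : 0 ≤ y) :
    expNeg (logExponent Nt y) = ENNReal.ofReal (((1 + y) ^ Nt)⁻¹) := by
  have h1 : 0 < 1 + y := by linarith
  rw [logExponent, expNeg_ofReal (mul_nonneg (Nat.cast_nonneg _) (Real.log_nonneg (by linarith))),
    Real.exp_neg, mul_comm, Real.exp_mul, Real.exp_log h1, Real.rpow_natCast]

theorem ae_nonneg_expMeasure : ∀ᵐ x ∂expMeasure 1, 0 ≤ x := by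
  have h : expMeasure 1 (Set.Iio 0) = 0 := gammaMeasure_Iio_zero
  filter_upwards [compl_mem_ae_iff.2 h] with x hx
  simpa using hx

/-- Averaging over the fading. -/
theorem lintegral_expNeg_fading {Nt : ℕ} {a : ℕ → ℝ} (ha : ∀ i, 0 ≤ a i) :
    ∫⁻ e, expNeg (∑' i, ENNReal.ofReal (a i * ∑ q, e (i, q)))
        ∂Measure.infinitePi (fun _ : ℕ × Fin Nt => expMeasure 1) =
      expNeg (∑' i, logExponent Nt (a i)) := by
  set η := Measure.infinitePi fun _ : ℕ × Fin Nt => expMeasure 1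
  have hpos : ∀ᵐ e ∂η, ∀ j, 0 ≤ e j := ae_all_iff.2 fun j =>
    (measurePreserving_eval_infinitePi (fun _ : ℕ × Fin Nt => expMeasure 1) j).quasiMeasurePreserving.ae
      ae_nonneg_expMeasure
  have hfac : ∀ j : ℕ × Fin Nt, Measurable fun x : ℝ => expNeg (ENNReal.ofReal (a j.1 * x)) :=
    fun j => measurable_expNeg.comp (by fun_prop)
  -- Finitely many points first; then the number of points tends to infinity by dominated convergence.
  have hK : ∀ K, ∫⁻ e, ∏ i ∈ Finset.range K, expNeg (ENNReal.ofReal (a i * ∑ q, e (i, q))) ∂η =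
      ∏ i ∈ Finset.range K, expNeg (logExponent Nt (a i)) := fun K => by
    have h1 : ∀ᵐ e ∂η, ∏ i ∈ Finset.range K, expNeg (ENNReal.ofReal (a i * ∑ q, e (i, q))) =
        ∏ j ∈ Finset.range K ×ˢ Finset.univ, expNeg (ENNReal.ofReal (a j.1 * e j)) := by
      filter_upwards [hpos] with e he
      rw [Finset.prod_product]
      refine Finset.prod_congr rfl fun i _ => ?_
      rw [Finset.mul_sum, ENNReal.ofReal_sum_of_nonneg fun q _ => mul_nonneg (ha i) (he _),
        expNeg_sum]
    rw [lintegral_congr_ae h1, lintegral_prod_eq_prod_lintegral_of_indepFun _ _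
      (iIndepFun_infinitePi (P := fun _ : ℕ × Fin Nt => expMeasure 1) hfac)
      (fun j => (hfac j).comp (measurable_pi_apply j)), Finset.prod_product]
    refine Finset.prod_congr rfl fun i _ => ?_
    have h2 : ∀ q : Fin Nt, ∫⁻ e, expNeg (ENNReal.ofReal (a i * e (i, q))) ∂η =
        ENNReal.ofReal ((1 + a i)⁻¹) := fun q => by
      have h3 := lintegral_expNeg_gammaMeasure 0 (ha i)
      rw [Nat.cast_zero, zero_add, zero_add, pow_one] at h3
      rw [← h3]
      exact (measurePreserving_eval_infinitePi (fun _ : ℕ × Fin Nt => expMeasure 1)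
        (i, q)).lintegral_comp (hfac (i, q))
    have h0 : 0 ≤ (1 + a i)⁻¹ := inv_nonneg.2 (by linarith [ha i])
    refine (Finset.prod_congr rfl fun q _ => h2 q).trans ?_
    rw [Finset.prod_const, Finset.card_univ, Fintype.card_fin, expNeg_logExponent Nt (ha i),
      ← inv_pow, ENNReal.ofReal_pow h0]
  have hlim := tendsto_expNeg_tsum fun i => logExponent Nt (a i)
  simp_rw [← hK] at hlim
  refine tendsto_nhds_unique ?_ hlim
  refine tendsto_lintegral_of_dominated_convergence (fun _ => 1) (fun K => ?_)
    (fun K => Filter.Eventually.of_forall fun e => ?_) (by simp)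
    (Filter.Eventually.of_forall fun e => tendsto_expNeg_tsum _)
  · exact Finset.measurable_prod _ fun i _ => measurable_expNeg.comp (by fun_prop)
  · exact Finset.prod_le_one' fun i _ => expNeg_le_one _

/-- `Λ₀` is known to be smooth on `(-1, ∞)` only; truncating its argument at `0` gives a function
continuous on the whole line. -/
theorem continuous_Lam_max {α : ℝ} (hα : 2 < α) (Nt : ℕ) :
    Continuous fun w : ℝ => Lam α Nt 0 (max w 0) := by
  refine continuous_iff_continuousAt.2 fun w => ?_
  have h : ContinuousAt (Lam α Nt 0) (max w 0) :=
    (hasDerivAt_Lam hα Nt 0 (by linarith [le_max_right w 0])).continuousAt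
  exact ContinuousAt.comp (f := fun w : ℝ => max w 0) h (by fun_prop)

/-- The ratio of path losses factors at the point `u`: up to `u`, and from `u` to `u + s`. -/
theorem rpow_half_div {α a u s : ℝ} (ha : 0 ≤ a) (hu : 0 < u) (hs : 0 ≤ s) :
    (a / (u + s)) ^ (α / 2) = √(u / a) ^ (-α) * (u / (u + s)) ^ (α / 2) := by
  have h1 : √(u / a) ^ (-α) = (a / u) ^ (α / 2) := by
    rw [Real.sqrt_eq_rpow, ← Real.rpow_mul (by positivity), show 1 / 2 * -α = -(α / 2) by ring,
      Real.rpow_neg (by positivity), ← Real.inv_rpow (by positivity), inv_div]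
  rw [h1, ← Real.mul_rpow (by positivity) (by positivity)]
  congr 1
  field_simp

theorem IsUnitPoisson.measurable_seq {Ω : Type*} [MeasurableSpace Ω] {P : Measure Ω}
    {T : ℕ → Ω → ℝ} (hT : IsUnitPoisson T P) : Measurable fun ω n => T n ω :=
  measurable_pi_lambda _ hT.measurable

namespace IsUnitPoisson

variable {Ω : Type*} [MeasurableSpace Ω] {P : Measure Ω} [IsProbabilityMeasure P]
  {T : ℕ → Ω → ℝ}

/-- Given the points up to `T n`, the later ones form a Poisson process shifted by `T n`, whose
Laplace functional is known. Averaging over the Gamma law of `T n` turns the exponential into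
a power. -/
theorem lintegral_expNeg_logExponent (hT : IsUnitPoisson T P) {α : ℝ} (hα : 2 < α) (Nt n : ℕ)
    {c : ℝ} (hc : 0 ≤ c) :
    ∫⁻ ω, expNeg (∑' i, logExponent Nt (c * (T 0 ω / T (n + 1 + i) ω) ^ (α / 2))) ∂P =
      ∫⁻ ω, ENNReal.ofReal
        ((Lam α Nt 0 (c * √(T n ω / T 0 ω) ^ (-α)) ^ (n + 1))⁻¹) ∂P := by
  have hm := hT.measurable
  have hseq := hT.measurable_seq
  have hL := (continuous_Lam_max hα Nt).measurable
  have hψ := measurable_logExponent Nt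
  set w : ℝ × ℝ → ℝ := fun p => c * √(p.2 / p.1) ^ (-α) with hw
  have hw0 : ∀ p, 0 ≤ w p := fun p => by rw [hw]; positivity
  set F : (ℝ × ℝ) × (ℕ → ℝ) → ENNReal := fun p =>
    expNeg (∑' i, logExponent Nt (w p.1 * (p.1.2 / (p.1.2 + p.2 i)) ^ (α / 2))) with hF
  have hwm : Measurable w := by fun_prop
  have hFm : Measurable F := by
    refine measurable_expNeg.comp (Measurable.tsum fun i => hψ.comp ?_)
    fun_prop
  have hS : Measurable fun ω i => T (n + 1 + i) ω - T n ω :=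
    measurable_pi_lambda _ fun i => (hm _).sub (hm _)
  have hind : IndepFun (fun ω => (T 0 ω, T n ω)) (fun ω i => T (n + 1 + i) ω - T n ω) P :=
    (hT.indepFun_restart n).comp
      (φ := fun v : Fin (n + 1) → ℝ => (v 0, v (Fin.last n))) (ψ := id) (by fun_prop) measurable_id
  have hjoint := (indepFun_iff_map_prod_eq_prod_map_map
    ((hm 0).prodMk (hm n)).aemeasurable hS.aemeasurable).1 hind
  rw [hT.map_restart n] at hjoint
  have := Measure.isProbabilityMeasure_map (μ := P) hseq.aemeasurable
  -- Seen from `T n`, the path loss relative to the serving point is `w` times that relative to `T n`.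
  have h1 : ∫⁻ ω, expNeg (∑' i, logExponent Nt (c * (T 0 ω / T (n + 1 + i) ω) ^ (α / 2))) ∂P =
      ∫⁻ p, F p ∂P.map (fun ω => ((T 0 ω, T n ω), fun i => T (n + 1 + i) ω - T n ω)) := by
    rw [lintegral_map hFm (by fun_prop)]
    refine lintegral_congr_ae ?_
    filter_upwards [hT.ae_pos, hT.mono] with ω hpos hmono
    simp only [hF, hw]
    congr 2
    funext i
    have hs : 0 ≤ T (n + 1 + i) ω - T n ω := sub_nonneg.2 (hmono (by omega))
    have h := rpow_half_div (α := α) (hpos 0).le (hpos n) hs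
    rw [mul_assoc, ← h, add_sub_cancel]
  have h2 : ∀ᵐ ω ∂P, ∫⁻ s, F ((T 0 ω, T n ω), s) ∂P.map (fun ω n => T n ω) =
      expNeg (ENNReal.ofReal ((Lam α Nt 0 (max (c * √(T n ω / T 0 ω) ^ (-α)) 0) - 1) * T n ω)) := by
    filter_upwards [hT.ae_pos] with ω hpos
    have hwn := hw0 (T 0 ω, T n ω)
    have hmeas : Measurable fun t =>
        logExponent Nt (w (T 0 ω, T n ω) * (T n ω / (T n ω + t)) ^ (α / 2)) :=
      hψ.comp (by fun_prop)
    rw [lintegral_map (by fun_prop) hseq]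
    refine (hT.laplace hmeas).trans ?_
    rw [max_eq_left hwn, mul_comm, ← lintegral_one_sub_eq_Lam hα Nt hwn (hpos n)]
    congr 1
    refine setLIntegral_congr_fun measurableSet_Ici fun t ht => ?_
    have ht0 : (0 : ℝ) ≤ t := ht
    have hu := hpos n
    rw [expNeg_logExponent Nt (mul_nonneg hwn (by positivity))]
  rw [h1, hjoint, lintegral_prod _ hFm.aemeasurable, lintegral_map hFm.lintegral_prod_right'
    ((hm 0).prodMk (hm n)), lintegral_congr_ae h2]
  -- the law of the pair of the ratio and `T n`
  set Q : ℝ × ℝ → ENNReal := fun p =>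
    expNeg (ENNReal.ofReal ((Lam α Nt 0 (max (c * p.1 ^ (-α)) 0) - 1) * p.2)) with hQ
  have hLm : Measurable fun b : ℝ => Lam α Nt 0 (max (c * b ^ (-α)) 0) :=
    hL.comp (f := fun b : ℝ => c * b ^ (-α)) (by fun_prop)
  have hQm : Measurable Q := measurable_expNeg.comp
    (((hLm.comp measurable_fst).sub_const 1).mul measurable_snd).ennreal_ofReal
  have hg : IsProbabilityMeasure (gammaMeasure ((n : ℝ) + 1) 1) :=
    isProbabilityMeasure_gammaMeasure (by positivity) one_pos
  have h3 : ∫⁻ ω, Q (√(T n ω / T 0 ω), T n ω) ∂P =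
      ∫⁻ p, Q p ∂P.map (fun ω => (√(T n ω / T 0 ω), T n ω)) := by
    rw [lintegral_map hQm (by fun_prop)]
  refine h3.trans ?_
  rw [hT.map_ratio n, lintegral_prod _ hQm.aemeasurable,
    lintegral_map hQm.lintegral_prod_right' (by fun_prop)]
  refine lintegral_congr fun ω => ?_
  have hwn := hw0 (T 0 ω, T n ω)
  have h1L := one_le_Lam_zero hα Nt (le_max_right (c * √(T n ω / T 0 ω) ^ (-α)) 0)
  simp only [hQ]
  rw [lintegral_expNeg_gammaMeasure n (sub_nonneg.2 h1L), add_sub_cancel, max_eq_left hwn]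

end IsUnitPoisson

/-- The Laplace transform of the relative interference. -/
theorem IsUnitPoisson.lintegral_expNeg_relInterference {Ω : Type*} [MeasurableSpace Ω]
    {P : Measure Ω} [IsProbabilityMeasure P] {T : ℕ → Ω → ℝ} (hT : IsUnitPoisson T P) {α : ℝ}
    (hα : 2 < α) {Nt : ℕ} (n : ℕ) {e : Ω → ℕ × Fin Nt → ℝ} (he : Measurable e)
    (hlaw : P.map (fun ω => ((fun n => T n ω), e ω)) =
      (P.map fun ω n => T n ω).prod (Measure.infinitePi fun _ => expMeasure 1))
    {c : ℝ} (hc : 0 ≤ c) :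
    ∫⁻ ω, expNeg (ENNReal.ofReal c * relInterference α (n + 1) (fun n => T n ω) (e ω)) ∂P =
      ∫⁻ ω, ENNReal.ofReal
        ((Lam α Nt 0 (c * √(T n ω / T 0 ω) ^ (-α)) ^ (n + 1))⁻¹) ∂P := by
  have hseq := hT.measurable_seq
  have hY := measurable_relInterference (Nt := Nt) α (n + 1)
  have hF : Measurable fun p : (ℕ → ℝ) × (ℕ × Fin Nt → ℝ) =>
      expNeg (ENNReal.ofReal c * relInterference α (n + 1) p.1 p.2) :=
    measurable_expNeg.comp (hY.const_mul _)
  have h1 := lintegral_map (μ := P) hF (hseq.prodMk he)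
  refine h1.symm.trans ?_
  rw [hlaw, lintegral_prod _ hF.aemeasurable, lintegral_map hF.lintegral_prod_right' hseq,
    ← hT.lintegral_expNeg_logExponent hα Nt n hc]
  refine lintegral_congr fun ω => ?_
  rw [← lintegral_expNeg_fading fun i => mul_nonneg hc
    (Real.rpow_nonneg (div_nonneg (hT.nonneg 0 ω) (hT.nonneg _ ω)) _)]
  refine lintegral_congr fun e => ?_
  rw [relInterference, ← ENNReal.tsum_mul_left]
  congr 2
  funext i
  rw [← ENNReal.ofReal_mul hc, mul_assoc]

/-! ### The coverage probability -/

section Realization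

variable {Nt Nr : ℕ} {α lam : ℝ} {m : ℕ} {κ : Fin Nt} {x : ℕ → Plane}
  {h : ℕ → Fin Nt → EuclideanSpace ℂ (Fin Nr)}

/-- Path losses are compared to that of the serving station: `(t 0 / t n) ^ (α / 2)` equals
`(‖x 0‖ / ‖x n‖) ^ α` for `t n = πλ‖x n‖²`. -/
theorem residualInterference_eq (hlam : 0 < lam) (hx : ∀ n, 0 < ‖x n‖) :
    residualInterference α m κ x h = ENNReal.ofReal (‖x 0‖ ^ (-α)) *
      relInterference α m (fun n => Real.pi * lam * ‖x n‖ ^ 2) (powers m κ h).2 := by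
  have hpi := Real.pi_pos
  have h0 := hx 0
  set e : ℕ ≃ {n : ℕ // m ≤ n} :=
    { toFun := fun i => ⟨m + i, Nat.le_add_right m i⟩
      invFun := fun n => n - m
      left_inv := fun i => by simp
      right_inv := fun n => by
        have := n.2
        ext; simp; omega }
  rw [residualInterference, ← e.tsum_eq, relInterference, ← ENNReal.tsum_mul_left]
  refine tsum_congr fun i => ?_
  have hi := hx (m + i)
  rw [← ENNReal.ofReal_mul (by positivity)]
  congr 1
  change ‖x (m + i)‖ ^ (-α) * ∑ q : Fin Nt, gain (filter m κ h) (h (m + i) q) = _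
  rw [← mul_assoc]
  congr 1
  rw [mul_div_mul_left _ _ (by positivity), ← div_pow, ← Real.rpow_natCast, ← Real.rpow_mul
    (by positivity), show ((2 : ℕ) : ℝ) * (α / 2) = α by push_cast; ring,
    Real.div_rpow h0.le hi.le, Real.rpow_neg h0.le, Real.rpow_neg hi.le]
  have := Real.rpow_pos_of_pos h0 α
  field_simp

/-- Without noise, coverage compares the signal power with the relative interference. -/
theorem lt_sinr_iff (hlam : 0 < lam) (hx : ∀ n, 0 < ‖x n‖) {z : ℝ} (hz : 0 ≤ z)
    (hY : relInterference α m (fun n => Real.pi * lam * ‖x n‖ ^ 2) (powers m κ h).2 < ⊤) :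
    ENNReal.ofReal z < sinr α 0 m κ x h ↔
      z * (relInterference α m (fun n => Real.pi * lam * ‖x n‖ ^ 2) (powers m κ h).2).toReal <
        (powers m κ h).1 := by
  have hr : 0 < ‖x 0‖ ^ (-α) := Real.rpow_pos_of_pos (hx 0) _
  have hr0 : ENNReal.ofReal (‖x 0‖ ^ (-α)) ≠ 0 := (ENNReal.ofReal_pos.2 hr).ne'
  rw [sinr, residualInterference_eq hlam hx, mul_zero, ENNReal.ofReal_zero, zero_add,
    ENNReal.lt_div_iff_mul_lt (Or.inr ENNReal.ofReal_ne_top)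
      (Or.inl (ENNReal.mul_lt_top ENNReal.ofReal_lt_top hY).ne), mul_left_comm,
    mul_comm (gain _ _), ENNReal.ofReal_mul hr.le,
    ENNReal.mul_lt_mul_iff_right hr0 ENNReal.ofReal_ne_top,
    ENNReal.lt_ofReal_iff_toReal_lt (ENNReal.mul_lt_top ENNReal.ofReal_lt_top hY).ne,
    ENNReal.toReal_mul, ENNReal.toReal_ofReal hz]
  rfl

/-- The ratio `β` of the distances in terms of the points `T n = πλ‖X n‖²` of the half-line. -/
theorem ratio_eq_sqrt {Ω : Type*} (X : ℕ → Ω → Plane) (hlam : 0 < lam) (n : ℕ) (ω : Ω) :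
    ratio X (n + 1) ω =
      √((Real.pi * lam * ‖X n ω‖ ^ 2) / (Real.pi * lam * ‖X 0 ω‖ ^ 2)) := by
  have hpi := Real.pi_pos
  rw [mul_div_mul_left _ _ (by positivity), ← div_pow, Real.sqrt_sq (by positivity), ratio,
    Nat.add_sub_cancel]

end Realization

/-- If `(t, (H, e))` has a product law, then so does `((t, e), H)`. -/
theorem map_prod_rotate {A B C : Type*} [MeasurableSpace A] [MeasurableSpace B] [MeasurableSpace C]
    (μ : Measure A) (ν : Measure B) (η : Measure C) [IsProbabilityMeasure μ]
    [IsProbabilityMeasure ν] [IsProbabilityMeasure η] :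
    (μ.prod (ν.prod η)).map (fun p => ((p.1, p.2.2), p.2.1)) = (μ.prod η).prod ν := by
  refine Measure.ext_of_lintegral _ fun F hF => ?_
  rw [lintegral_map hF (by fun_prop), lintegral_prod _ (by fun_prop),
    lintegral_prod _ hF.aemeasurable, lintegral_prod _ hF.lintegral_prod_right'.aemeasurable]
  refine lintegral_congr fun a => ?_
  rw [lintegral_prod _ (by fun_prop)]
  exact lintegral_lintegral_swap (by fun_prop)

/-- The coverage event for a Gamma distributed signal power independent of the interference. -/
theorem measureReal_lt_gamma {Ω A : Type*} [MeasurableSpace Ω] [MeasurableSpace A] {P : Measure Ω}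
    [IsProbabilityMeasure P] {V : Ω → A} {H : Ω → ℝ} {δ : ℕ} (hV : Measurable V)
    (hH : Measurable H)
    (hlaw : P.map (fun ω => (V ω, H ω)) = (P.map V).prod (gammaMeasure ((δ : ℝ) + 1) 1))
    {y : A → ℝ} (hy : Measurable y) (hy0 : ∀ a, 0 ≤ y a) :
    P.real {ω | y (V ω) < H ω} = ∫ ω, gammaTail δ (y (V ω)) ∂P := by
  have hg : IsProbabilityMeasure (gammaMeasure ((δ : ℝ) + 1) 1) :=
    isProbabilityMeasure_gammaMeasure (by positivity) one_pos
  have := Measure.isProbabilityMeasure_map (μ := P) hV.aemeasurable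
  have hset : MeasurableSet {p : A × ℝ | y p.1 < p.2} :=
    measurableSet_lt (by fun_prop) measurable_snd
  have hcont : Continuous (gammaTail δ) :=
    continuous_iff_continuousAt.2 fun t => (hasDerivAt_gammaTail δ t).continuousAt
  have h1 := Measure.map_apply (μ := P) (hV.prodMk hH) hset
  rw [hlaw, Measure.prod_apply hset, lintegral_map (measurable_measure_prodMk_left hset) hV] at h1
  have h2 : ∀ ω, gammaMeasure ((δ : ℝ) + 1) 1 (Prod.mk (V ω) ⁻¹' {p : A × ℝ | y p.1 < p.2}) =
      ENNReal.ofReal (gammaTail δ (y (V ω))) := fun ω => gammaMeasure_Ioi δ (hy0 _)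
  simp_rw [h2] at h1
  rw [integral_eq_lintegral_of_nonneg_ae
    (Filter.Eventually.of_forall fun ω => gammaTail_nonneg δ (hy0 _))
    (hcont.measurable.comp (hy.comp hV)).aestronglyMeasurable, h1]
  rfl

theorem poch_natCast_pos {m : ℕ} (hm : 1 ≤ m) (n : ℕ) : 0 < poch m n :=
  ascPochhammer_pos n _ (by exact_mod_cast hm)

theorem continuousAt_negPowTerm_Lam {α : ℝ} (hα : 2 < α) (Nt m : ℕ) {ι : Type*}
    (parts : Finset (Finset ι)) {w : ℝ} (hw : 0 ≤ w) :
    ContinuousAt (fun w => negPowTerm m (fun j => LamDeriv α Nt j w) parts) w := by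
  have hc : ∀ j, ContinuousAt (LamDeriv α Nt j) w := fun j =>
    (hasDerivAt_LamDeriv hα Nt j (by linarith)).continuousAt
  unfold negPowTerm
  refine (continuousAt_const.mul (((hc 0).pow _).inv₀ ?_)).mul
    (tendsto_finsetProd _ fun B _ => hc _)
  change LamDeriv α Nt 0 w ^ (m + parts.card) ≠ 0
  rw [LamDeriv_zero]
  exact pow_ne_zero _ (by linarith [one_le_Lam_zero hα Nt hw])

/-- The expectation of the partition sum, expressed through the derivatives of `Λ₀⁻ᵐ`. -/
theorem integral_partitionTerm {Ω : Type*} [MeasurableSpace Ω] {P : Measure Ω}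
    [IsProbabilityMeasure P] {α : ℝ} (hα : 2 < α) (Nt : ℕ) {m : ℕ} (hm : 1 ≤ m) {b : Ω → ℝ}
    (hb : Measurable b) (hb1 : ∀ᵐ ω ∂P, 1 ≤ b ω) {z : ℝ} (hz : 0 ≤ z) (k : ℕ) :
    (∀ υ : Finpartition (Finset.Icc 1 k), Integrable (fun ω => partitionTerm α Nt m z υ (b ω)) P) ∧
    ∑ υ : Finpartition (Finset.Icc 1 k), (-1) ^ υ.parts.card * poch m υ.parts.card *
        ∫ ω, partitionTerm α Nt m z υ (b ω) ∂P =
      (-1) ^ k * ∫ ω, (b ω ^ (-α)) ^ k *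
        negPowDeriv m (fun j => LamDeriv α Nt j (z * b ω ^ (-α))) k ∂P := by
  have hx01 : ∀ᵐ ω ∂P, b ω ^ (-α) ∈ Set.Icc (0 : ℝ) 1 := by
    filter_upwards [hb1] with ω hω
    exact ⟨by positivity, Real.rpow_le_one_of_one_le_of_nonpos hω (by linarith)⟩
  have hxm : AEMeasurable (fun ω => b ω ^ (-α)) P := (hb.pow_const _).aemeasurable
  have hterm : ∀ υ : Finpartition (Finset.Icc 1 k), Integrable (fun ω => (b ω ^ (-α)) ^ k *
      negPowTerm m (fun j => LamDeriv α Nt j (z * b ω ^ (-α))) υ.parts) P := fun υ =>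
    integrable_mixture (fun w hw => continuousAt_negPowTerm_Lam hα Nt m υ.parts hw) hxm hx01 k hz
  have heq : ∀ υ : Finpartition (Finset.Icc 1 k),
      (fun ω => (-1) ^ υ.parts.card * poch m υ.parts.card * partitionTerm α Nt m z υ (b ω)) =ᵐ[P]
        fun ω => (-1) ^ k * ((b ω ^ (-α)) ^ k *
          negPowTerm m (fun j => LamDeriv α Nt j (z * b ω ^ (-α))) υ.parts) := fun υ => by
    filter_upwards [hb1] with ω hω
    exact partitionTerm_eq hα Nt m hz υ (by linarith)
  refine ⟨fun υ => ?_, ?_⟩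
  · have h1 := ((hterm υ).const_mul ((-1) ^ k)).congr (heq υ).symm
    have hne : (-1 : ℝ) ^ υ.parts.card * poch m υ.parts.card ≠ 0 :=
      mul_ne_zero (pow_ne_zero _ (by norm_num)) (poch_natCast_pos hm _).ne'
    exact (integrable_const_mul_iff hne.isUnit _).1 h1
  · have h2 : ∀ υ : Finpartition (Finset.Icc 1 k), (-1) ^ υ.parts.card * poch m υ.parts.card *
        ∫ ω, partitionTerm α Nt m z υ (b ω) ∂P = (-1) ^ k * ∫ ω, (b ω ^ (-α)) ^ k *
          negPowTerm m (fun j => LamDeriv α Nt j (z * b ω ^ (-α))) υ.parts ∂P := fun υ => by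
      rw [← integral_const_mul, ← integral_const_mul, integral_congr_ae (heq υ)]
    simp_rw [h2]
    rw [← Finset.mul_sum, ← integral_finsetSum _ fun υ _ => hterm υ]
    simp_rw [negPowDeriv, Finset.mul_sum]

section Network

variable {Ω : Type*} [MeasurableSpace Ω] {P : Measure Ω} [IsProbabilityMeasure P]
  {lam α : ℝ} {Nt Nr m δ : ℕ} {Φ : Ω → Set Plane} {X : ℕ → Ω → Plane}
  {h : ℕ → Fin Nt → Ω → EuclideanSpace ℂ (Fin Nr)}

/-- The signal power is independent of the positions and the interference powers. -/
theorem IsRayleighFading.map_radial_powers (hh : IsRayleighFading h X P) (hNr : Nr = m * Nt + δ)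
    (hm : 1 ≤ m) (κ : Fin Nt) (hX : ∀ n, Measurable (X n)) (lam : ℝ) :
    P.map (fun ω => (((fun i => Real.pi * lam * ‖X i ω‖ ^ 2 : ℕ → ℝ),
        (powers m κ fun i q => h i q ω).2), (powers m κ fun i q => h i q ω).1)) =
      ((P.map fun ω (i : ℕ) => Real.pi * lam * ‖X i ω‖ ^ 2).prod
        (Measure.infinitePi fun _ => expMeasure 1)).prod (gammaMeasure ((δ : ℝ) + 1) 1) := by
  obtain ⟨hpm, hplaw⟩ := hh.map_powers hNr hm κ hX
  have hg : IsProbabilityMeasure (gammaMeasure ((δ : ℝ) + 1) 1) :=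
    isProbabilityMeasure_gammaMeasure (by positivity) one_pos
  have hXs : Measurable fun ω i => X i ω := measurable_pi_lambda _ hX
  have hrad : Measurable fun (x : ℕ → Plane) (i : ℕ) => Real.pi * lam * ‖x i‖ ^ 2 := by fun_prop
  have := Measure.isProbabilityMeasure_map (μ := P) hXs.aemeasurable
  have hrot : Measurable fun p : (ℕ → Plane) × (ℝ × (ℕ × Fin Nt → ℝ)) =>
      ((p.1, p.2.2), p.2.1) := by fun_prop
  have hlast : Measurable (Prod.map (Prod.map
      (fun (x : ℕ → Plane) (i : ℕ) => Real.pi * lam * ‖x i‖ ^ 2)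
      (id : (ℕ × Fin Nt → ℝ) → ℕ × Fin Nt → ℝ)) (id : ℝ → ℝ)) :=
    (hrad.prodMap measurable_id).prodMap measurable_id
  have h1 := congrArg (Measure.map (Prod.map (Prod.map
      (fun (x : ℕ → Plane) (i : ℕ) => Real.pi * lam * ‖x i‖ ^ 2)
      (id : (ℕ × Fin Nt → ℝ) → ℕ × Fin Nt → ℝ)) (id : ℝ → ℝ)))
    (congrArg (Measure.map fun p : (ℕ → Plane) × (ℝ × (ℕ × Fin Nt → ℝ)) =>
      ((p.1, p.2.2), p.2.1)) hplaw)
  rw [map_prod_rotate, ← Measure.map_prod_map _ _ (hrad.prodMap measurable_id) measurable_id,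
    ← Measure.map_prod_map _ _ hrad measurable_id, Measure.map_id, Measure.map_id,
    Measure.map_map hrad hXs, Measure.map_map hrot (hXs.prodMk hpm),
    Measure.map_map hlast (hrot.comp (hXs.prodMk hpm))] at h1
  exact h1

/-- The relative interference of the network. -/
noncomputable def netInterference (α lam : ℝ) (m : ℕ) (κ : Fin Nt) (X : ℕ → Ω → Plane)
    (h : ℕ → Fin Nt → Ω → EuclideanSpace ℂ (Fin Nr)) (ω : Ω) : ENNReal :=
  relInterference α m (fun i => Real.pi * lam * ‖X i ω‖ ^ 2) (powers m κ fun i q => h i q ω).2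

theorem measurable_netInterference (hh : IsRayleighFading h X P) (hNr : Nr = m * Nt + δ)
    (hm : 1 ≤ m) (κ : Fin Nt) (hX : ∀ n, Measurable (X n)) :
    Measurable (netInterference α lam m κ X h) := by
  have h1 : Measurable fun ω (i : ℕ) => Real.pi * lam * ‖X i ω‖ ^ 2 :=
    measurable_pi_lambda _ fun i => ((hX i).norm.pow_const 2).const_mul _
  have h2 := (hh.map_powers hNr hm κ hX).1
  have h3 : Measurable fun ω => (powers m κ fun i q => h i q ω).2 := measurable_snd.comp h2
  have h4 := (measurable_relInterference (Nt := Nt) α m).comp (h1.prodMk h3)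
  exact h4

/-- The Laplace transform of the relative interference is the expectation of `Λ₀⁻ᵐ`. -/
theorem lintegral_expNeg_netInterference (hlam : 0 < lam) (hα : 2 < α) {n : ℕ}
    (hT : IsUnitPoisson (fun n ω => Real.pi * lam * ‖X n ω‖ ^ 2) P)
    (hh : IsRayleighFading h X P) (hNr : Nr = (n + 1) * Nt + δ)
    (κ : Fin Nt) (hX : ∀ n, Measurable (X n)) {c : ℝ} (hc : 0 ≤ c) :
    ∫⁻ ω, expNeg (ENNReal.ofReal c * netInterference α lam (n + 1) κ X h ω) ∂P =
      ∫⁻ ω, ENNReal.ofReal ((Lam α Nt 0 (c * ratio X (n + 1) ω ^ (-α)) ^ (n + 1))⁻¹) ∂P := by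
  have hpm := (hh.map_powers hNr (Nat.le_add_left 1 n) κ hX).1
  have hVH := hh.map_radial_powers hNr (Nat.le_add_left 1 n) κ hX lam
  have hseq := hT.measurable_seq
  have hg : IsProbabilityMeasure (gammaMeasure ((δ : ℝ) + 1) 1) :=
    isProbabilityMeasure_gammaMeasure (by positivity) one_pos
  have h1 := congrArg (Measure.map Prod.fst) hVH
  rw [Measure.map_map measurable_fst ((hseq.prodMk hpm.snd).prodMk hpm.fst),
    Measure.map_fst_prod, measure_univ, one_smul] at h1
  simp_rw [ratio_eq_sqrt X hlam n]
  exact hT.lintegral_expNeg_relInterference hα n hpm.snd h1 hc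

/-- Given the interference, the coverage probability is a tail of the Gamma law. -/
theorem coverage_eq_integral (hlam : 0 < lam)
    (hT : IsUnitPoisson (fun n ω => Real.pi * lam * ‖X n ω‖ ^ 2) P)
    (hh : IsRayleighFading h X P) (hNr : Nr = m * Nt + δ) (hm : 1 ≤ m)
    (κ : Fin Nt) (hX : ∀ n, Measurable (X n)) (hX0 : ∀ᵐ ω ∂P, ∀ n, 0 < ‖X n ω‖)
    (hY : ∀ᵐ ω ∂P, netInterference α lam m κ X h ω < ⊤) {z : ℝ} (hz : 0 ≤ z) :
    coverage α 0 m κ X h P z =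
      ∫ ω, gammaTail δ (z * (netInterference α lam m κ X h ω).toReal) ∂P := by
  have hpm := (hh.map_powers hNr hm κ hX).1
  have hVH := hh.map_radial_powers hNr hm κ hX lam
  have hseq := hT.measurable_seq
  have hg : IsProbabilityMeasure (gammaMeasure ((δ : ℝ) + 1) 1) :=
    isProbabilityMeasure_gammaMeasure (by positivity) one_pos
  have h2 := congrArg (Measure.map Prod.fst) hVH
  rw [Measure.map_map measurable_fst ((hseq.prodMk hpm.snd).prodMk hpm.fst),
    Measure.map_fst_prod, measure_univ, one_smul] at h2
  rw [← h2] at hVH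
  have h1 := measureReal_lt_gamma (P := P) (hseq.prodMk hpm.snd) hpm.fst hVH
    (y := fun p => z * (relInterference α m p.1 p.2).toReal)
    ((measurable_relInterference α m).ennreal_toReal.const_mul z)
    (fun p => mul_nonneg hz ENNReal.toReal_nonneg)
  refine Eq.trans (measureReal_congr ?_) h1
  filter_upwards [hX0, hY] with ω hω hYω
  exact propext (lt_sinr_iff hlam hω hz hYω)

end Network

end PZF

theorem theorem2 {Ω : Type*} [MeasurableSpace Ω] (P : Measure Ω) [IsProbabilityMeasure P]
    (lam α : ℝ) (hlam : 0 < lam) (hα : 2 < α)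
    (Nt Nr m δ : ℕ) (hm : 1 ≤ m) (hNr : Nr = m * Nt + δ) (κ : Fin Nt)
    (Φ : Ω → Set PZF.Plane) (hΦ : PZF.IsPoissonPointProcess Φ lam P)
    (X : ℕ → Ω → PZF.Plane) (hX : PZF.IsNearestFirstLabelling X Φ P)
    (h : ℕ → Fin Nt → Ω → EuclideanSpace ℂ (Fin Nr)) (hh : PZF.IsRayleighFading h X P)
    (z : ℝ) (hz : 0 ≤ z) :
    (∀ k ∈ Finset.range (δ + 1), ∀ υ : Finpartition (Finset.Icc 1 k),
      Integrable (fun ω => PZF.partitionTerm α Nt m z υ (PZF.ratio X m ω)) P) ∧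
    PZF.coverage α 0 m κ X h P z =
      ∑ k ∈ Finset.range (δ + 1), z ^ k / (k.factorial : ℝ) *
        ∑ υ : Finpartition (Finset.Icc 1 k),
          (-1) ^ υ.parts.card * PZF.poch m υ.parts.card *
            ∫ ω, PZF.partitionTerm α Nt m z υ (PZF.ratio X m ω) ∂P ∧
    (2 ≤ m → HasLaw (PZF.ratio X m)
      (volume.withDensity fun b => ENNReal.ofReal (PZF.ratioDensity m b)) P) ∧
    (m = 1 → ∀ᵐ ω ∂P, PZF.ratio X m ω = 1) := by
  open PZF in
  have hpi := Real.pi_pos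
  have hT := hΦ.isUnitPoisson hlam hX
  set T : ℕ → Ω → ℝ := fun n ω => Real.pi * lam * ‖X n ω‖ ^ 2 with hTdef
  have hXm := hX.measurable
  obtain ⟨n, rfl⟩ : ∃ n, m = n + 1 := ⟨m - 1, by omega⟩
  have hratio : ∀ ω, ratio X (n + 1) ω = √(T n ω / T 0 ω) := ratio_eq_sqrt X hlam n
  have hratiom : Measurable (ratio X (n + 1)) := by
    have : ratio X (n + 1) = fun ω => √(T n ω / T 0 ω) := funext hratio
    rw [this]
    have := hT.measurable
    fun_prop
  have hX0 : ∀ᵐ ω ∂P, ∀ n, 0 < ‖X n ω‖ := by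
    filter_upwards [hT.ae_pos] with ω hω k
    refine (norm_nonneg _).lt_of_ne' fun h0 => (hω k).ne' ?_
    simp [hTdef, h0]
  have hratio1 : ∀ᵐ ω ∂P, 1 ≤ ratio X (n + 1) ω := by
    filter_upwards [hT.ae_pos, hT.mono] with ω hpos hmono
    rw [hratio ω, Real.one_le_sqrt, one_le_div (hpos 0)]
    exact hmono (Nat.zero_le n)
  have hpart := integral_partitionTerm hα Nt hm hratiom hratio1 hz
  refine ⟨fun k _ υ => (hpart k).1 υ, ?_, fun h2 => ?_, fun h1 => ?_⟩
  · simp_rw [fun k => (hpart k).2]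
    set Y : Ω → ENNReal := netInterference α lam (n + 1) κ X h with hY
    have hYm : Measurable Y := measurable_netInterference hh hNr hm κ hXm
    set x : Ω → ℝ := fun ω => ratio X (n + 1) ω ^ (-α) with hx
    have hxm : AEMeasurable x P := (hratiom.pow_const _).aemeasurable
    have hx01 : ∀ᵐ ω ∂P, x ω ∈ Set.Icc (0 : ℝ) 1 := by
      filter_upwards [hratio1] with ω hω
      exact ⟨by positivity, Real.rpow_le_one_of_one_le_of_nonpos hω (by linarith)⟩
    set G : ℕ → ℝ → ℝ := fun k w => negPowDeriv (n + 1) (fun j => LamDeriv α Nt j w) k with hG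
    have hGder : ∀ k w, 0 ≤ w → HasDerivAt (G k) (G (k + 1) w) w := fun k w hw =>
      hasDerivAt_negPowDeriv_Lam hα Nt (n + 1) k hw
    have hGc : ∀ w, 0 ≤ w → ContinuousAt (G 0) w := fun w hw => (hGder 0 w hw).continuousAt
    have hGeq : ∀ w, G 0 w = (Lam α Nt 0 w ^ (n + 1))⁻¹ := fun w => by
      simp only [hG, negPowDeriv_zero, LamDeriv_zero]
    have hG0 : G 0 0 = 1 := by rw [hGeq, Lam_zero_zero hα]; simp
    have hlap : ∀ c > 0, ∫⁻ ω, expNeg (ENNReal.ofReal c * Y ω) ∂P =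
        ENNReal.ofReal (∫ ω, G 0 (c * x ω) ∂P) := fun c hc => by
      have hint : Integrable (fun ω => G 0 (c * x ω)) P := by
        simpa using integrable_mixture hGc hxm hx01 0 hc.le
      rw [ofReal_integral_eq_lintegral_ofReal hint,
        lintegral_expNeg_netInterference hlam hα hT hh hNr κ hXm hc.le]
      · exact lintegral_congr fun ω => by rw [hGeq]
      · filter_upwards [hx01] with ω hω
        have := one_le_Lam_zero hα Nt (mul_nonneg hc.le hω.1)
        rw [hGeq]
        positivity
    have hYtop := ae_lt_top_of_laplace hGc hG0 hxm hx01 hYm.aemeasurable hlap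
    rw [coverage_eq_integral hlam hT hh hNr hm κ hXm hX0 hYtop hz]
    -- The Laplace transform is differentiable for positive arguments only; at `z = 0` the coverage
    -- probability is `1`.
    rcases hz.eq_or_lt with rfl | hz0
    · rw [Finset.sum_range_succ', Finset.sum_eq_zero fun k _ => by simp]
      have h1 : gammaTail δ 0 = 1 := by
        rw [gammaTail, Finset.sum_range_succ', Finset.sum_eq_zero fun k _ => by simp]
        simp
      have h2 : negPowDeriv (n + 1) (fun j => LamDeriv α Nt j 0) 0 = 1 := hG0
      simp [h1, h2]
    · have hmom := fun k => integral_pow_mul_exp_eq hGder hG0 hxm hx01 hYm.aemeasurable hlap hz0 k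
      have hexp : ∀ ω, gammaTail δ (z * (Y ω).toReal) = ∑ k ∈ Finset.range (δ + 1),
          z ^ k / k.factorial * ((Y ω).toReal ^ k * Real.exp (-(z * (Y ω).toReal))) := fun ω => by
        rw [gammaTail]
        refine Finset.sum_congr rfl fun k _ => ?_
        rw [mul_pow]; ring
      refine (integral_congr_ae (Filter.Eventually.of_forall hexp)).trans ?_
      rw [integral_finsetSum _ fun k _ => (hmom k).1.const_mul _]
      refine Finset.sum_congr rfl fun k _ => ?_
      rw [integral_const_mul, (hmom k).2]
  · obtain ⟨l, rfl⟩ : ∃ l, n = l + 1 := ⟨n - 1, by omega⟩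
    refine ⟨hratiom.aemeasurable, ?_⟩
    rw [← hT.map_sqrt_ratio_succ l]
    exact congrArg (fun f => P.map f) (funext hratio)
  · filter_upwards [hX0] with ω hω
    obtain rfl : n = 0 := by omega
    rw [ratio]
    exact div_self (hω 0).ne'
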